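/- Let $\Omega=(0,1)^2$, let $N$ be a positive integer divisible by $4$, and let $\varepsilon>0$ satisfy $\varepsilon\ln N\le\frac14$; put $\lambda=\varepsilon\ln N$. The one-dimensional Shishkin mesh divides $[0,\lambda]$ and $[1-\lambda,1]$ into $N/4$ equal intervals each and $[\lambda,1-\lambda]$ into $N/2$ equal intervals; $\mathcal T_N$ is the set of the $N^2$ closed rectangles $K$ of the tensor product of this mesh with itself. **Assumption on $u$.** Let $u\in H_0^2(\Omega)\cap H^4(\Omega)$ (so $u=\partial u/\partial n=0$ on $\partial\Omega$) have, on $\bar\Omega$, a decomposition $u=S+\sum_{i=1}^4E_i+E_{12}+E_{23}+E_{34}+E_{14}$ into functions in $C^4(\bar\Omega)$ such that, with a constant $C_0$, for all $(x,y)\in\bar\Omega$ and all $0\le i+j\le4$, $$\Big|\tfrac{\partial^{i+j}S}{\partial x^i\partial y^j}\Big|\le C_0,\qquad \Big|\tfrac{\partial^{i+j}E_1}{\partial x^i\partial y^j}\Big|\le C_0\varepsilon^{1-j}e^{-y/\varepsilon},\qquad \Big|\tfrac{\partial^{i+j}E_{12}}{\partial x^i\partial y^j}\Big|\le C_0\varepsilon^{1-i-j}e^{-x/\varepsilon}e^{-y/\varepsilon},$$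 and with the analogous bounds for the other components: the derivatives of $E_2,E_3,E_4$ are bounded by $C_0\varepsilon^{1-i}e^{-x/\varepsilon}$, $C_0\varepsilon^{1-j}e^{-(1-y)/\varepsilon}$, $C_0\varepsilon^{1-i}e^{-(1-x)/\varepsilon}$, and those of $E_{23},E_{34},E_{14}$ by $C_0\varepsilon^{1-i-j}$ times $e^{-x/\varepsilon}e^{-(1-y)/\varepsilon}$, $e^{-(1-x)/\varepsilon}e^{-(1-y)/\varepsilon}$, $e^{-(1-x)/\varepsilon}e^{-y/\varepsilon}$, respectively. **Discrete space.** The rectangular Morley space $V_N$ consists of the piecewise polynomials $v$ with $v|_K\in\mathrm{span}\{1,x,y,x^2,xy,y^2,x^3,y^3\}$ for each $K\in\mathcal T_N$ that are continuous at all mesh vertices in $\Omega$, vanish at all mesh vertices on $\partial\Omega$, and satisfy $\int_e[\partial v/\partial n_e]\,ds=0$ for every edge $e$ of the mesh, where $[\cdot]$ is the jump across $e$ if $e\not\subset\partial\Omega$ and $[\partial v/\partial n_e]=\partial v/\partial n$ if $e\subset\partial\Omega$. Let $I_Nv$ be the piecewise bilinear function that agrees with $v$ at the mesh vertices, and let $$\|v\|_{\varepsilon,N}^2=\varepsilon^2\sum_{K\in\mathcal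 T_N}\|\Delta v\|_{L^2(K)}^2+\sum_{K\in\mathcal T_N}\|\nabla v\|_{L^2(K)}^2 .$$ **Claim.** There is a constant $C$, depending only on $C_0$ (in particular independent of $\varepsilon$, $N$ and $\xi_N$), such that for all $\varepsilon$, $N$, $u$ as above and all $\xi_N\in V_N$, $$\varepsilon^2\Big|\sum_{K\in\mathcal T_N}\int_{\partial K}\frac{\partial^2u}{\partial n^2}\frac{\partial\xi_N}{\partial n}\,ds\Big|\le C\big(\varepsilon^{1/2}N^{-1}+\varepsilon N^{-1}\ln N+N^{-2}\big)\|\xi_N\|_{\varepsilon,N},$$ $$\varepsilon^2\Big|\sum_{K\in\mathcal T_N}\int_{\partial K}\frac{\partial^2u}{\partial s\partial n}\frac{\partial\xi_N}{\partial s}\,ds\Big|\le C\big(\varepsilon N^{-1}\ln N+N^{-2}\big)\|\xi_N\|_{\varepsilon,N},$$ $$\varepsilon^2\Big|\sum_{K\in\mathcal T_N}\int_K\nabla\Delta u\cdot\nabla(\xi_N-I_N\xi_N)\,dx\,dy\Big|\le C\big(\varepsilon^{1/2}N^{-1}+\varepsilon N^{-1}\ln N+N^{-2}\big)\|\xi_N\|_{\varepsilon,N},$$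 where $\partial/\partial n$ and $\partial/\partial s$ are the outward normal and the tangential derivative along $\partial K$, and derivatives of $\xi_N$ on $K$ or $\partial K$ are those of the polynomial $\xi_N|_K$. -/

import Mathlib

open Set MeasureTheory

namespace ShishkinMorley

/-- The closed unit square, the closure of `Ω = (0,1)²`. -/
def closedSquare : Set (ℝ × ℝ) := Icc (0 : ℝ) 1 ×ˢ Icc (0 : ℝ) 1

/-! ### Derivatives of functions on the closed unit square -/

/-- `∂w/∂x` on the closed square (one-sided on the sides `x = 0` and `x = 1`). -/
noncomputable def partialX (w : ℝ × ℝ → ℝ) (p : ℝ × ℝ) : ℝ :=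
  derivWithin (fun t => w (t, p.2)) (Icc (0 : ℝ) 1) p.1

/-- `∂w/∂y` on the closed square (one-sided on the sides `y = 0` and `y = 1`). -/
noncomputable def partialY (w : ℝ × ℝ → ℝ) (p : ℝ × ℝ) : ℝ :=
  derivWithin (fun t => w (p.1, t)) (Icc (0 : ℝ) 1) p.2

/-- `∂^{i+j} w / ∂x^i ∂y^j`. -/
noncomputable def partialXY (i j : ℕ) (w : ℝ × ℝ → ℝ) : ℝ × ℝ → ℝ :=
  partialX^[i] (partialY^[j] w)

/-- The Laplacian `Δw`. -/
noncomputable def laplacian (w : ℝ × ℝ → ℝ) (p : ℝ × ℝ) : ℝ :=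
  partialXY 2 0 w p + partialXY 0 2 w p

/-! ### The hypotheses on the solution -/

/-- `w ∈ C⁴` on the closed square, and `|∂^{i+j} w / ∂x^i ∂y^j| ≤ C₀ B i j` there
for all `i + j ≤ 4`. -/
def DerivBound (w : ℝ × ℝ → ℝ) (C₀ : ℝ) (B : ℕ → ℕ → ℝ × ℝ → ℝ) : Prop :=
  ContDiffOn ℝ 4 w closedSquare ∧
    ∀ i j : ℕ, i + j ≤ 4 → ∀ p ∈ closedSquare, |partialXY i j w p| ≤ C₀ * B i j p

/-- The decomposition of `u` into a smooth component `S`, boundary layer components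
`E₁, E₂, E₃, E₄` and corner layer components `E₁₂, E₂₃, E₃₄, E₁₄`, with constant `C₀`.
The sides are numbered clockwise: `1` is `y = 0`, `2` is `x = 0`, `3` is `y = 1`, `4` is `x = 1`. -/
def LayerDecomposition (ε C₀ : ℝ) (u : ℝ × ℝ → ℝ) : Prop :=
  ∃ S E₁ E₂ E₃ E₄ E₁₂ E₂₃ E₃₄ E₁₄ : ℝ × ℝ → ℝ,
    (∀ p ∈ closedSquare,
      u p = S p + (E₁ p + E₂ p + E₃ p + E₄ p) + E₁₂ p + E₂₃ p + E₃₄ p + E₁₄ p) ∧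
    DerivBound S C₀ (fun _ _ _ => 1) ∧
    DerivBound E₁ C₀ (fun _ j p => ε ^ (1 - (j : ℤ)) * Real.exp (-p.2 / ε)) ∧
    DerivBound E₂ C₀ (fun i _ p => ε ^ (1 - (i : ℤ)) * Real.exp (-p.1 / ε)) ∧
    DerivBound E₃ C₀ (fun _ j p => ε ^ (1 - (j : ℤ)) * Real.exp (-(1 - p.2) / ε)) ∧
    DerivBound E₄ C₀ (fun i _ p => ε ^ (1 - (i : ℤ)) * Real.exp (-(1 - p.1) / ε)) ∧
    DerivBound E₁₂ C₀ (fun i j p =>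
      ε ^ (1 - (i : ℤ) - (j : ℤ)) * Real.exp (-p.1 / ε) * Real.exp (-p.2 / ε)) ∧
    DerivBound E₂₃ C₀ (fun i j p =>
      ε ^ (1 - (i : ℤ) - (j : ℤ)) * Real.exp (-p.1 / ε) * Real.exp (-(1 - p.2) / ε)) ∧
    DerivBound E₃₄ C₀ (fun i j p =>
      ε ^ (1 - (i : ℤ) - (j : ℤ)) * Real.exp (-(1 - p.1) / ε) * Real.exp (-(1 - p.2) / ε)) ∧
    DerivBound E₁₄ C₀ (fun i j p =>
      ε ^ (1 - (i : ℤ) - (j : ℤ)) * Real.exp (-(1 - p.1) / ε) * Real.exp (-p.2 / ε))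

/-- `u = ∂u/∂n = 0` on the boundary of the square. For functions that are `C⁴` on the closed
square (hence in `H⁴`), as all functions with a layer decomposition are, this is membership
in `H₀² ∩ H⁴`. -/
def Clamped (u : ℝ × ℝ → ℝ) : Prop :=
  ∀ t ∈ Icc (0 : ℝ) 1,
    (u (t, 0) = 0 ∧ u (t, 1) = 0 ∧ u (0, t) = 0 ∧ u (1, t) = 0) ∧
    (partialY u (t, 0) = 0 ∧ partialY u (t, 1) = 0 ∧
      partialX u (0, t) = 0 ∧ partialX u (1, t) = 0)

/-! ### The Shishkin mesh -/

/-- The transition parameter `λ = min {ε ln N, 1/4}`. -/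
noncomputable def transition (ε : ℝ) (N : ℕ) : ℝ := min (ε * Real.log N) (1 / 4)

/-- The `k`-th point, `0 ≤ k ≤ N`, of the one-dimensional Shishkin mesh: `N/4` equal intervals on
`[0,λ]`, `N/2` equal intervals on `[λ,1-λ]`, and `N/4` equal intervals on `[1-λ,1]`. -/
noncomputable def node (ε : ℝ) (N k : ℕ) : ℝ :=
  if 4 * k ≤ N then (k : ℝ) * (transition ε N / ((N : ℝ) / 4))
  else if 4 * k ≤ 3 * N then
    transition ε N + ((k : ℝ) - (N : ℝ) / 4) * ((1 - 2 * transition ε N) / ((N : ℝ) / 2))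
  else
    1 - transition ε N + ((k : ℝ) - 3 * (N : ℝ) / 4) * (transition ε N / ((N : ℝ) / 4))

/-- The mesh rectangle `K = [x_i, x_{i+1}] × [y_j, y_{j+1}]`, `0 ≤ i, j < N`. -/
def cell (ε : ℝ) (N i j : ℕ) : Set (ℝ × ℝ) :=
  Icc (node ε N i) (node ε N (i + 1)) ×ˢ Icc (node ε N j) (node ε N (j + 1))

/-! ### Piecewise polynomials and the rectangular Morley space -/

/-- The shape functions, `span {1, x, y, x², xy, y², x³, y³}`. -/
def shapeSpace : Submodule ℝ (ℝ × ℝ → ℝ) :=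
  Submodule.span ℝ
    {fun _ => 1, fun p => p.1, fun p => p.2, fun p => p.1 ^ 2, fun p => p.1 * p.2,
      fun p => p.2 ^ 2, fun p => p.1 ^ 3, fun p => p.2 ^ 3}

/-- `∂v/∂x` for a polynomial `v`. -/
noncomputable def dx (v : ℝ × ℝ → ℝ) (p : ℝ × ℝ) : ℝ := deriv (fun t => v (t, p.2)) p.1

/-- `∂v/∂y` for a polynomial `v`. -/
noncomputable def dy (v : ℝ × ℝ → ℝ) (p : ℝ × ℝ) : ℝ := deriv (fun t => v (p.1, t)) p.2

/-- The rectangular Morley space `V_N`. A piecewise function `v` is given by the family of the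
polynomials `v i j` that represent it on the cells `(i, j)` with `i, j < N`; members of the
family with other indices are irrelevant. -/
structure IsMorley (ε : ℝ) (N : ℕ) (v : ℕ → ℕ → ℝ × ℝ → ℝ) : Prop where
  /-- the restriction to each mesh rectangle is a shape function -/
  mem_shape : ∀ i < N, ∀ j < N, v i j ∈ shapeSpace
  /-- `v` is continuous at the mesh vertices: any two cells with the common vertex
  `(x_k, y_l)` give the same value there -/
  vertex_continuous : ∀ k ≤ N, ∀ l ≤ N, ∀ i < N, ∀ j < N, ∀ i' < N, ∀ j' < N,
    (i = k ∨ i + 1 = k) → (j = l ∨ j + 1 = l) → (i' = k ∨ i' + 1 = k) → (j' = l ∨ j' + 1 = l) →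
      v i j (node ε N k, node ε N l) = v i' j' (node ε N k, node ε N l)
  /-- `v` vanishes at the mesh vertices on the boundary -/
  vertex_boundary : ∀ k ≤ N, ∀ l ≤ N, (k = 0 ∨ k = N ∨ l = 0 ∨ l = N) → ∀ i < N, ∀ j < N,
    (i = k ∨ i + 1 = k) → (j = l ∨ j + 1 = l) → v i j (node ε N k, node ε N l) = 0
  /-- the jump of the normal derivative has mean zero on interior vertical edges -/
  vertical_edge : ∀ i j : ℕ, i + 1 < N → j < N →
    ∫ y in node ε N j..node ε N (j + 1), dx (v i j) (node ε N (i + 1), y) =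
      ∫ y in node ε N j..node ε N (j + 1), dx (v (i + 1) j) (node ε N (i + 1), y)
  /-- the jump of the normal derivative has mean zero on interior horizontal edges -/
  horizontal_edge : ∀ i j : ℕ, i < N → j + 1 < N →
    ∫ x in node ε N i..node ε N (i + 1), dy (v i j) (x, node ε N (j + 1)) =
      ∫ x in node ε N i..node ε N (i + 1), dy (v i (j + 1)) (x, node ε N (j + 1))
  /-- the normal derivative has mean zero on the edges in the sides `x = 0` and `x = 1` -/
  vertical_boundary : ∀ i < N, ∀ j < N,
    (i = 0 → ∫ y in node ε N j..node ε N (j + 1), dx (v i j) (node ε N i, y) = 0) ∧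
    (i + 1 = N → ∫ y in node ε N j..node ε N (j + 1), dx (v i j) (node ε N (i + 1), y) = 0)
  /-- the normal derivative has mean zero on the edges in the sides `y = 0` and `y = 1` -/
  horizontal_boundary : ∀ i < N, ∀ j < N,
    (j = 0 → ∫ x in node ε N i..node ε N (i + 1), dy (v i j) (x, node ε N j) = 0) ∧
    (j + 1 = N → ∫ x in node ε N i..node ε N (i + 1), dy (v i j) (x, node ε N (j + 1)) = 0)

/-- The bilinear function that agrees with `v` at the vertices of `[a,b] × [c,d]`. -/
noncomputable def bilinearInterp (a b c d : ℝ) (v : ℝ × ℝ → ℝ) (p : ℝ × ℝ) : ℝ :=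
  (v (a, c) * (b - p.1) * (d - p.2) + v (b, c) * (p.1 - a) * (d - p.2)
    + v (a, d) * (b - p.1) * (p.2 - c) + v (b, d) * (p.1 - a) * (p.2 - c))
      / ((b - a) * (d - c))

/-- The piecewise bilinear nodal interpolant `I_N v`, again given cell by cell. -/
noncomputable def nodalInterp (ε : ℝ) (N : ℕ) (v : ℕ → ℕ → ℝ × ℝ → ℝ) (i j : ℕ) : ℝ × ℝ → ℝ :=
  bilinearInterp (node ε N i) (node ε N (i + 1)) (node ε N j) (node ε N (j + 1)) (v i j)

/-- The norm `‖v‖_{ε,N}`, with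
`‖v‖_{ε,N}² = ε² ∑_K ‖Δv‖²_{L²(K)} + ∑_K ‖∇v‖²_{L²(K)}`. -/
noncomputable def energyNorm (ε : ℝ) (N : ℕ) (v : ℕ → ℕ → ℝ × ℝ → ℝ) : ℝ :=
  √(ε ^ 2 * (∑ i ∈ Finset.range N, ∑ j ∈ Finset.range N,
        ∫ p in cell ε N i j, (dx (dx (v i j)) p + dy (dy (v i j)) p) ^ 2)
    + ∑ i ∈ Finset.range N, ∑ j ∈ Finset.range N,
        ∫ p in cell ε N i j, ((dx (v i j) p) ^ 2 + (dy (v i j) p) ^ 2))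

/-! ### The three consistency terms -/

/-- `∫_{∂K} F n ds` for the cell `K = (i, j)`, where `n` is the outward unit normal; the summands
belong to the bottom, top, left and right edge. -/
noncomputable def boundaryIntegral (ε : ℝ) (N i j : ℕ) (F : ℝ × ℝ → ℝ × ℝ → ℝ) : ℝ :=
  (∫ x in node ε N i..node ε N (i + 1), F (0, -1) (x, node ε N j))
  + (∫ x in node ε N i..node ε N (i + 1), F (0, 1) (x, node ε N (j + 1)))
  + (∫ y in node ε N j..node ε N (j + 1), F (-1, 0) (node ε N i, y))
  + (∫ y in node ε N j..node ε N (j + 1), F (1, 0) (node ε N (i + 1), y))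

/-- The second derivative `∂²u/∂a∂b` in the constant directions `a` and `b`. -/
noncomputable def secondDeriv (u : ℝ × ℝ → ℝ) (a b p : ℝ × ℝ) : ℝ :=
  a.1 * b.1 * partialXY 2 0 u p + (a.1 * b.2 + a.2 * b.1) * partialXY 1 1 u p
    + a.2 * b.2 * partialXY 0 2 u p

/-- The derivative `∂v/∂a` of a polynomial `v` in the direction `a`. -/
noncomputable def dirDeriv (v : ℝ × ℝ → ℝ) (a p : ℝ × ℝ) : ℝ := a.1 * dx v p + a.2 * dy v p

/-- The unit tangent, counterclockwise along the boundary of a cell with outward normal `n`. -/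
def tangent (n : ℝ × ℝ) : ℝ × ℝ := (-n.2, n.1)

/-- `∑_K ∫_{∂K} (∂²u/∂n²) (∂v/∂n) ds`. -/
noncomputable def normalSum (ε : ℝ) (N : ℕ) (u : ℝ × ℝ → ℝ) (v : ℕ → ℕ → ℝ × ℝ → ℝ) : ℝ :=
  ∑ i ∈ Finset.range N, ∑ j ∈ Finset.range N,
    boundaryIntegral ε N i j fun n p => secondDeriv u n n p * dirDeriv (v i j) n p

/-- `∑_K ∫_{∂K} (∂²u/∂s∂n) (∂v/∂s) ds`. -/
noncomputable def tangentialSum (ε : ℝ) (N : ℕ) (u : ℝ × ℝ → ℝ) (v : ℕ → ℕ → ℝ × ℝ → ℝ) : ℝ :=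
  ∑ i ∈ Finset.range N, ∑ j ∈ Finset.range N,
    boundaryIntegral ε N i j fun n p =>
      secondDeriv u (tangent n) n p * dirDeriv (v i j) (tangent n) p

/-- `∑_K ∫_K ∇Δu · ∇(v - I_N v) dx dy`. -/
noncomputable def interpSum (ε : ℝ) (N : ℕ) (u : ℝ × ℝ → ℝ) (v : ℕ → ℕ → ℝ × ℝ → ℝ) : ℝ :=
  ∑ i ∈ Finset.range N, ∑ j ∈ Finset.range N, ∫ p in cell ε N i j,
    (partialX (laplacian u) p * dx (v i j - nodalInterp ε N v i j) p
      + partialY (laplacian u) p * dy (v i j - nodalInterp ε N v i j) p)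

end ShishkinMorley

namespace ShishkinMorley

/-! ### Calculus on the closed square -/

/-! Exchanging x and y maps the setting to itself, so only half of each term needs an estimate: the
horizontal edges in the first two, the x-derivative in the third. On a cell with midpoint (a, b) and
sides w, v, the gradient of a shape function is expanded as in `GradCoeffs`, in polynomials
orthogonal on the cell. The energy norm thereby becomes an explicit quadratic form in the
coefficients (`energyNorm_eq`).

Along a horizontal edge each derivative of ξ is its mean plus a function of x of mean zero, and this
function is the same on the top and the bottom edge of a cell. The means are single-valued and
vanish on the boundary: for ∂ξ/∂y by the edge condition, for ∂ξ/∂x because its integral is a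
difference of vertex values. Hence the means telescope, and the fundamental theorem of calculus in y
leaves cell integrals of a third derivative of u against a mean-zero function of x
(`horizontalSum_eq`). The gradient of ξ - Iξ has such a form already. What remains are moments of
u_yyy against c (x - a), and of u_xyy and u_xxx against p₁ (x - a) + p₂ ((x - a)² - w²/12).

For these, u = A + E + D, where A has no layer in x, E has layers in x only, and D is the corner
part. Mean zero lets one subtract the value on the left edge and gain w times an x-derivative. For A
this gives 2/N. For E and D the derivative costs 1/ε, but w = 4 ε log N / N on fine columns; on
coarse columns the layer has decayed to order 1/N and the size of the integrand suffices.
`layerWeight` covers both cases: its squares sum to at most 4 ε (`sum_layerWeight_sq_le`), and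
Cauchy–Schwarz over the cells concludes.

For E_xxx against p₁, p₂ this would give √ε log N / N, a logarithm too much. On fine columns p₁ is
therefore written as (p₁ + q₁) - q₁. The numbers p₁ + q₁ and p₂ are controlled by ε ‖Δξ‖, which
gains w/ε, and w²/ε is at most 64 ε / N since log² N ≤ 4 N. The number v q₁ is the difference of the
means of ∂ξ/∂y over the top and bottom edges; against moments of E_xxx along the mesh lines it
telescopes to zero, up to an error involving the y-derivative of E_xxx, which costs no power of ε
(`abs_sum_moment_boundary_le`). -/

theorem uniqueDiffOn_closedSquare : UniqueDiffOn ℝ closedSquare :=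
  (uniqueDiffOn_Icc zero_lt_one).prod (uniqueDiffOn_Icc zero_lt_one)

theorem closedSquare_subset_closure_interior : closedSquare ⊆ closure (interior closedSquare) := by
  rw [closedSquare, interior_prod_eq, closure_prod_eq, interior_Icc, closure_Ioo zero_ne_one]

theorem swap_mem_closedSquare {p : ℝ × ℝ} (hp : p ∈ closedSquare) : p.swap ∈ closedSquare :=
  ⟨hp.2, hp.1⟩

theorem hasDerivWithinAt_fst {w : ℝ × ℝ → ℝ} (hw : DifferentiableOn ℝ w closedSquare)
    {p : ℝ × ℝ} (hp : p ∈ closedSquare) :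
    HasDerivWithinAt (fun t => w (t, p.2)) (fderivWithin ℝ w closedSquare p (1, 0))
      (Icc (0 : ℝ) 1) p.1 := by
  have h1 : HasFDerivWithinAt w (fderivWithin ℝ w closedSquare p) closedSquare (p.1, p.2) :=
    (hw p hp).hasFDerivWithinAt
  have h2 : HasDerivWithinAt (fun t : ℝ => (t, p.2)) ((1 : ℝ), (0 : ℝ)) (Icc (0 : ℝ) 1) p.1 :=
    (hasDerivWithinAt_id _ _).prodMk (hasDerivWithinAt_const _ _ _)
  exact h1.comp_hasDerivWithinAt p.1 h2 fun t ht => mk_mem_prod ht hp.2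

theorem hasDerivWithinAt_snd {w : ℝ × ℝ → ℝ} (hw : DifferentiableOn ℝ w closedSquare)
    {p : ℝ × ℝ} (hp : p ∈ closedSquare) :
    HasDerivWithinAt (fun t => w (p.1, t)) (fderivWithin ℝ w closedSquare p (0, 1))
      (Icc (0 : ℝ) 1) p.2 := by
  have h1 : HasFDerivWithinAt w (fderivWithin ℝ w closedSquare p) closedSquare (p.1, p.2) :=
    (hw p hp).hasFDerivWithinAt
  have h2 : HasDerivWithinAt (fun t : ℝ => (p.1, t)) ((0 : ℝ), (1 : ℝ)) (Icc (0 : ℝ) 1) p.2 :=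
    (hasDerivWithinAt_const _ _ _).prodMk (hasDerivWithinAt_id _ _)
  exact h1.comp_hasDerivWithinAt p.2 h2 fun t ht => mk_mem_prod hp.1 ht

theorem partialX_eq_fderivWithin {w : ℝ × ℝ → ℝ} (hw : DifferentiableOn ℝ w closedSquare) :
    EqOn (partialX w) (fun p => fderivWithin ℝ w closedSquare p (1, 0)) closedSquare :=
  fun p hp => (hasDerivWithinAt_fst hw hp).derivWithin (uniqueDiffOn_Icc zero_lt_one p.1 hp.1)

theorem partialY_eq_fderivWithin {w : ℝ × ℝ → ℝ} (hw : DifferentiableOn ℝ w closedSquare) :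
    EqOn (partialY w) (fun p => fderivWithin ℝ w closedSquare p (0, 1)) closedSquare :=
  fun p hp => (hasDerivWithinAt_snd hw hp).derivWithin (uniqueDiffOn_Icc zero_lt_one p.2 hp.2)

theorem hasDerivWithinAt_partialX {w : ℝ × ℝ → ℝ} (hw : ContDiffOn ℝ 1 w closedSquare)
    {p : ℝ × ℝ} (hp : p ∈ closedSquare) :
    HasDerivWithinAt (fun t => w (t, p.2)) (partialX w p) (Icc (0 : ℝ) 1) p.1 := by
  have hd := hw.differentiableOn one_ne_zero
  rw [partialX_eq_fderivWithin hd hp]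
  exact hasDerivWithinAt_fst hd hp

theorem hasDerivWithinAt_partialY {w : ℝ × ℝ → ℝ} (hw : ContDiffOn ℝ 1 w closedSquare)
    {p : ℝ × ℝ} (hp : p ∈ closedSquare) :
    HasDerivWithinAt (fun t => w (p.1, t)) (partialY w p) (Icc (0 : ℝ) 1) p.2 := by
  have hd := hw.differentiableOn one_ne_zero
  rw [partialY_eq_fderivWithin hd hp]
  exact hasDerivWithinAt_snd hd hp

theorem contDiffOn_partialX {n : ℕ} {w : ℝ × ℝ → ℝ}
    (hw : ContDiffOn ℝ ((n + 1 : ℕ) : WithTop ℕ∞) w closedSquare) :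
    ContDiffOn ℝ n (partialX w) closedSquare := by
  refine ContDiffOn.congr ?_ (partialX_eq_fderivWithin (hw.differentiableOn (by simp)))
  exact (hw.fderivWithin uniqueDiffOn_closedSquare (by norm_cast)).clm_apply contDiffOn_const

theorem contDiffOn_partialY {n : ℕ} {w : ℝ × ℝ → ℝ}
    (hw : ContDiffOn ℝ ((n + 1 : ℕ) : WithTop ℕ∞) w closedSquare) :
    ContDiffOn ℝ n (partialY w) closedSquare := by
  refine ContDiffOn.congr ?_ (partialY_eq_fderivWithin (hw.differentiableOn (by simp)))
  exact (hw.fderivWithin uniqueDiffOn_closedSquare (by norm_cast)).clm_apply contDiffOn_const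

theorem partialX_congr {f g : ℝ × ℝ → ℝ} (h : EqOn f g closedSquare) :
    EqOn (partialX f) (partialX g) closedSquare :=
  fun _ hp => derivWithin_congr (fun _ ht => h ⟨ht, hp.2⟩) (h hp)

theorem partialY_congr {f g : ℝ × ℝ → ℝ} (h : EqOn f g closedSquare) :
    EqOn (partialY f) (partialY g) closedSquare :=
  fun _ hp => derivWithin_congr (fun _ ht => h ⟨hp.1, ht⟩) (h hp)

theorem iterate_partialX_congr {f g : ℝ × ℝ → ℝ} (h : EqOn f g closedSquare) (i : ℕ) :
    EqOn (partialX^[i] f) (partialX^[i] g) closedSquare := by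
  induction i with
  | zero => exact h
  | succ i ih =>
    simp only [Function.iterate_succ_apply']
    exact partialX_congr ih

theorem iterate_partialY_congr {f g : ℝ × ℝ → ℝ} (h : EqOn f g closedSquare) (i : ℕ) :
    EqOn (partialY^[i] f) (partialY^[i] g) closedSquare := by
  induction i with
  | zero => exact h
  | succ i ih =>
    simp only [Function.iterate_succ_apply']
    exact partialY_congr ih

theorem partialXY_congr {f g : ℝ × ℝ → ℝ} (h : EqOn f g closedSquare) (i j : ℕ) :
    EqOn (partialXY i j f) (partialXY i j g) closedSquare :=
  iterate_partialX_congr (iterate_partialY_congr h j) i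

theorem contDiffOn_iterate_partialX {w : ℝ × ℝ → ℝ} (i : ℕ) :
    ∀ {n : ℕ}, ContDiffOn ℝ ((n + i : ℕ) : WithTop ℕ∞) w closedSquare →
      ContDiffOn ℝ n (partialX^[i] w) closedSquare := by
  induction i with
  | zero => intro n h; exact h
  | succ i ih =>
    intro n h
    rw [Function.iterate_succ_apply']
    exact contDiffOn_partialX (ih (by rwa [show n + 1 + i = n + (i + 1) by ring]))

theorem contDiffOn_iterate_partialY {w : ℝ × ℝ → ℝ} (i : ℕ) :
    ∀ {n : ℕ}, ContDiffOn ℝ ((n + i : ℕ) : WithTop ℕ∞) w closedSquare →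
      ContDiffOn ℝ n (partialY^[i] w) closedSquare := by
  induction i with
  | zero => intro n h; exact h
  | succ i ih =>
    intro n h
    rw [Function.iterate_succ_apply']
    exact contDiffOn_partialY (ih (by rwa [show n + 1 + i = n + (i + 1) by ring]))

theorem contDiffOn_partialXY {w : ℝ × ℝ → ℝ} {n : ℕ} (i j : ℕ)
    (hw : ContDiffOn ℝ ((n + i + j : ℕ) : WithTop ℕ∞) w closedSquare) :
    ContDiffOn ℝ n (partialXY i j w) closedSquare :=
  contDiffOn_iterate_partialX i (contDiffOn_iterate_partialY j hw)

/-- Symmetry of the second derivative persists on the sides and at the corners because every point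
of the square is a limit of interior points. -/
theorem partialX_partialY_comm {w : ℝ × ℝ → ℝ} (hw : ContDiffOn ℝ 2 w closedSquare) :
    EqOn (partialX (partialY w)) (partialY (partialX w)) closedSquare := by
  intro p hp
  have hd : DifferentiableOn ℝ w closedSquare := hw.differentiableOn two_ne_zero
  have hf : ContDiffOn ℝ 1 (fderivWithin ℝ w closedSquare) closedSquare :=
    hw.fderivWithin uniqueDiffOn_closedSquare (by norm_num)
  have hfd := hf.differentiableOn one_ne_zero
  have hu := uniqueDiffOn_closedSquare p hp
  have key : ∀ a b : ℝ × ℝ,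
      fderivWithin ℝ (fun q => fderivWithin ℝ w closedSquare q a) closedSquare p b =
        fderivWithin ℝ (fderivWithin ℝ w closedSquare) closedSquare p b a := by
    intro a b
    have := ((hfd p hp).hasFDerivWithinAt.clm_apply
      (hasFDerivWithinAt_const a p closedSquare)).fderivWithin hu
    rw [this]
    simp
  have hdiff : ∀ a : ℝ × ℝ,
      DifferentiableOn ℝ (fun q => fderivWithin ℝ w closedSquare q a) closedSquare :=
    fun a => hfd.clm_apply (differentiableOn_const a)
  have hsymm := (hw p hp).isSymmSndFDerivWithinAt (by simp) uniqueDiffOn_closedSquare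
    (closedSquare_subset_closure_interior hp) hp
  rw [partialX_congr (partialY_eq_fderivWithin hd) hp,
    partialY_congr (partialX_eq_fderivWithin hd) hp,
    partialX_eq_fderivWithin (hdiff _) hp, partialY_eq_fderivWithin (hdiff _) hp]
  simp only [key]
  exact hsymm _ _

/-- `partialXY` takes the y-derivatives first, so a further x-derivative is free, while a further
y-derivative has to be commuted past all the x-derivatives. -/
theorem partialY_iterate_partialX {w : ℝ × ℝ → ℝ} (i : ℕ)
    (hw : ContDiffOn ℝ ((i + 1 : ℕ) : WithTop ℕ∞) w closedSquare) :
    EqOn (partialY (partialX^[i] w)) (partialX^[i] (partialY w)) closedSquare := by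
  induction i with
  | zero => exact fun _ _ => rfl
  | succ i ih =>
    simp only [Function.iterate_succ_apply']
    have h2 : ContDiffOn ℝ ((2 : ℕ) : WithTop ℕ∞) (partialX^[i] w) closedSquare :=
      contDiffOn_iterate_partialX i (by rwa [show 2 + i = i + 1 + 1 by ring])
    refine (partialX_partialY_comm h2).symm.trans (partialX_congr (ih (hw.of_le ?_)))
    exact_mod_cast Nat.le_succ _

theorem partialY_partialXY {w : ℝ × ℝ → ℝ} (i j : ℕ)
    (hw : ContDiffOn ℝ ((i + j + 1 : ℕ) : WithTop ℕ∞) w closedSquare) :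
    EqOn (partialY (partialXY i j w)) (partialXY i (j + 1) w) closedSquare := by
  have := partialY_iterate_partialX (w := partialY^[j] w) i
    (contDiffOn_iterate_partialY j (by rwa [show i + 1 + j = i + j + 1 by ring]))
  rw [partialXY, partialXY, Function.iterate_succ_apply']
  exact this

theorem partialX_partialXY (w : ℝ × ℝ → ℝ) (i j : ℕ) :
    partialX (partialXY i j w) = partialXY (i + 1) j w := by
  rw [partialXY, partialXY, Function.iterate_succ_apply']

/-! ### Exchange of the two variables in derivatives. -/

theorem iterate_partialX_swap (w : ℝ × ℝ → ℝ) (i : ℕ) :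
    partialX^[i] (w ∘ Prod.swap) = (partialY^[i] w) ∘ Prod.swap := by
  induction i with
  | zero => rfl
  | succ i ih => rw [Function.iterate_succ_apply', Function.iterate_succ_apply', ih]; rfl

theorem iterate_partialY_swap (w : ℝ × ℝ → ℝ) (i : ℕ) :
    partialY^[i] (w ∘ Prod.swap) = (partialX^[i] w) ∘ Prod.swap := by
  induction i with
  | zero => rfl
  | succ i ih => rw [Function.iterate_succ_apply', Function.iterate_succ_apply', ih]; rfl

theorem iterate_partialY_iterate_partialX {w : ℝ × ℝ → ℝ} (i j : ℕ)
    (hw : ContDiffOn ℝ ((i + j : ℕ) : WithTop ℕ∞) w closedSquare) :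
    EqOn (partialY^[j] (partialX^[i] w)) (partialXY i j w) closedSquare := by
  induction j with
  | zero => exact fun _ _ => rfl
  | succ j ih =>
    rw [Function.iterate_succ_apply']
    exact (partialY_congr (ih (hw.of_le (by exact_mod_cast Nat.le_succ _)))).trans
      (partialY_partialXY i j hw)

theorem partialXY_swap {w : ℝ × ℝ → ℝ} (i j : ℕ)
    (hw : ContDiffOn ℝ ((i + j : ℕ) : WithTop ℕ∞) w closedSquare) :
    EqOn (partialXY i j (w ∘ Prod.swap)) (partialXY j i w ∘ Prod.swap) closedSquare := by
  intro p hp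
  rw [partialXY, iterate_partialY_swap, iterate_partialX_swap]
  exact iterate_partialY_iterate_partialX j i (by rwa [add_comm]) (swap_mem_closedSquare hp)

/-! ### Additivity of the derivatives. -/

theorem partialX_add {f g : ℝ × ℝ → ℝ} (hf : ContDiffOn ℝ 1 f closedSquare)
    (hg : ContDiffOn ℝ 1 g closedSquare) :
    EqOn (partialX (f + g)) (partialX f + partialX g) closedSquare := fun p hp =>
  ((hasDerivWithinAt_partialX hf hp).add (hasDerivWithinAt_partialX hg hp)).derivWithin
    (uniqueDiffOn_Icc zero_lt_one p.1 hp.1)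

theorem partialY_add {f g : ℝ × ℝ → ℝ} (hf : ContDiffOn ℝ 1 f closedSquare)
    (hg : ContDiffOn ℝ 1 g closedSquare) :
    EqOn (partialY (f + g)) (partialY f + partialY g) closedSquare := fun p hp =>
  ((hasDerivWithinAt_partialY hf hp).add (hasDerivWithinAt_partialY hg hp)).derivWithin
    (uniqueDiffOn_Icc zero_lt_one p.2 hp.2)

theorem iterate_partialX_add {f g : ℝ × ℝ → ℝ} (i : ℕ)
    (hf : ContDiffOn ℝ (i : WithTop ℕ∞) f closedSquare)
    (hg : ContDiffOn ℝ (i : WithTop ℕ∞) g closedSquare) :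
    EqOn (partialX^[i] (f + g)) (partialX^[i] f + partialX^[i] g) closedSquare := by
  induction i with
  | zero => exact fun _ _ => rfl
  | succ i ih =>
    have hle : ((i : ℕ) : WithTop ℕ∞) ≤ ((i + 1 : ℕ) : WithTop ℕ∞) := by
      exact_mod_cast Nat.le_succ _
    simp only [Function.iterate_succ_apply']
    refine (partialX_congr (ih (hf.of_le hle) (hg.of_le hle))).trans (partialX_add ?_ ?_)
    · exact_mod_cast contDiffOn_iterate_partialX (n := 1) i (by rwa [add_comm])
    · exact_mod_cast contDiffOn_iterate_partialX (n := 1) i (by rwa [add_comm])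

theorem iterate_partialY_add {f g : ℝ × ℝ → ℝ} (i : ℕ)
    (hf : ContDiffOn ℝ (i : WithTop ℕ∞) f closedSquare)
    (hg : ContDiffOn ℝ (i : WithTop ℕ∞) g closedSquare) :
    EqOn (partialY^[i] (f + g)) (partialY^[i] f + partialY^[i] g) closedSquare := by
  induction i with
  | zero => exact fun _ _ => rfl
  | succ i ih =>
    have hle : ((i : ℕ) : WithTop ℕ∞) ≤ ((i + 1 : ℕ) : WithTop ℕ∞) := by
      exact_mod_cast Nat.le_succ _
    simp only [Function.iterate_succ_apply']
    refine (partialY_congr (ih (hf.of_le hle) (hg.of_le hle))).trans (partialY_add ?_ ?_)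
    · exact_mod_cast contDiffOn_iterate_partialY (n := 1) i (by rwa [add_comm])
    · exact_mod_cast contDiffOn_iterate_partialY (n := 1) i (by rwa [add_comm])

theorem partialXY_add {f g : ℝ × ℝ → ℝ} (i j : ℕ)
    (hf : ContDiffOn ℝ ((i + j : ℕ) : WithTop ℕ∞) f closedSquare)
    (hg : ContDiffOn ℝ ((i + j : ℕ) : WithTop ℕ∞) g closedSquare) :
    EqOn (partialXY i j (f + g)) (partialXY i j f + partialXY i j g) closedSquare := by
  have hle : ((j : ℕ) : WithTop ℕ∞) ≤ ((i + j : ℕ) : WithTop ℕ∞) := by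
    exact_mod_cast Nat.le_add_left _ _
  exact (iterate_partialX_congr
    (iterate_partialY_add j (hf.of_le hle) (hg.of_le hle)) i).trans
    (iterate_partialX_add i (contDiffOn_iterate_partialY j hf) (contDiffOn_iterate_partialY j hg))

/-! ### Derivative bounds under sums and exchange of variables. -/

namespace DerivBound

variable {f g : ℝ × ℝ → ℝ} {C₀ : ℝ} {B B' : ℕ → ℕ → ℝ × ℝ → ℝ}

theorem contDiffOn_partialXY (hf : DerivBound f C₀ B) {i j n : ℕ} (h : n + i + j ≤ 4) :
    ContDiffOn ℝ n (partialXY i j f) closedSquare :=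
  ShishkinMorley.contDiffOn_partialXY i j (hf.1.of_le (by exact_mod_cast h))

theorem add (hf : DerivBound f C₀ B) (hg : DerivBound g C₀ B') :
    DerivBound (f + g) C₀ (B + B') := by
  refine ⟨hf.1.add hg.1, fun i j hij p hp => ?_⟩
  have hle : ((i + j : ℕ) : WithTop ℕ∞) ≤ 4 := by exact_mod_cast hij
  rw [partialXY_add i j (hf.1.of_le hle) (hg.1.of_le hle) hp]
  refine (abs_add_le _ _).trans ?_
  have := add_le_add (hf.2 i j hij p hp) (hg.2 i j hij p hp)
  simpa [mul_add] using this

theorem swap (hf : DerivBound f C₀ B) :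
    DerivBound (f ∘ Prod.swap) C₀ (fun i j p => B j i p.swap) := by
  refine ⟨hf.1.comp (contDiff_snd.prodMk contDiff_fst).contDiffOn fun p hp => swap_mem_closedSquare hp,
    fun i j hij p hp => ?_⟩
  rw [partialXY_swap i j (hf.1.of_le (by exact_mod_cast hij)) hp]
  exact hf.2 j i (by omega) p.swap (swap_mem_closedSquare hp)

end DerivBound

/-! ### Grouping the layer components -/

/-- The sum of the two boundary layer profiles in one variable. -/
noncomputable def layer (ε x : ℝ) : ℝ := Real.exp (-x / ε) + Real.exp (-(1 - x) / ε)

/-- `u` is the sum of a part `A` without layers in `x`, a part `E` without layers in `y`, and the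
corner part `D`. -/
structure LayerSplit (ε C₀ : ℝ) (u A E D : ℝ × ℝ → ℝ) : Prop where
  eqOn : EqOn u (A + E + D) closedSquare
  boundA : DerivBound A C₀ (fun _ j p => 1 + ε ^ (1 - (j : ℤ)) * layer ε p.2)
  boundE : DerivBound E C₀ (fun i _ p => ε ^ (1 - (i : ℤ)) * layer ε p.1)
  boundD : DerivBound D C₀
    (fun i j p => ε ^ (1 - (i : ℤ) - (j : ℤ)) * (layer ε p.1 * layer ε p.2))

theorem DerivBound.congr {f : ℝ × ℝ → ℝ} {C₀ : ℝ} {B B' : ℕ → ℕ → ℝ × ℝ → ℝ}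
    (hf : DerivBound f C₀ B) (h : ∀ i j p, B i j p = B' i j p) : DerivBound f C₀ B' := by
  have : B = B' := by
    funext i j p
    exact h i j p
  rwa [← this]

/-- All moments are taken against functions of x, so the only distinction that matters is which
components have a layer in x and which of those also have one in y. -/
theorem LayerDecomposition.exists_layerSplit {ε C₀ : ℝ} {u : ℝ × ℝ → ℝ}
    (h : LayerDecomposition ε C₀ u) : ∃ A E D, LayerSplit ε C₀ u A E D := by
  obtain ⟨S, E₁, E₂, E₃, E₄, E₁₂, E₂₃, E₃₄, E₁₄, hu, hS, h1, h2, h3, h4, h12, h23, h34, h14⟩ := h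
  refine ⟨S + E₁ + E₃, E₂ + E₄, E₁₂ + E₂₃ + E₃₄ + E₁₄, ?_, ?_, ?_, ?_⟩
  · intro p hp
    rw [hu p hp]
    simp only [Pi.add_apply]
    ring
  · refine ((hS.add h1).add h3).congr fun i j p => ?_
    simp only [Pi.add_apply, layer]
    ring
  · refine (h2.add h4).congr fun i j p => ?_
    simp only [Pi.add_apply, layer]
    ring
  · refine (((h12.add h23).add h34).add h14).congr fun i j p => ?_
    simp only [Pi.add_apply, layer]
    ring

/-- Reflection in the diagonal exchanges the sides 1 and 2, the sides 3 and 4, and the corners 23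
and 14; it fixes the corners 12 and 34. -/
theorem LayerDecomposition.swap {ε C₀ : ℝ} {u : ℝ × ℝ → ℝ} (h : LayerDecomposition ε C₀ u) :
    LayerDecomposition ε C₀ (u ∘ Prod.swap) := by
  obtain ⟨S, E₁, E₂, E₃, E₄, E₁₂, E₂₃, E₃₄, E₁₄, hu, hS, h1, h2, h3, h4, h12, h23, h34, h14⟩ := h
  have hz : ∀ i j : ℕ, ε ^ (1 - (j : ℤ) - (i : ℤ)) = ε ^ (1 - (i : ℤ) - (j : ℤ)) := fun i j => by
    congr 1
    ring
  refine ⟨S ∘ Prod.swap, E₂ ∘ Prod.swap, E₁ ∘ Prod.swap, E₄ ∘ Prod.swap, E₃ ∘ Prod.swap,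
    E₁₂ ∘ Prod.swap, E₁₄ ∘ Prod.swap, E₃₄ ∘ Prod.swap, E₂₃ ∘ Prod.swap, fun p hp => ?_,
    hS.swap, h2.swap, h1.swap, h4.swap, h3.swap, h12.swap.congr fun i j p => ?_,
    h14.swap.congr fun i j p => ?_, h34.swap.congr fun i j p => ?_,
    h23.swap.congr fun i j p => ?_⟩
  · simp only [Function.comp]
    rw [hu _ (swap_mem_closedSquare hp)]
    ring
  all_goals
    simp only [hz i j, Prod.fst_swap, Prod.snd_swap]
    ring

theorem LayerDecomposition.contDiffOn {ε C₀ : ℝ} {u : ℝ × ℝ → ℝ}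
    (h : LayerDecomposition ε C₀ u) : ContDiffOn ℝ 4 u closedSquare := by
  obtain ⟨A, E, D, hs⟩ := h.exists_layerSplit
  exact ((hs.boundA.1.add hs.boundE.1).add hs.boundD.1).congr hs.eqOn

theorem LayerSplit.partialXY_eq {ε C₀ : ℝ} {u A E D : ℝ × ℝ → ℝ} (h : LayerSplit ε C₀ u A E D)
    {i j : ℕ} (hij : i + j ≤ 4) :
    EqOn (partialXY i j u) (partialXY i j A + partialXY i j E + partialXY i j D)
      closedSquare := by
  have hle : ((i + j : ℕ) : WithTop ℕ∞) ≤ 4 := by exact_mod_cast hij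
  have hA := h.boundA.1.of_le hle
  have hE := h.boundE.1.of_le hle
  have hD := h.boundD.1.of_le hle
  have hAE : ContDiffOn ℝ ((i + j : ℕ) : WithTop ℕ∞) (A + E) closedSquare := hA.add hE
  intro p hp
  rw [partialXY_congr h.eqOn i j hp, partialXY_add i j hAE hD hp, Pi.add_apply,
    partialXY_add i j hA hE hp]
  rfl

/-- A negative C₀ admits no decomposition, as the bound at the origin shows; this is why the final
constant may be a plain multiple of C₀. -/
theorem LayerSplit.nonneg {ε C₀ : ℝ} (hε : 0 < ε) {u A E D : ℝ × ℝ → ℝ}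
    (h : LayerSplit ε C₀ u A E D) : 0 ≤ C₀ := by
  have h0 : ((0 : ℝ), (0 : ℝ)) ∈ closedSquare := ⟨by simp, by simp⟩
  have := (abs_nonneg _).trans (h.boundE.2 0 0 (by norm_num) _ h0)
  have hp : 0 < ε ^ (1 - ((0 : ℕ) : ℤ)) * layer ε 0 := by
    unfold layer
    positivity
  exact nonneg_of_mul_nonneg_left this hp

/-! ### The layer profile -/

theorem layer_pos (ε x : ℝ) : 0 < layer ε x := by
  unfold layer
  positivity

theorem continuous_layer (ε : ℝ) : Continuous (layer ε) := by
  unfold layer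
  fun_prop

theorem layer_le_exp_mul {ε x y δ : ℝ} (hε : 0 < ε) (h : |x - y| ≤ δ) :
    layer ε x ≤ Real.exp (δ / ε) * layer ε y := by
  rw [abs_le] at h
  unfold layer
  rw [mul_add, ← Real.exp_add, ← Real.exp_add, ← add_div, ← add_div]
  gcongr <;> linarith

/-- Integral of the squared profile over an interval. -/
theorem integral_layer_sq_le {ε a b : ℝ} (hε : 0 < ε) (hab : a ≤ b) :
    ∫ x in a..b, layer ε x ^ 2 ≤
      ε * (Real.exp (-2 * a / ε) + Real.exp (-2 * (1 - b) / ε)) := by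
  -- The square of a sum is at most twice the sum of the squares, and that majorant has this
  -- explicit antiderivative. Its values at the far ends enter with a negative sign and are dropped
  -- at the end.
  have hd : ∀ x ∈ uIcc a b, HasDerivAt
      (fun x => ε * (Real.exp (-2 * (1 - x) / ε) - Real.exp (-2 * x / ε)))
      (2 * (Real.exp (-2 * (1 - x) / ε) + Real.exp (-2 * x / ε))) x := by
    intro x _
    have h1 : HasDerivAt (fun x : ℝ => -2 * (1 - x) / ε) (2 / ε) x := by
      have := (((hasDerivAt_id x).const_sub 1).const_mul (-2 : ℝ)).div_const ε
      simpa using this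
    have h2 : HasDerivAt (fun x : ℝ => -2 * x / ε) (-2 / ε) x := by
      have := ((hasDerivAt_id x).const_mul (-2 : ℝ)).div_const ε
      simpa using this
    refine ((h1.exp.sub h2.exp).const_mul ε).congr_deriv ?_
    field_simp
    ring
  have hc : Continuous fun x : ℝ => 2 * (Real.exp (-2 * (1 - x) / ε) + Real.exp (-2 * x / ε)) := by
    fun_prop
  have hle : ∀ x ∈ Icc a b, layer ε x ^ 2 ≤
      2 * (Real.exp (-2 * (1 - x) / ε) + Real.exp (-2 * x / ε)) := by
    intro x _
    have e1 : Real.exp (-2 * (1 - x) / ε) = Real.exp (-(1 - x) / ε) ^ 2 := by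
      rw [← Real.exp_nat_mul]
      congr 1
      push_cast
      ring
    have e2 : Real.exp (-2 * x / ε) = Real.exp (-x / ε) ^ 2 := by
      rw [← Real.exp_nat_mul]
      congr 1
      push_cast
      ring
    rw [e1, e2, layer]
    nlinarith [sq_nonneg (Real.exp (-x / ε) - Real.exp (-(1 - x) / ε))]
  have hint : IntervalIntegrable (fun x => layer ε x ^ 2) volume a b :=
    ((continuous_layer ε).pow 2).intervalIntegrable a b
  have hi := intervalIntegral.integral_mono_on hab hint (hc.intervalIntegrable a b) hle
  rw [intervalIntegral.integral_eq_sub_of_hasDerivAt hd (hc.intervalIntegrable a b)] at hi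
  refine hi.trans ?_
  have p1 := (Real.exp_pos (-2 * b / ε)).le
  have p2 := (Real.exp_pos (-2 * (1 - a) / ε)).le
  nlinarith

/-- Cauchy–Schwarz against the constant function. -/
theorem sq_integral_le {f : ℝ → ℝ} (hf : Continuous f) {a b : ℝ} (hab : a < b) :
    (∫ x in a..b, f x) ^ 2 ≤ (b - a) * ∫ x in a..b, f x ^ 2 := by
  set r := ∫ x in a..b, f x with hr
  have h0 : 0 ≤ ∫ x in a..b, ((b - a) * f x - r) ^ 2 :=
    intervalIntegral.integral_nonneg hab.le fun x _ => sq_nonneg _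
  have h1 : ∫ x in a..b, ((b - a) * f x - r) ^ 2 =
      (b - a) ^ 2 * (∫ x in a..b, f x ^ 2) - 2 * (b - a) * r * r + (b - a) * r ^ 2 := by
    have : ∀ x, ((b - a) * f x - r) ^ 2 =
        (b - a) ^ 2 * f x ^ 2 - 2 * (b - a) * r * f x + r ^ 2 := fun x => by ring
    simp only [this]
    rw [intervalIntegral.integral_add, intervalIntegral.integral_sub,
      intervalIntegral.integral_const_mul, intervalIntegral.integral_const_mul,
      intervalIntegral.integral_const, smul_eq_mul]
    all_goals exact Continuous.intervalIntegrable (by fun_prop) _ _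
  rw [h1] at h0
  have hba : 0 < b - a := sub_pos.2 hab
  nlinarith

/-! ### The mesh -/

/-- The standing assumptions on the mesh parameters. -/
structure Admissible (ε : ℝ) (N : ℕ) : Prop where
  eps_pos : 0 < ε
  pos : 0 < N
  four_dvd : 4 ∣ N
  eps_log_le : ε * Real.log N ≤ 1 / 4

/-- The index of a mesh interval in the fine part of the mesh. -/
def IsFine (N i : ℕ) : Prop := 4 * i < N ∨ 3 * N ≤ 4 * i

instance (N i : ℕ) : Decidable (IsFine N i) := by
  unfold IsFine
  infer_instance

/-- The length of a mesh interval. -/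
noncomputable def width (ε : ℝ) (N i : ℕ) : ℝ := node ε N (i + 1) - node ε N i

/-- The midpoint of a mesh interval. -/
noncomputable def center (ε : ℝ) (N i : ℕ) : ℝ := (node ε N i + node ε N (i + 1)) / 2

/-- The integral of the layer profile over a mesh interval. -/
noncomputable def layerMass (ε : ℝ) (N i : ℕ) : ℝ :=
  ∫ x in node ε N i..node ε N (i + 1), layer ε x

/-- The layer mass divided by the root of the length, amplified by `N` in the coarse part of the
mesh. -/
noncomputable def layerWeight (ε : ℝ) (N i : ℕ) : ℝ :=
  (if IsFine N i then 1 else (N : ℝ)) * (layerMass ε N i / √(width ε N i))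

/-! ### Geometry of the mesh and size of the layer weights. -/

namespace Admissible

variable {ε : ℝ} {N : ℕ}

theorem four_le (h : Admissible ε N) : (4 : ℝ) ≤ N := by
  exact_mod_cast Nat.le_of_dvd h.pos h.four_dvd

theorem cast_pos (h : Admissible ε N) : (0 : ℝ) < N := by linarith [h.four_le]

/-- N ≥ 4 exceeds e. This is what absorbs a bare ε/N into ε log N / N. -/
theorem one_le_log (h : Admissible ε N) : 1 ≤ Real.log N := by
  rw [Real.le_log_iff_exp_le h.cast_pos]
  linarith [Real.exp_one_lt_d9, h.four_le]

theorem log_le (h : Admissible ε N) : Real.log N ≤ N := by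
  linarith [Real.log_le_sub_one_of_pos h.cast_pos]

theorem eps_le_one (h : Admissible ε N) : ε ≤ 1 := by
  nlinarith [h.eps_log_le, h.one_le_log, h.eps_pos]

theorem transition_eq (h : Admissible ε N) : transition ε N = ε * Real.log N :=
  min_eq_left h.eps_log_le

theorem transition_pos (h : Admissible ε N) : 0 < transition ε N := by
  rw [h.transition_eq]
  exact mul_pos h.eps_pos (by linarith [h.one_le_log])

theorem transition_le (_h : Admissible ε N) : transition ε N ≤ 1 / 4 := min_le_right _ _

theorem node_zero (_h : Admissible ε N) : node ε N 0 = 0 := by simp [node]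

theorem node_of_le (_h : Admissible ε N) {k : ℕ} (hk : 4 * k ≤ N) :
    node ε N k = k * (4 * transition ε N / N) := by
  rw [node, if_pos hk]
  ring

/-- The formula also holds at the transition index 4k = N, where `node` takes its first branch, so
that each coarse interval can be measured with a single formula. `node_of_ge` does the same at 4k =
3N. -/
theorem node_mid (h : Admissible ε N) {k : ℕ} (hk : N ≤ 4 * k) (hk' : 4 * k ≤ 3 * N) :
    node ε N k = transition ε N + (k - N / 4) * (2 * (1 - 2 * transition ε N) / N) := by
  have hN := h.cast_pos
  rcases eq_or_lt_of_le hk with he | hlt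
  · have : (N : ℝ) = 4 * k := by exact_mod_cast he
    rw [h.node_of_le he.ge, this]
    have : (k : ℝ) ≠ 0 := by
      rintro h0
      rw [h0] at this
      linarith
    field_simp
    ring
  · rw [node, if_neg (by omega), if_pos hk']
    ring

theorem node_of_ge (h : Admissible ε N) {k : ℕ} (hk : 3 * N ≤ 4 * k) :
    node ε N k = 1 - transition ε N + (k - 3 * N / 4) * (4 * transition ε N / N) := by
  have hN := h.cast_pos
  rcases eq_or_lt_of_le hk with he | hlt
  · have h1 : (k : ℝ) = 3 * N / 4 := by
      have : (3 * N : ℝ) = 4 * k := by exact_mod_cast he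
      linarith
    rw [h.node_mid (by omega) he.ge, h1]
    field_simp
    ring
  · have hp := h.pos
    rw [node, if_neg (by omega), if_neg (by omega)]
    ring

theorem node_last (h : Admissible ε N) : node ε N N = 1 := by
  have hN := h.cast_pos
  rw [h.node_of_ge (by omega)]
  field_simp
  ring

theorem width_fine (h : Admissible ε N) {i : ℕ} (hi : IsFine N i) :
    width ε N i = 4 * (ε * Real.log N) / N := by
  -- Divisibility turns 4i < N into 4(i + 1) ≤ N, so no mesh interval straddles a transition point.
  have hd := h.four_dvd
  rw [width, ← h.transition_eq]
  rcases hi with hi | hi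
  · rw [h.node_of_le hi.le, h.node_of_le (by omega)]
    push_cast
    ring
  · rw [h.node_of_ge hi, h.node_of_ge (by omega)]
    push_cast
    ring

theorem width_coarse (h : Admissible ε N) {i : ℕ} (hi : ¬ IsFine N i) :
    width ε N i = 2 * (1 - 2 * transition ε N) / N := by
  have hd := h.four_dvd
  unfold IsFine at hi
  rw [width, h.node_mid (by omega) (by omega), h.node_mid (by omega) (by omega)]
  push_cast
  ring

/-- No bound on i is needed: beyond N the last branch of `node` continues with the fine step. -/
theorem width_pos (h : Admissible ε N) (i : ℕ) : 0 < width ε N i := by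
  have hN := h.cast_pos
  by_cases hi : IsFine N i
  · rw [h.width_fine hi, ← h.transition_eq]
    have := h.transition_pos
    positivity
  · rw [h.width_coarse hi]
    have : 0 < 1 - 2 * transition ε N := by linarith [h.transition_le]
    positivity

theorem node_lt (h : Admissible ε N) (i : ℕ) : node ε N i < node ε N (i + 1) :=
  sub_pos.1 (h.width_pos i)

theorem width_le (h : Admissible ε N) (i : ℕ) : width ε N i ≤ 2 / N := by
  by_cases hi : IsFine N i
  · rw [h.width_fine hi]
    have := h.cast_pos
    gcongr
    linarith [h.eps_log_le]
  · rw [h.width_coarse hi]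
    have := h.cast_pos
    gcongr
    linarith [h.transition_pos]

theorem monotone_node (h : Admissible ε N) : Monotone (node ε N) :=
  monotone_nat_of_le_succ fun i => (h.node_lt i).le

theorem node_mem (h : Admissible ε N) {i : ℕ} (hi : i ≤ N) : node ε N i ∈ Icc (0 : ℝ) 1 := by
  refine ⟨?_, ?_⟩
  · rw [← h.node_zero]
    exact h.monotone_node (Nat.zero_le i)
  · rw [← h.node_last]
    exact h.monotone_node hi

theorem Icc_subset (h : Admissible ε N) {i : ℕ} (hi : i < N) :
    Icc (node ε N i) (node ε N (i + 1)) ⊆ Icc (0 : ℝ) 1 :=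
  Icc_subset_Icc (h.node_mem hi.le).1 (h.node_mem hi).2

theorem cell_subset (h : Admissible ε N) {i j : ℕ} (hi : i < N) (hj : j < N) :
    cell ε N i j ⊆ closedSquare :=
  prod_mono (h.Icc_subset hi) (h.Icc_subset hj)

theorem sum_width (h : Admissible ε N) : ∑ i ∈ Finset.range N, width ε N i = 1 := by
  simp only [width]
  rw [Finset.sum_range_sub, h.node_last, h.node_zero, sub_zero]

theorem layerMass_nonneg (h : Admissible ε N) (i : ℕ) : 0 ≤ layerMass ε N i :=
  intervalIntegral.integral_nonneg (h.node_lt i).le fun x _ => (layer_pos ε x).le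

theorem layerWeight_nonneg (h : Admissible ε N) (i : ℕ) : 0 ≤ layerWeight ε N i := by
  have := h.layerMass_nonneg i
  unfold layerWeight
  split_ifs <;> positivity

theorem layerMass_le (h : Admissible ε N) (i : ℕ) :
    layerMass ε N i ≤ √(width ε N i) * layerWeight ε N i := by
  have hs := Real.sqrt_pos.2 (h.width_pos i)
  have hm := h.layerMass_nonneg i
  have h1 : √(width ε N i) * layerWeight ε N i =
      (if IsFine N i then 1 else (N : ℝ)) * layerMass ε N i := by
    unfold layerWeight
    field_simp
  rw [h1]
  refine le_mul_of_one_le_left hm ?_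
  split_ifs <;> linarith [h.four_le]

theorem layerMass_coarse (h : Admissible ε N) {i : ℕ} (hi : ¬ IsFine N i) :
    layerMass ε N i = √(width ε N i) * layerWeight ε N i / N := by
  have hs := Real.sqrt_pos.2 (h.width_pos i)
  have hN := h.cast_pos
  rw [layerWeight, if_neg hi]
  field_simp

theorem layerMass_sq_div_le (h : Admissible ε N) (i : ℕ) :
    (layerMass ε N i / √(width ε N i)) ^ 2 ≤
      ∫ x in node ε N i..node ε N (i + 1), layer ε x ^ 2 := by
  have hw := h.width_pos i
  rw [div_pow, Real.sq_sqrt hw.le, div_le_iff₀ hw, mul_comm]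
  exact sq_integral_le (continuous_layer ε) (h.node_lt i)

/-- By Cauchy–Schwarz the unamplified squares sum to at most the integral of the squared profile
over [0, 1], hence to 2 ε. Over [λ, 1 - λ] that integral is at most 2 ε / N², because λ = ε log N
gives exp(-2λ/ε) = N⁻²; the amplification by N² on the coarse part therefore costs only another 2 ε.
-/
theorem sum_layerWeight_sq_le (h : Admissible ε N) :
    ∑ i ∈ Finset.range N, layerWeight ε N i ^ 2 ≤ 4 * ε := by
  have hN := h.cast_pos
  have hε := h.eps_pos
  obtain ⟨n, hn⟩ := h.four_dvd
  have hint : ∀ k : ℕ, IntervalIntegrable (fun x => layer ε x ^ 2) volume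
      (node ε N k) (node ε N (k + 1)) :=
    fun k => ((continuous_layer ε).pow 2).intervalIntegrable _ _
  have hnn : ∀ i, 0 ≤ ∫ x in node ε N i..node ε N (i + 1), layer ε x ^ 2 := fun i =>
    intervalIntegral.integral_nonneg (h.node_lt i).le fun x _ => sq_nonneg _
  have hall : ∑ i ∈ Finset.range N, (∫ x in node ε N i..node ε N (i + 1), layer ε x ^ 2) ≤
      2 * ε := by
    rw [intervalIntegral.sum_integral_adjacent_intervals fun k _ => hint k, h.node_zero,
      h.node_last]
    refine (integral_layer_sq_le hε zero_le_one).trans ?_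
    norm_num
    linarith
  have hmid : ∑ i ∈ Finset.Ico n (3 * n), (∫ x in node ε N i..node ε N (i + 1), layer ε x ^ 2) ≤
      2 * ε / N ^ 2 := by
    rw [intervalIntegral.sum_integral_adjacent_intervals_Ico (by omega) fun k _ => hint k]
    have e1 : node ε N n = ε * Real.log N := by
      rw [h.node_of_le (by omega), h.transition_eq, hn]
      have : (n : ℝ) ≠ 0 := by
        have := h.pos
        have : n ≠ 0 := by omega
        exact_mod_cast this
      push_cast
      field_simp
    have e2 : node ε N (3 * n) = 1 - ε * Real.log N := by
      rw [h.node_of_ge (by omega), h.transition_eq, hn]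
      push_cast
      ring
    have e3 : Real.exp (-2 * (ε * Real.log N) / ε) = 1 / N ^ 2 := by
      rw [show -2 * (ε * Real.log N) / ε = -(Real.log N + Real.log N) by field_simp; ring,
        Real.exp_neg, Real.exp_add, Real.exp_log hN]
      field_simp
    rw [e1, e2]
    refine (integral_layer_sq_le hε ?_).trans ?_
    · linarith [h.eps_log_le]
    · rw [sub_sub_cancel, e3]
      apply le_of_eq
      ring
  have hterm : ∀ i ∈ Finset.range N, layerWeight ε N i ^ 2 ≤
      (∫ x in node ε N i..node ε N (i + 1), layer ε x ^ 2) +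
        N ^ 2 * (if i ∈ Finset.Ico n (3 * n) then
          (∫ x in node ε N i..node ε N (i + 1), layer ε x ^ 2) else 0) := by
    intro i _
    have hsq := h.layerMass_sq_div_le i
    have h0 := hnn i
    unfold layerWeight
    by_cases hi : IsFine N i
    · have hi' : i ∉ Finset.Ico n (3 * n) := by
        unfold IsFine at hi
        rw [Finset.mem_Ico]
        omega
      rw [if_pos hi, if_neg hi', one_mul]
      linarith
    · have hi' : i ∈ Finset.Ico n (3 * n) := by
        unfold IsFine at hi
        rw [Finset.mem_Ico]
        omega
      rw [if_neg hi, if_pos hi', mul_pow]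
      have := mul_le_mul_of_nonneg_left hsq (sq_nonneg (N : ℝ))
      linarith
  refine (Finset.sum_le_sum hterm).trans ?_
  rw [Finset.sum_add_distrib, ← Finset.mul_sum, Finset.sum_ite_mem,
    Finset.inter_eq_right.2 (fun i hi => by
      rw [Finset.mem_Ico] at hi
      rw [Finset.mem_range]
      omega)]
  have := mul_le_mul_of_nonneg_left hmid (sq_nonneg (N : ℝ))
  rw [mul_div_cancel₀ _ (by positivity)] at this
  linarith

end Admissible

/-! ### Moments of functions on a mesh rectangle -/

theorem isCompact_cell (ε : ℝ) (N i j : ℕ) : IsCompact (cell ε N i j) :=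
  isCompact_Icc.prod isCompact_Icc

theorem integrableOn_cell {ε : ℝ} {N i j : ℕ} {F : ℝ × ℝ → ℝ}
    (hF : ContinuousOn F (cell ε N i j)) : IntegrableOn F (cell ε N i j) :=
  hF.integrableOn_compact (isCompact_cell ε N i j)

theorem measurableSet_cell (ε : ℝ) (N i j : ℕ) : MeasurableSet (cell ε N i j) :=
  measurableSet_Icc.prod measurableSet_Icc

theorem setIntegral_cell_mul {ε : ℝ} {N : ℕ} (h : Admissible ε N) (i j : ℕ) (f g : ℝ → ℝ) :
    ∫ p in cell ε N i j, f p.1 * g p.2 =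
      (∫ x in node ε N i..node ε N (i + 1), f x) * ∫ y in node ε N j..node ε N (j + 1), g y := by
  rw [cell, Measure.volume_eq_prod, setIntegral_prod_mul,
    intervalIntegral.integral_of_le (h.node_lt i).le,
    intervalIntegral.integral_of_le (h.node_lt j).le, integral_Icc_eq_integral_Ioc,
    integral_Icc_eq_integral_Ioc]

theorem setIntegral_cell_swap (ε : ℝ) (N i j : ℕ) (F : ℝ × ℝ → ℝ) :
    ∫ p in cell ε N i j, F p.swap = ∫ p in cell ε N j i, F p := by
  rw [cell, cell, Measure.volume_eq_prod, setIntegral_prod_swap]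

theorem setIntegral_cell_eq {ε : ℝ} {N : ℕ} (h : Admissible ε N) {i j : ℕ} {F : ℝ × ℝ → ℝ}
    (hF : ContinuousOn F (cell ε N i j)) :
    ∫ p in cell ε N i j, F p =
      ∫ x in node ε N i..node ε N (i + 1), ∫ y in node ε N j..node ε N (j + 1), F (x, y) := by
  have hint := integrableOn_cell hF
  rw [cell, Measure.volume_eq_prod] at hint ⊢
  rw [setIntegral_prod _ hint, intervalIntegral.integral_of_le (h.node_lt i).le,
    integral_Icc_eq_integral_Ioc]
  simp only [intervalIntegral.integral_of_le (h.node_lt j).le, integral_Icc_eq_integral_Ioc]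

/-- A combination of the layer profiles in both variables. -/
noncomputable def profile (ε α β γ δ : ℝ) (p : ℝ × ℝ) : ℝ :=
  α + β * layer ε p.1 + γ * layer ε p.2 + δ * (layer ε p.1 * layer ε p.2)

theorem continuous_profile (ε α β γ δ : ℝ) : Continuous (profile ε α β γ δ) := by
  have := continuous_layer ε
  unfold profile
  fun_prop

theorem setIntegral_profile {ε : ℝ} {N : ℕ} (h : Admissible ε N) (i j : ℕ) (α β γ δ : ℝ) :
    ∫ p in cell ε N i j, profile ε α β γ δ p =
      α * (width ε N i * width ε N j) + β * (layerMass ε N i * width ε N j)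
        + γ * (width ε N i * layerMass ε N j) + δ * (layerMass ε N i * layerMass ε N j) := by
  have hL := continuous_layer ε
  have e1 : ∫ p in cell ε N i j, α * ((fun _ : ℝ => (1 : ℝ)) p.1 * (fun _ : ℝ => (1 : ℝ)) p.2) =
      α * (width ε N i * width ε N j) := by
    rw [integral_const_mul, setIntegral_cell_mul h i j (fun _ => 1) (fun _ => 1)]
    simp [width]
  have e2 : ∫ p in cell ε N i j, β * (layer ε p.1 * (fun _ : ℝ => (1 : ℝ)) p.2) =
      β * (layerMass ε N i * width ε N j) := by
    rw [integral_const_mul, setIntegral_cell_mul h i j (layer ε) (fun _ => 1)]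
    simp [width, layerMass]
  have e3 : ∫ p in cell ε N i j, γ * ((fun _ : ℝ => (1 : ℝ)) p.1 * layer ε p.2) =
      γ * (width ε N i * layerMass ε N j) := by
    rw [integral_const_mul, setIntegral_cell_mul h i j (fun _ => 1) (layer ε)]
    simp [width, layerMass]
  have e4 : ∫ p in cell ε N i j, δ * (layer ε p.1 * layer ε p.2) =
      δ * (layerMass ε N i * layerMass ε N j) := by
    rw [integral_const_mul, setIntegral_cell_mul h i j (layer ε) (layer ε)]
    rfl
  rw [← e1, ← e2, ← e3, ← e4]
  simp only [mul_one, one_mul]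
  rw [← integral_add, ← integral_add, ← integral_add]
  · rfl
  all_goals exact integrableOn_cell (Continuous.continuousOn (by fun_prop))

theorem abs_setIntegral_mul_le {ε : ℝ} {N i j : ℕ} {F ψ : ℝ × ℝ → ℝ} {g : ℝ → ℝ} {G : ℝ}
    (hψ : ContinuousOn ψ (cell ε N i j)) (hF : ∀ p ∈ cell ε N i j, |F p| ≤ ψ p)
    (hg : ∀ x ∈ Icc (node ε N i) (node ε N (i + 1)), |g x| ≤ G) :
    |∫ p in cell ε N i j, F p * g p.1| ≤ G * ∫ p in cell ε N i j, ψ p := by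
  rw [← integral_const_mul, ← Real.norm_eq_abs]
  refine norm_integral_le_of_norm_le (integrableOn_cell (hψ.const_mul G)) ?_
  refine (ae_restrict_iff' (measurableSet_cell ε N i j)).2 (Filter.Eventually.of_forall ?_)
  intro p hp
  rw [Real.norm_eq_abs, abs_mul, mul_comm]
  exact mul_le_mul (hg p.1 hp.1) (hF p hp) (abs_nonneg _) ((abs_nonneg _).trans (hg p.1 hp.1))

theorem abs_sub_le_of_partialX {F : ℝ × ℝ → ℝ} (hF : ContDiffOn ℝ 1 F closedSquare)
    {a b x y M : ℝ} (hab : Icc a b ⊆ Icc (0 : ℝ) 1) (hx : x ∈ Icc a b) (hy : y ∈ Icc (0 : ℝ) 1)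
    (hM : ∀ t ∈ Icc a b, |partialX F (t, y)| ≤ M) : |F (x, y) - F (a, y)| ≤ (b - a) * M := by
  have haa : a ∈ Icc a b := left_mem_Icc.2 (hx.1.trans hx.2)
  have hd : ∀ t ∈ Icc a b,
      HasDerivWithinAt (fun t => F (t, y)) (partialX F (t, y)) (Icc a b) t := fun t ht =>
    (hasDerivWithinAt_partialX hF (mk_mem_prod (hab ht) hy)).mono hab
  have := (convex_Icc a b).norm_image_sub_le_of_norm_hasDerivWithin_le hd hM haa hx
  rw [Real.norm_eq_abs, Real.norm_eq_abs, mul_comm, abs_of_nonneg (sub_nonneg.2 hx.1)] at this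
  refine this.trans ?_
  have hM0 : 0 ≤ M := (abs_nonneg _).trans (hM a haa)
  gcongr
  exact hx.2

theorem abs_sub_le_of_partialY {F : ℝ × ℝ → ℝ} (hF : ContDiffOn ℝ 1 F closedSquare)
    {c d x y y' M : ℝ} (hcd : Icc c d ⊆ Icc (0 : ℝ) 1) (hx : x ∈ Icc (0 : ℝ) 1)
    (hy : y ∈ Icc c d) (hy' : y' ∈ Icc c d) (hM : ∀ t ∈ Icc c d, |partialY F (x, t)| ≤ M) :
    |F (x, y) - F (x, y')| ≤ (d - c) * M := by
  have hd : ∀ t ∈ Icc c d,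
      HasDerivWithinAt (fun t => F (x, t)) (partialY F (x, t)) (Icc c d) t := fun t ht =>
    (hasDerivWithinAt_partialY hF (mk_mem_prod hx (hcd ht))).mono hcd
  have := (convex_Icc c d).norm_image_sub_le_of_norm_hasDerivWithin_le hd hM hy' hy
  rw [Real.norm_eq_abs, Real.norm_eq_abs, mul_comm] at this
  refine this.trans ?_
  have hM0 : 0 ≤ M := (abs_nonneg _).trans (hM y hy)
  gcongr
  rw [abs_le]
  constructor <;> linarith [hy.1, hy.2, hy'.1, hy'.2]

/-- The moment against a function of mean zero is controlled by the variation in `x`. -/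
theorem abs_moment_le_of_partialX {ε : ℝ} {N : ℕ} (h : Admissible ε N) {i j : ℕ} (hi : i < N)
    (hj : j < N) {F ψ : ℝ × ℝ → ℝ} (hF : ContDiffOn ℝ 1 F closedSquare) {g : ℝ → ℝ} {G : ℝ}
    (hgc : Continuous g) (hg0 : ∫ x in node ε N i..node ε N (i + 1), g x = 0)
    (hg : ∀ x ∈ Icc (node ε N i) (node ε N (i + 1)), |g x| ≤ G)
    (hψ : ContinuousOn ψ (cell ε N i j))
    (hb : ∀ p ∈ cell ε N i j, ∀ t ∈ Icc (node ε N i) (node ε N (i + 1)),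
      |partialX F (t, p.2)| ≤ ψ p) :
    |∫ p in cell ε N i j, F p * g p.1| ≤ G * (width ε N i * ∫ p in cell ε N i j, ψ p) := by
  have hsub := h.cell_subset hi hj
  have hFc : ContinuousOn F (cell ε N i j) := hF.continuousOn.mono hsub
  have hF0 : ContinuousOn (fun p : ℝ × ℝ => F (node ε N i, p.2)) (cell ε N i j) := by
    refine hF.continuousOn.comp (by fun_prop) fun p hp => ?_
    exact mk_mem_prod (h.node_mem hi.le) (hsub hp).2
  -- The trace on the left edge depends on y alone, so g annihilates it; subtracting it replaces F
  -- by an increment in x.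
  have hz : ∫ p in cell ε N i j, F (node ε N i, p.2) * g p.1 = 0 := by
    simp only [mul_comm (F _)]
    rw [setIntegral_cell_mul h i j g fun y => F (node ε N i, y), hg0, zero_mul]
  have hgc' : ContinuousOn (fun p : ℝ × ℝ => g p.1) (cell ε N i j) := by fun_prop
  have heq : ∫ p in cell ε N i j, F p * g p.1 =
      ∫ p in cell ε N i j, (F p - F (node ε N i, p.2)) * g p.1 := by
    simp only [sub_mul]
    have hi1 : IntegrableOn (fun p => F p * g p.1) (cell ε N i j) :=
      integrableOn_cell (hFc.mul hgc')
    have hi2 : IntegrableOn (fun p => F (node ε N i, p.2) * g p.1) (cell ε N i j) :=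
      integrableOn_cell (hF0.mul hgc')
    rw [integral_sub hi1 hi2, hz, sub_zero]
  rw [heq, ← integral_const_mul]
  refine abs_setIntegral_mul_le (F := fun p => F p - F (node ε N i, p.2))
    (hψ.const_mul _) (fun p hp => ?_) hg
  exact abs_sub_le_of_partialX hF (h.Icc_subset hi) hp.1 (hsub hp).2 (hb p hp)

/-! ### Global estimate for a splitting into a smooth and a layer part -/

/-- Cauchy–Schwarz over all cells; the weight factorises, so its square sum is a product of two
one-dimensional sums. -/
theorem sum_mul_mul_le (N : ℕ) (a b : ℕ → ℝ) (e : ℕ → ℕ → ℝ) {A B E : ℝ}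
    (hA : 0 ≤ A) (hB : 0 ≤ B) (hE : 0 ≤ E)
    (ha : ∑ i ∈ Finset.range N, a i ^ 2 ≤ A ^ 2) (hb : ∑ j ∈ Finset.range N, b j ^ 2 ≤ B ^ 2)
    (he : ∑ i ∈ Finset.range N, ∑ j ∈ Finset.range N, e i j ^ 2 ≤ E ^ 2) :
    ∑ i ∈ Finset.range N, ∑ j ∈ Finset.range N, a i * b j * e i j ≤ A * B * E := by
  rw [← Finset.sum_product'] at he ⊢
  have h1 := Finset.sum_mul_sq_le_sq_mul_sq (Finset.range N ×ˢ Finset.range N)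
    (fun q => a q.1 * b q.2) (fun q => e q.1 q.2)
  have h2 : ∑ q ∈ Finset.range N ×ˢ Finset.range N, (a q.1 * b q.2) ^ 2 =
      (∑ i ∈ Finset.range N, a i ^ 2) * ∑ j ∈ Finset.range N, b j ^ 2 := by
    rw [Finset.sum_mul_sum, ← Finset.sum_product']
    exact Finset.sum_congr rfl fun q _ => mul_pow _ _ _
  rw [h2] at h1
  have ha0 : 0 ≤ ∑ i ∈ Finset.range N, a i ^ 2 := Finset.sum_nonneg fun _ _ => sq_nonneg _
  have hb0 : 0 ≤ ∑ i ∈ Finset.range N, b i ^ 2 := Finset.sum_nonneg fun _ _ => sq_nonneg _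
  refine abs_le_of_sq_le_sq' ?_ (by positivity) |>.2
  refine h1.trans ?_
  rw [mul_pow, mul_pow]
  gcongr

/-- On a fine interval width/ε = 4 log N / N ≤ 4, so there the layer profile is constant up to the
factor exp 4. This is the origin of exp 4 in all later constants. -/
theorem Admissible.exp_width_le {ε : ℝ} {N : ℕ} (h : Admissible ε N) {i : ℕ} (hi : IsFine N i) :
    Real.exp (width ε N i / ε) ≤ Real.exp 4 := by
  have hε := h.eps_pos
  have hN := h.cast_pos
  rw [Real.exp_le_exp, h.width_fine hi, div_div, div_le_iff₀ (by positivity)]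
  nlinarith [h.log_le]

theorem layer_le_of_mem_fine {ε : ℝ} {N : ℕ} (h : Admissible ε N) {i : ℕ} (hi : IsFine N i)
    {x t : ℝ} (hx : x ∈ Icc (node ε N i) (node ε N (i + 1)))
    (ht : t ∈ Icc (node ε N i) (node ε N (i + 1))) :
    layer ε t ≤ Real.exp 4 * layer ε x := by
  refine (layer_le_exp_mul h.eps_pos (δ := width ε N i) ?_).trans
    (mul_le_mul_of_nonneg_right (h.exp_width_le hi) (layer_pos ε x).le)
  rw [abs_le, width]
  constructor <;> linarith [hx.1, hx.2, ht.1, ht.2]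

/-- A family of test functions of mean zero in `x`, bounded on each mesh rectangle by means of
numbers `e i j`. -/
structure TestFamily (ε : ℝ) (N : ℕ) (e : ℕ → ℕ → ℝ) (c₁ : ℝ) (g : ℕ → ℕ → ℝ → ℝ)
    (G : ℕ → ℕ → ℝ) : Prop where
  continuous : ∀ i j, Continuous (g i j)
  mean_zero : ∀ i j, ∫ x in node ε N i..node ε N (i + 1), g i j x = 0
  abs_le : ∀ i j, ∀ x ∈ Icc (node ε N i) (node ε N (i + 1)), |g i j x| ≤ G i j
  bound_le : ∀ i j, G i j * (√(width ε N i) * √(width ε N j)) ≤ c₁ * e i j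

/-! ### Moments on a single cell. -/

theorem abs_moment_smooth_le {ε : ℝ} {N : ℕ} (h : Admissible ε N) {e : ℕ → ℕ → ℝ} {c₁ : ℝ}
    {g : ℕ → ℕ → ℝ → ℝ} {G : ℕ → ℕ → ℝ} (hg : TestFamily ε N e c₁ g G) {F : ℝ × ℝ → ℝ}
    {a₀ a₁ : ℝ} (ha₀ : 0 ≤ a₀) (ha₁ : 0 ≤ a₁) (hF : ContDiffOn ℝ 1 F closedSquare)
    (hFx : ∀ p ∈ closedSquare, |partialX F p| ≤ a₀ + a₁ * layer ε p.2)
    {i j : ℕ} (hi : i < N) (hj : j < N) :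
    |∫ p in cell ε N i j, F p * g i j p.1| ≤
      2 / N * c₁ * (a₀ * (√(width ε N i) * √(width ε N j) * e i j)
        + a₁ * (√(width ε N i) * layerWeight ε N j * e i j)) := by
  have h1 := abs_moment_le_of_partialX h hi hj hF (hg.continuous i j) (hg.mean_zero i j)
    (hg.abs_le i j) (ψ := profile ε a₀ 0 a₁ 0) (continuous_profile _ _ _ _ _).continuousOn
    (fun p hp t ht => by
      have := hFx (t, p.2) (mk_mem_prod (h.Icc_subset hi ht) (h.cell_subset hi hj hp).2)
      simpa [profile] using this)
  rw [setIntegral_profile h] at h1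
  have hwi := h.width_pos i
  have hwj := h.width_pos j
  have hN := h.cast_pos
  have hm := h.layerMass_le j
  have hm0 := h.layerMass_nonneg j
  have hwle := h.width_le i
  have hG : 0 ≤ G i j := (abs_nonneg _).trans (hg.abs_le i j _ (left_mem_Icc.2 (h.node_lt i).le))
  have hρ := h.layerWeight_nonneg j
  refine h1.trans ?_
  set si := √(width ε N i)
  set sj := √(width ε N j)
  have hsi : si * si = width ε N i := Real.mul_self_sqrt hwi.le
  have hsj : sj * sj = width ε N j := Real.mul_self_sqrt hwj.le
  have hsi0 : 0 ≤ si := Real.sqrt_nonneg _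
  have hsj0 : 0 ≤ sj := Real.sqrt_nonneg _
  have hle := hg.bound_le i j
  calc G i j * (width ε N i * (a₀ * (width ε N i * width ε N j) + 0 * (layerMass ε N i * width ε N j)
        + a₁ * (width ε N i * layerMass ε N j) + 0 * (layerMass ε N i * layerMass ε N j)))
      ≤ G i j * (2 / N * (a₀ * (width ε N i * width ε N j)
        + a₁ * (width ε N i * (sj * layerWeight ε N j)))) := by
        simp only [zero_mul, add_zero]
        gcongr
    _ = 2 / N * (G i j * (si * sj)) * (a₀ * (si * sj) + a₁ * (si * layerWeight ε N j)) := by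
        rw [← hsi, ← hsj]
        ring
    _ ≤ 2 / N * (c₁ * e i j) * (a₀ * (si * sj) + a₁ * (si * layerWeight ε N j)) := by
        gcongr
    _ = _ := by ring

/-- The two hypotheses express that an x-derivative costs 1/ε. On a fine column the gain is the
width 4 ε log N / N against ∂F/∂x. On a coarse column F is bounded directly: `hF0` supplies ε and
the decayed layer mass supplies 1/N. -/
theorem abs_moment_layer_le {ε : ℝ} {N : ℕ} (h : Admissible ε N) {e : ℕ → ℕ → ℝ} {c₁ : ℝ}
    {g : ℕ → ℕ → ℝ → ℝ} {G : ℕ → ℕ → ℝ} (hg : TestFamily ε N e c₁ g G) {F : ℝ × ℝ → ℝ}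
    {b₁ b₂ : ℝ} (hb₁ : 0 ≤ b₁) (hb₂ : 0 ≤ b₂) (hF : ContDiffOn ℝ 1 F closedSquare)
    (hF0 : ∀ p ∈ closedSquare,
      |F p| ≤ ε * (b₁ * layer ε p.1 + b₂ * (layer ε p.1 * layer ε p.2)))
    (hFx : ∀ p ∈ closedSquare,
      |partialX F p| ≤ b₁ * layer ε p.1 + b₂ * (layer ε p.1 * layer ε p.2))
    {i j : ℕ} (hi : i < N) (hj : j < N) :
    |∫ p in cell ε N i j, F p * g i j p.1| ≤
      4 * Real.exp 4 * (ε * Real.log N / N) * c₁ *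
        (b₁ * (layerWeight ε N i * √(width ε N j) * e i j)
          + b₂ * (layerWeight ε N i * layerWeight ε N j * e i j)) := by
  have hε := h.eps_pos
  have hwi := h.width_pos i
  have hwj := h.width_pos j
  have hN := h.cast_pos
  have hlog := h.one_le_log
  have hmi := h.layerMass_le i
  have hmj := h.layerMass_le j
  have hmi0 := h.layerMass_nonneg i
  have hmj0 := h.layerMass_nonneg j
  have hG : 0 ≤ G i j := (abs_nonneg _).trans (hg.abs_le i j _ (left_mem_Icc.2 (h.node_lt i).le))
  have hρ := h.layerWeight_nonneg j
  have hρi := h.layerWeight_nonneg i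
  have hle := hg.bound_le i j
  have hE4 : (1 : ℝ) ≤ Real.exp 4 := Real.one_le_exp (by norm_num)
  have hsub := h.cell_subset hi hj
  have key : |∫ p in cell ε N i j, F p * g i j p.1| ≤
      G i j * (4 * Real.exp 4 * (ε * Real.log N / N) *
        (b₁ * (√(width ε N i) * layerWeight ε N i * width ε N j) +
          b₂ * (√(width ε N i) * layerWeight ε N i * layerMass ε N j))) := by
    by_cases hfi : IsFine N i
    · have h1 := abs_moment_le_of_partialX h hi hj hF (hg.continuous i j) (hg.mean_zero i j)
        (hg.abs_le i j)
        (ψ := profile ε 0 (Real.exp 4 * b₁) 0 (Real.exp 4 * b₂))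
        (continuous_profile _ _ _ _ _).continuousOn
        (fun p hp t ht => by
          have h2 := hFx (t, p.2) (mk_mem_prod (h.Icc_subset hi ht) (hsub hp).2)
          have h3 := layer_le_of_mem_fine h hfi hp.1 ht
          have h4 := (layer_pos ε p.2).le
          refine h2.trans ?_
          calc b₁ * layer ε t + b₂ * (layer ε t * layer ε p.2)
              ≤ b₁ * (Real.exp 4 * layer ε p.1)
                + b₂ * (Real.exp 4 * layer ε p.1 * layer ε p.2) := by gcongr
            _ = profile ε 0 (Real.exp 4 * b₁) 0 (Real.exp 4 * b₂) p := by
              unfold profile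
              ring)
      rw [setIntegral_profile h, h.width_fine hfi] at h1
      refine h1.trans (mul_le_mul_of_nonneg_left ?_ hG)
      calc 4 * (ε * Real.log N) / N * (0 * (4 * (ε * Real.log N) / N * width ε N j)
            + Real.exp 4 * b₁ * (layerMass ε N i * width ε N j)
            + 0 * (4 * (ε * Real.log N) / N * layerMass ε N j)
            + Real.exp 4 * b₂ * (layerMass ε N i * layerMass ε N j))
          = 4 * Real.exp 4 * (ε * Real.log N / N) *
            (b₁ * (layerMass ε N i * width ε N j) + b₂ * (layerMass ε N i * layerMass ε N j)) := by
            ring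
        _ ≤ _ := by gcongr
    · have h1 := abs_setIntegral_mul_le (ψ := profile ε 0 (ε * b₁) 0 (ε * b₂)) (F := F)
        (continuous_profile _ _ _ _ _).continuousOn
        (fun p hp => (hF0 p (hsub hp)).trans (le_of_eq (by unfold profile; ring)))
        (hg.abs_le i j)
      rw [setIntegral_profile h, h.layerMass_coarse hfi] at h1
      refine h1.trans (mul_le_mul_of_nonneg_left ?_ hG)
      set P := b₁ * (√(width ε N i) * layerWeight ε N i * width ε N j) +
          b₂ * (√(width ε N i) * layerWeight ε N i * layerMass ε N j) with hP
      have hP0 : 0 ≤ P := by positivity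
      calc _ = ε * 1 / N * P := by
            rw [hP]
            ring
        _ ≤ ε * Real.log N / N * P := by gcongr
        _ = 1 * (ε * Real.log N / N) * P := by ring
        _ ≤ 4 * Real.exp 4 * (ε * Real.log N / N) * P := by
            gcongr
            linarith
  refine key.trans ?_
  set si := √(width ε N i)
  set sj := √(width ε N j)
  have hsj : sj * sj = width ε N j := Real.mul_self_sqrt hwj.le
  have hsi0 : 0 ≤ si := Real.sqrt_nonneg _
  have hsj0 : 0 ≤ sj := Real.sqrt_nonneg _
  calc _ ≤ G i j * (4 * Real.exp 4 * (ε * Real.log N / N) *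
        (b₁ * (si * layerWeight ε N i * (sj * sj)) +
          b₂ * (si * layerWeight ε N i * (sj * layerWeight ε N j)))) := by
        rw [hsj]
        gcongr
    _ = 4 * Real.exp 4 * (ε * Real.log N / N) * (G i j * (si * sj)) *
        (b₁ * (layerWeight ε N i * sj) + b₂ * (layerWeight ε N i * layerWeight ε N j)) := by ring
    _ ≤ 4 * Real.exp 4 * (ε * Real.log N / N) * (c₁ * e i j) *
        (b₁ * (layerWeight ε N i * sj) + b₂ * (layerWeight ε N i * layerWeight ε N j)) := by
        gcongr
    _ = _ := by ring

/-! ### Summation of the cell moments over the mesh. -/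

theorem Admissible.sum_sqrt_width_sq {ε : ℝ} {N : ℕ} (h : Admissible ε N) :
    ∑ i ∈ Finset.range N, √(width ε N i) ^ 2 ≤ 1 ^ 2 := by
  simp only [Real.sq_sqrt (h.width_pos _).le]
  rw [h.sum_width, one_pow]

theorem Admissible.sum_layerWeight_sq_le' {ε : ℝ} {N : ℕ} (h : Admissible ε N) :
    ∑ i ∈ Finset.range N, layerWeight ε N i ^ 2 ≤ (2 * √ε) ^ 2 := by
  rw [mul_pow, Real.sq_sqrt h.eps_pos.le]
  linarith [h.sum_layerWeight_sq_le]

theorem sum_abs_moment_smooth_le {ε : ℝ} {N : ℕ} (h : Admissible ε N) {e : ℕ → ℕ → ℝ} {c₁ E : ℝ}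
    (hc₁ : 0 ≤ c₁) (hE : 0 ≤ E)
    (he : ∑ i ∈ Finset.range N, ∑ j ∈ Finset.range N, e i j ^ 2 ≤ E ^ 2)
    {g : ℕ → ℕ → ℝ → ℝ} {G : ℕ → ℕ → ℝ} (hg : TestFamily ε N e c₁ g G) {F : ℝ × ℝ → ℝ}
    {a₀ a₁ : ℝ} (ha₀ : 0 ≤ a₀) (ha₁ : 0 ≤ a₁) (hF : ContDiffOn ℝ 1 F closedSquare)
    (hFx : ∀ p ∈ closedSquare, |partialX F p| ≤ a₀ + a₁ * layer ε p.2) :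
    ∑ i ∈ Finset.range N, ∑ j ∈ Finset.range N, |∫ p in cell ε N i j, F p * g i j p.1| ≤
      4 * c₁ * ((a₀ + a₁ * √ε) / N) * E := by
  have hN := h.cast_pos
  have s1 := sum_mul_mul_le N _ _ e zero_le_one zero_le_one hE h.sum_sqrt_width_sq
    h.sum_sqrt_width_sq he
  have s2 := sum_mul_mul_le N _ _ e zero_le_one (by positivity) hE h.sum_sqrt_width_sq
    h.sum_layerWeight_sq_le' he
  refine (Finset.sum_le_sum fun i hi => Finset.sum_le_sum fun j hj =>
    abs_moment_smooth_le h hg ha₀ ha₁ hF hFx (Finset.mem_range.1 hi)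
      (Finset.mem_range.1 hj)).trans ?_
  simp only [← Finset.mul_sum, Finset.sum_add_distrib]
  calc _ ≤ 2 / N * c₁ * (a₀ * (1 * 1 * E) + a₁ * (1 * (2 * √ε) * E)) := by gcongr
    _ = 2 * c₁ / N * (a₀ * E + 2 * (a₁ * √ε * E)) := by ring
    _ ≤ 2 * c₁ / N * (2 * (a₀ * E) + 2 * (a₁ * √ε * E)) := by
        have : 0 ≤ a₀ * E := by positivity
        refine mul_le_mul_of_nonneg_left ?_ (by positivity)
        linarith
    _ = _ := by ring

theorem sum_abs_moment_layer_le {ε : ℝ} {N : ℕ} (h : Admissible ε N) {e : ℕ → ℕ → ℝ} {c₁ E : ℝ}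
    (hc₁ : 0 ≤ c₁) (hE : 0 ≤ E)
    (he : ∑ i ∈ Finset.range N, ∑ j ∈ Finset.range N, e i j ^ 2 ≤ E ^ 2)
    {g : ℕ → ℕ → ℝ → ℝ} {G : ℕ → ℕ → ℝ} (hg : TestFamily ε N e c₁ g G) {F : ℝ × ℝ → ℝ}
    {b₁ b₂ : ℝ} (hb₁ : 0 ≤ b₁) (hb₂ : 0 ≤ b₂) (hF : ContDiffOn ℝ 1 F closedSquare)
    (hF0 : ∀ p ∈ closedSquare,
      |F p| ≤ ε * (b₁ * layer ε p.1 + b₂ * (layer ε p.1 * layer ε p.2)))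
    (hFx : ∀ p ∈ closedSquare,
      |partialX F p| ≤ b₁ * layer ε p.1 + b₂ * (layer ε p.1 * layer ε p.2)) :
    ∑ i ∈ Finset.range N, ∑ j ∈ Finset.range N, |∫ p in cell ε N i j, F p * g i j p.1| ≤
      16 * Real.exp 4 * c₁ * (ε * Real.log N / N * (b₁ * √ε + b₂ * ε)) * E := by
  have hN := h.cast_pos
  have hε := h.eps_pos
  have hlog := h.one_le_log
  have s1 := sum_mul_mul_le N _ _ e (by positivity) zero_le_one hE h.sum_layerWeight_sq_le'
    h.sum_sqrt_width_sq he
  have s2 := sum_mul_mul_le N _ _ e (by positivity) (by positivity) hE h.sum_layerWeight_sq_le'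
    h.sum_layerWeight_sq_le' he
  refine (Finset.sum_le_sum fun i hi => Finset.sum_le_sum fun j hj =>
    abs_moment_layer_le h hg hb₁ hb₂ hF hF0 hFx (Finset.mem_range.1 hi)
      (Finset.mem_range.1 hj)).trans ?_
  simp only [← Finset.mul_sum, Finset.sum_add_distrib]
  calc _ ≤ 4 * Real.exp 4 * (ε * Real.log N / N) * c₁ *
        (b₁ * (2 * √ε * 1 * E) + b₂ * (2 * √ε * (2 * √ε) * E)) := by gcongr
    _ = 4 * Real.exp 4 * (ε * Real.log N / N) * c₁ *
        (2 * (b₁ * √ε * E) + 4 * (b₂ * (√ε * √ε) * E)) := by ring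
    _ ≤ 4 * Real.exp 4 * (ε * Real.log N / N) * c₁ *
        (4 * (b₁ * √ε * E) + 4 * (b₂ * (√ε * √ε) * E)) := by
        have : 0 ≤ b₁ * √ε * E := by positivity
        refine mul_le_mul_of_nonneg_left ?_ (by positivity)
        linarith
    _ = _ := by
        rw [Real.mul_self_sqrt hε.le]
        ring

/-! ### Centred coefficients of the shape functions -/

/-- The centred coefficients of the gradient of a shape function on a rectangle with sides `w`,
`v` and midpoint `(a, b)`:
`∂ξ/∂x = p₀ + p₁ (x - a) + p₂ ((x - a)² - w² / 12) + c (y - b)` and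
`∂ξ/∂y = q₀ + q₁ (y - b) + q₂ ((y - b)² - v² / 12) + c (x - a)`. -/
structure GradCoeffs where
  p₀ : ℝ
  p₁ : ℝ
  p₂ : ℝ
  q₀ : ℝ
  q₁ : ℝ
  q₂ : ℝ
  c : ℝ

namespace GradCoeffs

/-- Exchange of the two variables. -/
def swap (κ : GradCoeffs) : GradCoeffs := ⟨κ.q₀, κ.q₁, κ.q₂, κ.p₀, κ.p₁, κ.p₂, κ.c⟩

/-- The contribution of a rectangle with sides `w` and `v` to the squared energy norm. -/
noncomputable def energy (ε w v : ℝ) (κ : GradCoeffs) : ℝ :=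
  w * v * (ε ^ 2 * ((κ.p₁ + κ.q₁) ^ 2 + κ.p₂ ^ 2 * w ^ 2 / 3 + κ.q₂ ^ 2 * v ^ 2 / 3)
    + (κ.p₀ ^ 2 + κ.p₁ ^ 2 * w ^ 2 / 12 + κ.p₂ ^ 2 * w ^ 4 / 180 + κ.c ^ 2 * v ^ 2 / 12)
    + (κ.q₀ ^ 2 + κ.q₁ ^ 2 * v ^ 2 / 12 + κ.q₂ ^ 2 * v ^ 4 / 180 + κ.c ^ 2 * w ^ 2 / 12))

/-- The mean of `∂ξ/∂y` over the top edge. -/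
noncomputable def qTop (v : ℝ) (κ : GradCoeffs) : ℝ := κ.q₀ + κ.q₁ * v / 2 + κ.q₂ * v ^ 2 / 6

/-- The mean of `∂ξ/∂y` over the bottom edge. -/
noncomputable def qBot (v : ℝ) (κ : GradCoeffs) : ℝ := κ.q₀ - κ.q₁ * v / 2 + κ.q₂ * v ^ 2 / 6

theorem energy_nonneg {ε w v : ℝ} (hw : 0 ≤ w) (hv : 0 ≤ v) (κ : GradCoeffs) :
    0 ≤ energy ε w v κ := by
  unfold energy
  positivity

theorem energy_swap (ε w v : ℝ) (κ : GradCoeffs) : energy ε v w κ.swap = energy ε w v κ := by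
  unfold energy swap
  ring

/-- Turns an inequality between squared coefficients and the energy density into the form required
by `TestFamily.bound_le`. -/
theorem mul_sqrt_le {a b w v S : ℝ} (hb : 0 ≤ b) (hw : 0 ≤ w) (hv : 0 ≤ v)
    (h : w * v * a ^ 2 ≤ b ^ 2 * S) : a * (√w * √v) ≤ b * √S := by
  have h1 : a * (√w * √v) ≤ √(b ^ 2 * S) := by
    apply Real.le_sqrt_of_sq_le
    rw [mul_pow, mul_pow, Real.sq_sqrt hw, Real.sq_sqrt hv]
    linarith
  rwa [Real.sqrt_mul (sq_nonneg b), Real.sqrt_sq hb] at h1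

section

variable {ε w v : ℝ}

theorem abs_c_mul_le (hw : 0 ≤ w) (hv : 0 ≤ v) (κ : GradCoeffs) :
    |κ.c| * (w / 2) * (√w * √v) ≤ 4 * √(energy ε w v κ) := by
  refine mul_sqrt_le (by norm_num) hw hv ?_
  rw [energy, mul_left_comm]
  refine mul_le_mul_of_nonneg_left ?_ (by positivity)
  rw [mul_pow, sq_abs]
  have : 0 ≤ ε ^ 2 * ((κ.p₁ + κ.q₁) ^ 2 + κ.p₂ ^ 2 * w ^ 2 / 3 + κ.q₂ ^ 2 * v ^ 2 / 3)
    + (κ.p₀ ^ 2 + κ.p₁ ^ 2 * w ^ 2 / 12 + κ.p₂ ^ 2 * w ^ 4 / 180 + κ.c ^ 2 * v ^ 2 / 12)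
    + (κ.q₀ ^ 2 + κ.q₁ ^ 2 * v ^ 2 / 12 + κ.q₂ ^ 2 * v ^ 4 / 180) := by positivity
  have h2 : 0 ≤ κ.c ^ 2 * w ^ 2 := by positivity
  linarith

theorem abs_p_mul_le (hw : 0 ≤ w) (hv : 0 ≤ v) (κ : GradCoeffs) :
    (|κ.p₁| * (w / 2) + |κ.p₂| * (w ^ 2 / 6)) * (√w * √v) ≤ 4 * √(energy ε w v κ) := by
  refine mul_sqrt_le (by norm_num) hw hv ?_
  rw [energy, mul_left_comm]
  refine mul_le_mul_of_nonneg_left ?_ (by positivity)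
  have h1 : (|κ.p₁| * (w / 2) + |κ.p₂| * (w ^ 2 / 6)) ^ 2 ≤
      2 * (κ.p₁ ^ 2 * (w / 2) ^ 2) + 2 * (κ.p₂ ^ 2 * (w ^ 2 / 6) ^ 2) := by
    rw [← sq_abs κ.p₁, ← sq_abs κ.p₂]
    linarith [sq_nonneg (|κ.p₁| * (w / 2) - |κ.p₂| * (w ^ 2 / 6))]
  have : 0 ≤ ε ^ 2 * ((κ.p₁ + κ.q₁) ^ 2 + κ.p₂ ^ 2 * w ^ 2 / 3 + κ.q₂ ^ 2 * v ^ 2 / 3)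
    + (κ.p₀ ^ 2 + κ.c ^ 2 * v ^ 2 / 12)
    + (κ.q₀ ^ 2 + κ.q₁ ^ 2 * v ^ 2 / 12 + κ.q₂ ^ 2 * v ^ 4 / 180 + κ.c ^ 2 * w ^ 2 / 12) := by
    positivity
  have h2 : 0 ≤ κ.p₁ ^ 2 * w ^ 2 := by positivity
  have h3 : 0 ≤ κ.p₂ ^ 2 * w ^ 4 := by positivity
  linarith

/-- This rests on the ε² ‖Δξ‖² part of the energy, whose mean component sees only p₁ + q₁ and not
p₁. In return the factor is w/ε, which is small on fine intervals for large N. -/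
theorem abs_laplace_mul_le (hε : 0 < ε) (hw : 0 ≤ w) (hv : 0 ≤ v) (κ : GradCoeffs) :
    (|κ.p₁ + κ.q₁| * (w / 2) + |κ.p₂| * (w ^ 2 / 6)) * (√w * √v) ≤
      w / ε * √(energy ε w v κ) := by
  refine mul_sqrt_le (by positivity) hw hv ?_
  rw [energy, mul_left_comm]
  refine mul_le_mul_of_nonneg_left ?_ (by positivity)
  have h1 : (|κ.p₁ + κ.q₁| * (w / 2) + |κ.p₂| * (w ^ 2 / 6)) ^ 2 ≤
      2 * ((κ.p₁ + κ.q₁) ^ 2 * (w / 2) ^ 2) + 2 * (κ.p₂ ^ 2 * (w ^ 2 / 6) ^ 2) := by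
    rw [← sq_abs (κ.p₁ + κ.q₁), ← sq_abs κ.p₂]
    linarith [sq_nonneg (|κ.p₁ + κ.q₁| * (w / 2) - |κ.p₂| * (w ^ 2 / 6))]
  set R := (κ.p₀ ^ 2 + κ.p₁ ^ 2 * w ^ 2 / 12 + κ.p₂ ^ 2 * w ^ 4 / 180 + κ.c ^ 2 * v ^ 2 / 12)
    + (κ.q₀ ^ 2 + κ.q₁ ^ 2 * v ^ 2 / 12 + κ.q₂ ^ 2 * v ^ 4 / 180 + κ.c ^ 2 * w ^ 2 / 12) with hR
  have hR0 : 0 ≤ R := by positivity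
  have h4 : (w / ε) ^ 2 * (ε ^ 2 * ((κ.p₁ + κ.q₁) ^ 2 + κ.p₂ ^ 2 * w ^ 2 / 3
      + κ.q₂ ^ 2 * v ^ 2 / 3) + R) = w ^ 2 * ((κ.p₁ + κ.q₁) ^ 2 + κ.p₂ ^ 2 * w ^ 2 / 3
      + κ.q₂ ^ 2 * v ^ 2 / 3) + (w / ε) ^ 2 * R := by
    field_simp
  have h5 : 0 ≤ (w / ε) ^ 2 * R := by positivity
  have h6 : 0 ≤ w ^ 2 * (κ.q₂ ^ 2 * v ^ 2) := by positivity
  have h2 : 0 ≤ w ^ 2 * (κ.p₁ + κ.q₁) ^ 2 := by positivity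
  have h3 : 0 ≤ κ.p₂ ^ 2 * w ^ 4 := by positivity
  rw [add_assoc, h4]
  linarith

theorem sq_three_le (a b c : ℝ) : (a + b + c) ^ 2 ≤ 3 * a ^ 2 + 3 * b ^ 2 + 3 * c ^ 2 := by
  linarith [sq_nonneg (a - b), sq_nonneg (a - c), sq_nonneg (b - c)]

/-- The sign s selects the top or the bottom edge. The constant is governed by the q₂ term, where
3/36 ≤ 16/180 is needed. -/
theorem abs_edge_mul_le (hw : 0 ≤ w) (hv : 0 ≤ v) (κ : GradCoeffs) {s : ℝ} (hs : s ^ 2 = 1) :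
    |κ.q₀ + s * (κ.q₁ * v / 2) + κ.q₂ * v ^ 2 / 6| * (√w * √v) ≤ 4 * √(energy ε w v κ) := by
  refine mul_sqrt_le (by norm_num) hw hv ?_
  rw [energy, mul_left_comm, sq_abs]
  refine mul_le_mul_of_nonneg_left ?_ (by positivity)
  have h1 := sq_three_le κ.q₀ (s * (κ.q₁ * v / 2)) (κ.q₂ * v ^ 2 / 6)
  rw [mul_pow, hs, one_mul] at h1
  have : 0 ≤ ε ^ 2 * ((κ.p₁ + κ.q₁) ^ 2 + κ.p₂ ^ 2 * w ^ 2 / 3 + κ.q₂ ^ 2 * v ^ 2 / 3)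
    + (κ.p₀ ^ 2 + κ.p₁ ^ 2 * w ^ 2 / 12 + κ.p₂ ^ 2 * w ^ 4 / 180 + κ.c ^ 2 * v ^ 2 / 12)
    + (κ.c ^ 2 * w ^ 2 / 12) := by positivity
  have h0 : 0 ≤ κ.q₀ ^ 2 := by positivity
  have h2 : 0 ≤ κ.q₁ ^ 2 * v ^ 2 := by positivity
  have h3 : 0 ≤ κ.q₂ ^ 2 * v ^ 4 := by positivity
  linarith

theorem abs_qTop_mul_le (hw : 0 ≤ w) (hv : 0 ≤ v) (κ : GradCoeffs) :
    |κ.qTop v| * (√w * √v) ≤ 4 * √(energy ε w v κ) := by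
  have := abs_edge_mul_le (ε := ε) hw hv κ (s := 1) (by norm_num)
  rwa [one_mul] at this

theorem abs_qBot_mul_le (hw : 0 ≤ w) (hv : 0 ≤ v) (κ : GradCoeffs) :
    |κ.qBot v| * (√w * √v) ≤ 4 * √(energy ε w v κ) := by
  have := abs_edge_mul_le (ε := ε) hw hv κ (s := -1) (by norm_num)
  rwa [neg_one_mul, ← sub_eq_add_neg] at this

end

end GradCoeffs

/-! ### Mean-zero test functions on a mesh interval. -/

/-- The linear test function of mean zero on a mesh interval. -/
noncomputable def linTest (ε : ℝ) (N i : ℕ) (x : ℝ) : ℝ := x - center ε N i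

/-- The quadratic test function of mean zero on a mesh interval. -/
noncomputable def quadTest (ε : ℝ) (N i : ℕ) (x : ℝ) : ℝ :=
  (x - center ε N i) ^ 2 - width ε N i ^ 2 / 12

theorem continuous_linTest (ε : ℝ) (N i : ℕ) : Continuous (linTest ε N i) := by
  unfold linTest
  fun_prop

theorem continuous_quadTest (ε : ℝ) (N i : ℕ) : Continuous (quadTest ε N i) := by
  unfold quadTest
  fun_prop

theorem integral_linTest (ε : ℝ) (N i : ℕ) :
    ∫ x in node ε N i..node ε N (i + 1), linTest ε N i x = 0 := by
  unfold linTest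
  rw [intervalIntegral.integral_comp_sub_right (fun s => s), integral_id, center]
  ring

theorem integral_quadTest (ε : ℝ) (N i : ℕ) :
    ∫ x in node ε N i..node ε N (i + 1), quadTest ε N i x = 0 := by
  unfold quadTest
  rw [intervalIntegral.integral_comp_sub_right (fun s => s ^ 2 - width ε N i ^ 2 / 12),
    intervalIntegral.integral_sub (Continuous.intervalIntegrable (by fun_prop) _ _)
      (Continuous.intervalIntegrable (by fun_prop) _ _), integral_pow,
    intervalIntegral.integral_const, center, width, smul_eq_mul]
  norm_num
  ring

theorem abs_sub_center_le {ε : ℝ} {N i : ℕ} {x : ℝ}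
    (hx : x ∈ Icc (node ε N i) (node ε N (i + 1))) : |x - center ε N i| ≤ width ε N i / 2 := by
  rw [abs_le, center, width]
  constructor <;> linarith [hx.1, hx.2]

theorem abs_linTest_le {ε : ℝ} {N i : ℕ} {x : ℝ}
    (hx : x ∈ Icc (node ε N i) (node ε N (i + 1))) : |linTest ε N i x| ≤ width ε N i / 2 :=
  abs_sub_center_le hx

theorem abs_quadTest_le {ε : ℝ} {N i : ℕ} {x : ℝ}
    (hx : x ∈ Icc (node ε N i) (node ε N (i + 1))) : |quadTest ε N i x| ≤ width ε N i ^ 2 / 6 := by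
  have h1 := abs_sub_center_le hx
  have h2 : (x - center ε N i) ^ 2 ≤ (width ε N i / 2) ^ 2 := by
    rw [← sq_abs]
    gcongr
  rw [quadTest, abs_le]
  constructor <;> nlinarith [sq_nonneg (x - center ε N i), sq_nonneg (width ε N i)]

/-- A combination of the two test functions. -/
noncomputable def testFun (ε : ℝ) (N i : ℕ) (s t : ℝ) (x : ℝ) : ℝ :=
  s * linTest ε N i x + t * quadTest ε N i x

theorem continuous_testFun (ε : ℝ) (N i : ℕ) (s t : ℝ) : Continuous (testFun ε N i s t) :=
  ((continuous_linTest ε N i).const_mul s).add ((continuous_quadTest ε N i).const_mul t)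

theorem integral_testFun (ε : ℝ) (N i : ℕ) (s t : ℝ) :
    ∫ x in node ε N i..node ε N (i + 1), testFun ε N i s t x = 0 := by
  have h1 : IntervalIntegrable (fun x => s * linTest ε N i x) volume (node ε N i)
      (node ε N (i + 1)) := ((continuous_linTest ε N i).const_mul s).intervalIntegrable _ _
  have h2 : IntervalIntegrable (fun x => t * quadTest ε N i x) volume (node ε N i)
      (node ε N (i + 1)) := ((continuous_quadTest ε N i).const_mul t).intervalIntegrable _ _
  unfold testFun
  rw [intervalIntegral.integral_add h1 h2, intervalIntegral.integral_const_mul,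
    intervalIntegral.integral_const_mul, integral_linTest, integral_quadTest]
  ring

theorem abs_testFun_le {ε : ℝ} {N i : ℕ} (s t : ℝ) {x : ℝ}
    (hx : x ∈ Icc (node ε N i) (node ε N (i + 1))) :
    |testFun ε N i s t x| ≤ |s| * (width ε N i / 2) + |t| * (width ε N i ^ 2 / 6) := by
  refine (abs_add_le _ _).trans ?_
  rw [abs_mul, abs_mul]
  gcongr
  exacts [abs_linTest_le hx, abs_quadTest_le hx]

/-! ### Cellwise energy and the two test families. -/

/-- The root of the contribution of the rectangle `(i, j)` to the squared energy norm. -/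
noncomputable def cellNorm (ε : ℝ) (N : ℕ) (κ : ℕ → ℕ → GradCoeffs) (i j : ℕ) : ℝ :=
  √((κ i j).energy ε (width ε N i) (width ε N j))

/-- The energy norm in terms of the coefficients. -/
noncomputable def coeffNorm (ε : ℝ) (N : ℕ) (κ : ℕ → ℕ → GradCoeffs) : ℝ :=
  √(∑ i ∈ Finset.range N, ∑ j ∈ Finset.range N,
    (κ i j).energy ε (width ε N i) (width ε N j))

theorem sum_cellNorm_sq {ε : ℝ} {N : ℕ} (h : Admissible ε N) (κ : ℕ → ℕ → GradCoeffs) :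
    ∑ i ∈ Finset.range N, ∑ j ∈ Finset.range N, cellNorm ε N κ i j ^ 2 =
      coeffNorm ε N κ ^ 2 := by
  have h0 : ∀ i j, 0 ≤ (κ i j).energy ε (width ε N i) (width ε N j) := fun i j =>
    GradCoeffs.energy_nonneg (h.width_pos i).le (h.width_pos j).le _
  unfold cellNorm coeffNorm
  simp only [Real.sq_sqrt (h0 _ _)]
  rw [Real.sq_sqrt (Finset.sum_nonneg fun i _ => Finset.sum_nonneg fun j _ => h0 i j)]

theorem testFamily_c {ε : ℝ} {N : ℕ} (h : Admissible ε N) (κ : ℕ → ℕ → GradCoeffs) :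
    TestFamily ε N (cellNorm ε N κ) 4 (fun i j => testFun ε N i (κ i j).c 0)
      (fun i j => |(κ i j).c| * (width ε N i / 2)) where
  continuous _ _ := continuous_testFun _ _ _ _ _
  mean_zero _ _ := integral_testFun _ _ _ _ _
  abs_le i j _ hx := by simpa using abs_testFun_le (κ i j).c 0 hx
  bound_le i j := (κ i j).abs_c_mul_le (h.width_pos i).le (h.width_pos j).le

theorem testFamily_p {ε : ℝ} {N : ℕ} (h : Admissible ε N) (κ : ℕ → ℕ → GradCoeffs) :
    TestFamily ε N (cellNorm ε N κ) 4 (fun i j => testFun ε N i (κ i j).p₁ (κ i j).p₂)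
      (fun i j => |(κ i j).p₁| * (width ε N i / 2) + |(κ i j).p₂| * (width ε N i ^ 2 / 6)) where
  continuous _ _ := continuous_testFun _ _ _ _ _
  mean_zero _ _ := integral_testFun _ _ _ _ _
  abs_le _ _ _ hx := abs_testFun_le _ _ hx
  bound_le i j := (κ i j).abs_p_mul_le (h.width_pos i).le (h.width_pos j).le

/-! ### The boundary layer part of the third derivative in the normal direction -/

/-- The first m terms add up to b m γ m, and the last term removes this because t vanishes at the
end. -/
theorem telescope_eq_zero {N : ℕ} (t b γ : ℕ → ℝ) (h : ∀ j, j + 1 < N → t j = b (j + 1))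
    (h0 : 0 < N → b 0 = 0) (hN : ∀ j, j + 1 = N → t j = 0) :
    ∑ j ∈ Finset.range N, (t j * γ (j + 1) - b j * γ j) = 0 := by
  cases N with
  | zero => simp
  | succ n =>
    have key : ∀ m, m ≤ n → ∑ j ∈ Finset.range m, (t j * γ (j + 1) - b j * γ j) = b m * γ m := by
      intro m
      induction m with
      | zero =>
        intro _
        rw [h0 (Nat.succ_pos n)]
        simp
      | succ m ih =>
        intro hm
        rw [Finset.sum_range_succ, ih (by omega), h m (by omega)]
        ring
    rw [Finset.sum_range_succ, key n le_rfl, hN n rfl]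
    ring

/-- The values `t i j` at the top and `b i j` at the bottom of the mesh rectangles belong to a
single-valued function on the horizontal edges that vanishes on the boundary edges. -/
structure EdgeMatching (N : ℕ) (t b : ℕ → ℕ → ℝ) : Prop where
  interior : ∀ i < N, ∀ j, j + 1 < N → t i j = b i (j + 1)
  bottom : ∀ i < N, 0 < N → b i 0 = 0
  top : ∀ i < N, ∀ j, j + 1 = N → t i j = 0

/-- The condition on the means of the normal derivative on horizontal edges. -/
abbrev HorizontalNormal (ε : ℝ) (N : ℕ) (κ : ℕ → ℕ → GradCoeffs) : Prop :=
  EdgeMatching N (fun i j => (κ i j).qTop (width ε N j)) (fun i j => (κ i j).qBot (width ε N j))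

/-- The first moment in `x` along the horizontal mesh line `y = node j`. -/
noncomputable def lineMoment (ε : ℝ) (N : ℕ) (F : ℝ × ℝ → ℝ) (i j : ℕ) : ℝ :=
  ∫ x in node ε N i..node ε N (i + 1), F (x, node ε N j) * linTest ε N i x

/-- This is log √N ≤ √N squared; it trades two logarithms for one power of N. -/
theorem Admissible.log_sq_le {ε : ℝ} {N : ℕ} (h : Admissible ε N) :
    Real.log N ^ 2 ≤ 4 * N := by
  have hN := h.cast_pos
  have h1 : Real.log √(N : ℝ) ≤ √N := by
    linarith [Real.log_le_sub_one_of_pos (Real.sqrt_pos.2 hN)]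
  rw [Real.log_sqrt hN.le] at h1
  have h2 : Real.log N ≤ 2 * √(N : ℝ) := by linarith
  calc Real.log (N : ℝ) ^ 2 ≤ (2 * √(N : ℝ)) ^ 2 := by
        have := h.one_le_log
        gcongr
    _ = 4 * (N : ℝ) := by
        rw [mul_pow, Real.sq_sqrt hN.le]
        norm_num

/-- One width comes from the variation of the integrand, the factor width/ε from the Laplacian part
of the energy. The product is 16 ε log² N / N², so the logarithms disappear. -/
theorem Admissible.width_sq_div_le {ε : ℝ} {N : ℕ} (h : Admissible ε N) {i : ℕ}
    (hi : IsFine N i) : width ε N i / ε * width ε N i ≤ 64 * (ε / N) := by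
  have hε := h.eps_pos
  have hN := h.cast_pos
  rw [h.width_fine hi]
  calc 4 * (ε * Real.log N) / N / ε * (4 * (ε * Real.log N) / N)
      = 16 * ε * Real.log N ^ 2 / N ^ 2 := by
        field_simp
        ring
    _ ≤ 16 * ε * (4 * N) / N ^ 2 := by
        gcongr
        exact h.log_sq_le
    _ = _ := by
        field_simp
        ring

section

variable {ε b : ℝ} {N : ℕ} {H : ℝ × ℝ → ℝ} {κ : ℕ → ℕ → GradCoeffs}

/-- The line moment times the height is the cell moment of H frozen on the mesh line, so the
difference is controlled by ∂H/∂y, which is assumed no larger than the bound for H itself. -/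
theorem abs_moment_sub_lineMoment_le (h : Admissible ε N) (hH : ContDiffOn ℝ 1 H closedSquare)
    (hHy : ∀ p ∈ closedSquare, |partialY H p| ≤ ε * b * layer ε p.1)
    {i j l : ℕ} (hi : i < N) (hj : j < N) (hl : l = j ∨ l = j + 1) :
    |(∫ p in cell ε N i j, H p * linTest ε N i p.1) - width ε N j * lineMoment ε N H i l| ≤
      width ε N i / 2 * (width ε N j * (ε * b * (layerMass ε N i * width ε N j))) := by
  have hsub := h.cell_subset hi hj
  have hl' : node ε N l ∈ Icc (node ε N j) (node ε N (j + 1)) := by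
    rcases hl with rfl | rfl
    · exact left_mem_Icc.2 (h.node_lt _).le
    · exact right_mem_Icc.2 (h.node_lt _).le
  have e1 : width ε N j * lineMoment ε N H i l =
      ∫ p in cell ε N i j, H (p.1, node ε N l) * linTest ε N i p.1 := by
    have := setIntegral_cell_mul h i j (fun x => H (x, node ε N l) * linTest ε N i x)
      (fun _ => 1)
    simp only [mul_one, intervalIntegral.integral_const, smul_eq_mul] at this
    rw [this, mul_comm]
    rfl
  have hc1 : ContinuousOn (fun p : ℝ × ℝ => H p * linTest ε N i p.1) (cell ε N i j) :=
    (hH.continuousOn.mono hsub).mul ((continuous_linTest ε N i).comp continuous_fst).continuousOn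
  have hc2 : ContinuousOn (fun p : ℝ × ℝ => H (p.1, node ε N l) * linTest ε N i p.1)
      (cell ε N i j) := by
    refine ContinuousOn.mul (hH.continuousOn.comp (by fun_prop) fun p hp => ?_)
      ((continuous_linTest ε N i).comp continuous_fst).continuousOn
    exact mk_mem_prod (hsub hp).1 (h.Icc_subset hj hl')
  rw [e1, ← integral_sub (integrableOn_cell hc1) (integrableOn_cell hc2)]
  simp only [← sub_mul]
  have h1 := abs_setIntegral_mul_le (ε := ε) (N := N) (i := i) (j := j)
    (F := fun p => H p - H (p.1, node ε N l))
    (ψ := fun p => width ε N j * profile ε 0 (ε * b) 0 0 p)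
    ((continuous_profile _ _ _ _ _).continuousOn.const_mul _) ?_
    (fun x hx => abs_linTest_le hx)
  · refine h1.trans_eq ?_
    rw [integral_const_mul, setIntegral_profile h]
    ring
  · intro p hp
    have := abs_sub_le_of_partialY hH (h.Icc_subset hj) (hsub hp).1 hp.2 hl'
      (M := ε * b * layer ε p.1) fun t ht => hHy (p.1, t) (mk_mem_prod (hsub hp).1
        (h.Icc_subset hj ht))
    refine this.trans_eq ?_
    unfold profile width
    ring

/-- The telescoping correction that is subtracted on the fine part of the mesh. -/
noncomputable def edgeCorrection (ε : ℝ) (N : ℕ) (H : ℝ × ℝ → ℝ) (κ : ℕ → ℕ → GradCoeffs)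
    (i j : ℕ) : ℝ :=
  if IsFine N i then (κ i j).qTop (width ε N j) * lineMoment ε N H i (j + 1)
    - (κ i j).qBot (width ε N j) * lineMoment ε N H i j else 0

/-- Whether the correction is present depends on the column i only, so in each corrected column the
whole sum over j telescopes: edge means and line moments are both single-valued on the mesh lines.
-/
theorem sum_edgeCorrection (hκ : HorizontalNormal ε N κ) :
    ∑ i ∈ Finset.range N, ∑ j ∈ Finset.range N, edgeCorrection ε N H κ i j = 0 := by
  refine Finset.sum_eq_zero fun i hi => ?_
  have hi' := Finset.mem_range.1 hi
  unfold edgeCorrection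
  split_ifs with hf
  · exact telescope_eq_zero (fun j => (κ i j).qTop (width ε N j))
      (fun j => (κ i j).qBot (width ε N j)) (fun j => lineMoment ε N H i j)
      (hκ.interior i hi') (hκ.bottom i hi') (hκ.top i hi')
  · simp

/-- Applied with q the mean of ∂ξ/∂y over the top or bottom edge, M the cell moment and γ the line
moment. Dividing by the height cancels one factor of it, and the fine width, at most 1/N, provides
the gain. -/
theorem abs_edge_term_le (h : Admissible ε N) {q M γ : ℝ} {i j : ℕ} (hb : 0 ≤ b)
    (hfi : IsFine N i)
    (hq : |q| * (√(width ε N i) * √(width ε N j)) ≤ 4 * cellNorm ε N κ i j)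
    (hM : |M - width ε N j * γ| ≤
      width ε N i / 2 * (width ε N j * (ε * b * (layerMass ε N i * width ε N j)))) :
    |q * (M / width ε N j - γ)| ≤
      2 * (b * (ε / N)) * (layerWeight ε N i * √(width ε N j) * cellNorm ε N κ i j) := by
  have hε := h.eps_pos
  have hN := h.cast_pos
  have hw := h.width_pos i
  have hv := h.width_pos j
  have hρ := h.layerWeight_nonneg i
  have hm := h.layerMass_le i
  have hsv := Real.sqrt_nonneg (width ε N j)
  have hsw := Real.sqrt_nonneg (width ε N i)
  have hvv : √(width ε N j) * √(width ε N j) = width ε N j := Real.mul_self_sqrt hv.le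
  have he : 0 ≤ cellNorm ε N κ i j := Real.sqrt_nonneg _
  have h1 : |M / width ε N j - γ| ≤
      width ε N i / 2 * (ε * b * (layerMass ε N i * width ε N j)) := by
    rw [show M / width ε N j - γ = (M - width ε N j * γ) / width ε N j by field_simp, abs_div,
      abs_of_pos hv, div_le_iff₀ hv]
    linarith
  have h2 : width ε N i ≤ 1 / N := by
    rw [h.width_fine hfi]
    gcongr
    linarith [h.eps_log_le]
  rw [abs_mul]
  calc |q| * |M / width ε N j - γ|
      ≤ |q| * (width ε N i / 2 * (ε * b * (√(width ε N i) * layerWeight ε N i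
          * (√(width ε N j) * √(width ε N j))))) := by
        rw [hvv]
        refine mul_le_mul_of_nonneg_left (h1.trans ?_) (abs_nonneg _)
        gcongr
    _ = |q| * (√(width ε N i) * √(width ε N j)) *
        (width ε N i / 2 * (ε * b * (layerWeight ε N i * √(width ε N j)))) := by ring
    _ ≤ 4 * cellNorm ε N κ i j *
        (1 / N / 2 * (ε * b * (layerWeight ε N i * √(width ε N j)))) := by gcongr
    _ = _ := by ring

/-- The moment alone would carry a factor log N on fine columns. The correction cancels the leading
part of its q₁ contribution, and the rest is bounded through the Laplacian or through ∂H/∂y. -/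
theorem abs_moment_add_edgeCorrection_le (h : Admissible ε N) (hb : 0 ≤ b)
    (hH : ContDiffOn ℝ 1 H closedSquare)
    (hH0 : ∀ p ∈ closedSquare, |H p| ≤ ε * b * layer ε p.1)
    (hHx : ∀ p ∈ closedSquare, |partialX H p| ≤ b * layer ε p.1)
    (hHy : ∀ p ∈ closedSquare, |partialY H p| ≤ ε * b * layer ε p.1)
    {i j : ℕ} (hi : i < N) (hj : j < N) :
    |(∫ p in cell ε N i j, H p * testFun ε N i (κ i j).p₁ (κ i j).p₂ p.1)
        + edgeCorrection ε N H κ i j| ≤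
      (64 * Real.exp 4 + 4) * (b * (ε / N)) *
        (layerWeight ε N i * √(width ε N j) * cellNorm ε N κ i j) := by
  have hε := h.eps_pos
  have hN := h.cast_pos
  have hw := h.width_pos i
  have hv := h.width_pos j
  have hρ := h.layerWeight_nonneg i
  have hm := h.layerMass_le i
  have hm0 := h.layerMass_nonneg i
  have hsv := Real.sqrt_nonneg (width ε N j)
  have hsw := Real.sqrt_nonneg (width ε N i)
  have hvv : √(width ε N j) * √(width ε N j) = width ε N j := Real.mul_self_sqrt hv.le
  have he : 0 ≤ cellNorm ε N κ i j := Real.sqrt_nonneg _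
  have hE4 : (1 : ℝ) ≤ Real.exp 4 := Real.one_le_exp (by norm_num)
  have hsub := h.cell_subset hi hj
  set X := layerWeight ε N i * √(width ε N j) * cellNorm ε N κ i j with hX
  have hX0 : 0 ≤ X := by positivity
  by_cases hfi : IsFine N i
  · have hHc : ContinuousOn H (cell ε N i j) := hH.continuousOn.mono hsub
    set M := ∫ p in cell ε N i j, H p * linTest ε N i p.1 with hM
    set T := ∫ p in cell ε N i j, H p * testFun ε N i ((κ i j).p₁ + (κ i j).q₁) (κ i j).p₂ p.1
      with hT
    -- Here p₁ = (p₁ + q₁) - q₁: the first part is seen by the Laplacian, the second by the normal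
    -- derivatives on the horizontal edges.
    have hsplit : (∫ p in cell ε N i j, H p * testFun ε N i (κ i j).p₁ (κ i j).p₂ p.1) =
        T - (κ i j).q₁ * M := by
      have i1 : IntegrableOn
          (fun p => H p * testFun ε N i ((κ i j).p₁ + (κ i j).q₁) (κ i j).p₂ p.1)
          (cell ε N i j) := integrableOn_cell
        (hHc.mul ((continuous_testFun _ _ _ _ _).comp continuous_fst).continuousOn)
      have i2 : IntegrableOn (fun p => (κ i j).q₁ * (H p * linTest ε N i p.1))
          (cell ε N i j) := integrableOn_cell
        ((hHc.mul ((continuous_linTest _ _ _).comp continuous_fst).continuousOn).const_mul _)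
      rw [hT, hM, ← integral_const_mul, ← integral_sub i1 i2]
      congr 1
      funext p
      unfold testFun
      ring
    have hq : (κ i j).q₁ * width ε N j =
        (κ i j).qTop (width ε N j) - (κ i j).qBot (width ε N j) := by
      unfold GradCoeffs.qTop GradCoeffs.qBot
      ring
    have hT' : |T| ≤ 64 * Real.exp 4 * (b * (ε / N)) * X := by
      have h1 := abs_moment_le_of_partialX h hi hj hH
        (continuous_testFun ε N i ((κ i j).p₁ + (κ i j).q₁) (κ i j).p₂)
        (integral_testFun _ _ _ _ _) (fun x hx => abs_testFun_le _ _ hx)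
        (ψ := profile ε 0 (Real.exp 4 * b) 0 0) (continuous_profile _ _ _ _ _).continuousOn
        (fun p hp t ht => by
          have h2 := hHx (t, p.2) (mk_mem_prod (h.Icc_subset hi ht) (hsub hp).2)
          have h3 := layer_le_of_mem_fine h hfi hp.1 ht
          refine h2.trans ?_
          calc b * layer ε t ≤ b * (Real.exp 4 * layer ε p.1) := by gcongr
            _ = profile ε 0 (Real.exp 4 * b) 0 0 p := by
              unfold profile
              ring)
      rw [setIntegral_profile h] at h1
      have h2 := (κ i j).abs_laplace_mul_le hε hw.le hv.le
      set Q := |(κ i j).p₁ + (κ i j).q₁| * (width ε N i / 2)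
        + |(κ i j).p₂| * (width ε N i ^ 2 / 6)
      have hQ : 0 ≤ Q := by positivity
      refine h1.trans ?_
      calc _ = Q * (width ε N i * (Real.exp 4 * b * (layerMass ε N i * width ε N j))) := by ring
        _ ≤ Q * (width ε N i * (Real.exp 4 * b * (√(width ε N i) * layerWeight ε N i
              * (√(width ε N j) * √(width ε N j))))) := by
            rw [hvv]
            gcongr
        _ = Q * (√(width ε N i) * √(width ε N j)) *
            (width ε N i * (Real.exp 4 * b * (layerWeight ε N i * √(width ε N j)))) := by ring
        _ ≤ width ε N i / ε * cellNorm ε N κ i j *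
            (width ε N i * (Real.exp 4 * b * (layerWeight ε N i * √(width ε N j)))) := by
            exact mul_le_mul_of_nonneg_right h2 (by positivity)
        _ = width ε N i / ε * width ε N i * (Real.exp 4 * b * X) := by
            rw [hX]
            ring
        _ ≤ 64 * (ε / N) * (Real.exp 4 * b * X) := by
            exact mul_le_mul_of_nonneg_right (h.width_sq_div_le hfi) (by positivity)
        _ = _ := by ring
    have hU := abs_edge_term_le (κ := κ) h hb hfi
      ((κ i j).abs_qTop_mul_le (ε := ε) hw.le hv.le)
      (abs_moment_sub_lineMoment_le h hH hHy hi hj (Or.inr rfl))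
    have hB := abs_edge_term_le (κ := κ) h hb hfi
      ((κ i j).abs_qBot_mul_le (ε := ε) hw.le hv.le)
      (abs_moment_sub_lineMoment_le h hH hHy hi hj (Or.inl rfl))
    rw [← hM, ← hX] at hU hB
    -- With q₁ the difference of the edge means divided by the height, the correction replaces M
    -- divided by the height by its deviation from the line moments.
    have heq : T - (κ i j).q₁ * M + edgeCorrection ε N H κ i j =
        T - (κ i j).qTop (width ε N j) * (M / width ε N j - lineMoment ε N H i (j + 1))
          + (κ i j).qBot (width ε N j) * (M / width ε N j - lineMoment ε N H i j) := by
      rw [edgeCorrection, if_pos hfi, eq_div_of_mul_eq hv.ne' hq]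
      field_simp
      ring
    rw [hsplit, heq]
    refine (abs_add_le _ _).trans ((add_le_add ((abs_sub _ _).trans (add_le_add hT' hU)) hB).trans
      (le_of_eq ?_))
    ring
  -- On coarse columns the decay of the layer already yields 1/N without a logarithm.
  · rw [edgeCorrection, if_neg hfi, add_zero]
    have h1 := abs_setIntegral_mul_le (ψ := profile ε 0 (ε * b) 0 0) (F := H) (i := i) (j := j)
      (continuous_profile _ _ _ _ _).continuousOn
      (fun p hp => (hH0 p (hsub hp)).trans (le_of_eq (by unfold profile; ring)))
      (fun x hx => abs_testFun_le (κ i j).p₁ (κ i j).p₂ hx)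
    rw [setIntegral_profile h, h.layerMass_coarse hfi] at h1
    have h2 := (κ i j).abs_p_mul_le (ε := ε) hw.le hv.le
    set Q := |(κ i j).p₁| * (width ε N i / 2) + |(κ i j).p₂| * (width ε N i ^ 2 / 6)
    refine h1.trans ?_
    calc _ = Q * (ε * b * (√(width ε N i) * layerWeight ε N i / N
            * (√(width ε N j) * √(width ε N j)))) := by
          rw [hvv]
          ring
      _ = Q * (√(width ε N i) * √(width ε N j)) *
          (b * (ε / N) * (layerWeight ε N i * √(width ε N j))) := by ring
      _ ≤ 4 * cellNorm ε N κ i j *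
          (b * (ε / N) * (layerWeight ε N i * √(width ε N j))) :=
          mul_le_mul_of_nonneg_right h2 (by positivity)
      _ = 4 * (b * (ε / N)) * X := by
          rw [hX]
          ring
      _ ≤ _ := by
          gcongr
          linarith

theorem abs_sum_moment_boundary_le (h : Admissible ε N) (hκ : HorizontalNormal ε N κ)
    (hb : 0 ≤ b) (hH : ContDiffOn ℝ 1 H closedSquare)
    (hH0 : ∀ p ∈ closedSquare, |H p| ≤ ε * b * layer ε p.1)
    (hHx : ∀ p ∈ closedSquare, |partialX H p| ≤ b * layer ε p.1)
    (hHy : ∀ p ∈ closedSquare, |partialY H p| ≤ ε * b * layer ε p.1) :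
    |∑ i ∈ Finset.range N, ∑ j ∈ Finset.range N,
        ∫ p in cell ε N i j, H p * testFun ε N i (κ i j).p₁ (κ i j).p₂ p.1| ≤
      (128 * Real.exp 4 + 8) * (b * ε * √ε / N) * coeffNorm ε N κ := by
  have hN := h.cast_pos
  have hε := h.eps_pos
  have s1 := sum_mul_mul_le N _ _ (cellNorm ε N κ) (by positivity) zero_le_one
    (Real.sqrt_nonneg _) h.sum_layerWeight_sq_le' h.sum_sqrt_width_sq (sum_cellNorm_sq h κ).le
  have heq : ∑ i ∈ Finset.range N, ∑ j ∈ Finset.range N,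
        (∫ p in cell ε N i j, H p * testFun ε N i (κ i j).p₁ (κ i j).p₂ p.1) =
      ∑ i ∈ Finset.range N, ∑ j ∈ Finset.range N,
        ((∫ p in cell ε N i j, H p * testFun ε N i (κ i j).p₁ (κ i j).p₂ p.1)
          + edgeCorrection ε N H κ i j) := by
    simp only [Finset.sum_add_distrib]
    rw [sum_edgeCorrection hκ, add_zero]
  rw [heq]
  refine (Finset.abs_sum_le_sum_abs _ _).trans ((Finset.sum_le_sum fun i hi =>
    (Finset.abs_sum_le_sum_abs _ _).trans (Finset.sum_le_sum fun j hj =>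
      abs_moment_add_edgeCorrection_le h hb hH hH0 hHx hHy (Finset.mem_range.1 hi)
        (Finset.mem_range.1 hj))).trans ?_)
  simp only [← Finset.mul_sum]
  calc _ ≤ (64 * Real.exp 4 + 4) * (b * (ε / N)) * (2 * √ε * 1 * coeffNorm ε N κ) := by
        refine mul_le_mul_of_nonneg_left s1 (by positivity)
    _ = _ := by ring

end

/-! ### Estimates of the moments of the third derivatives -/

section

variable {ε C₀ : ℝ} {N : ℕ} {u A E D : ℝ × ℝ → ℝ} {e : ℕ → ℕ → ℝ} {M : ℝ}
  {g : ℕ → ℕ → ℝ → ℝ} {G : ℕ → ℕ → ℝ}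

theorem sum_abs_moment_A_le (h : Admissible ε N) (hs : LayerSplit ε C₀ u A E D)
    (hM : 0 ≤ M) (he : ∑ i ∈ Finset.range N, ∑ j ∈ Finset.range N, e i j ^ 2 ≤ M ^ 2)
    (hg : TestFamily ε N e 4 g G) {k l : ℕ} (hkl : k + l = 3) :
    ∑ i ∈ Finset.range N, ∑ j ∈ Finset.range N,
        |∫ p in cell ε N i j, partialXY k l A p * g i j p.1| ≤
      16 * C₀ * ((1 + ε ^ (1 - (l : ℤ)) * √ε) / N) * M := by
  have hε := h.eps_pos
  have hC := hs.nonneg hε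
  refine (sum_abs_moment_smooth_le h (by norm_num) hM he hg (a₀ := C₀)
    (a₁ := C₀ * ε ^ (1 - (l : ℤ))) hC (by positivity)
    (by exact_mod_cast hs.boundA.contDiffOn_partialXY (n := 1) (by omega))
    (fun p hp => ?_)).trans_eq ?_
  · rw [partialX_partialXY]
    refine (hs.boundA.2 (k + 1) l (by omega) p hp).trans_eq ?_
    ring
  · ring

theorem sum_abs_moment_ED_le (h : Admissible ε N) (hs : LayerSplit ε C₀ u A E D)
    (hM : 0 ≤ M) (he : ∑ i ∈ Finset.range N, ∑ j ∈ Finset.range N, e i j ^ 2 ≤ M ^ 2)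
    (hg : TestFamily ε N e 4 g G) {k l : ℕ} (hkl : k + l = 3) :
    ∑ i ∈ Finset.range N, ∑ j ∈ Finset.range N,
        |∫ p in cell ε N i j, (partialXY k l E p + partialXY k l D p) * g i j p.1| ≤
      64 * Real.exp 4 * C₀ * (ε * Real.log N / N * (ε ^ (-(k : ℤ)) * √ε + ε ^ (-3 : ℤ) * ε)) *
        M := by
  have hε := h.eps_pos
  have hC := hs.nonneg hε
  have cE : ContDiffOn ℝ ((1 : ℕ) : WithTop ℕ∞) (partialXY k l E) closedSquare :=
    hs.boundE.contDiffOn_partialXY (by omega)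
  have cD : ContDiffOn ℝ ((1 : ℕ) : WithTop ℕ∞) (partialXY k l D) closedSquare :=
    hs.boundD.contDiffOn_partialXY (by omega)
  rw [Nat.cast_one] at cE cD
  have cED : ContDiffOn ℝ 1 (partialXY k l E + partialXY k l D) closedSquare := cE.add cD
  have z1 : ε ^ (1 - (k : ℤ)) = ε * ε ^ (-(k : ℤ)) := by
    rw [sub_eq_add_neg, zpow_add₀ hε.ne', zpow_one]
  have z2 : ε ^ (1 - (k : ℤ) - (l : ℤ)) = ε * ε ^ (-3 : ℤ) := by
    rw [show 1 - (k : ℤ) - (l : ℤ) = 1 + (-3) by omega, zpow_add₀ hε.ne', zpow_one]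
  refine (sum_abs_moment_layer_le h (by norm_num) hM he hg (b₁ := C₀ * ε ^ (-(k : ℤ)))
    (b₂ := C₀ * ε ^ (-3 : ℤ)) (by positivity) (by positivity) cED
    (fun p hp => ?_) (fun p hp => ?_)).trans_eq ?_
  · refine (abs_add_le _ _).trans ((add_le_add (hs.boundE.2 k l (by omega) p hp)
      (hs.boundD.2 k l (by omega) p hp)).trans_eq ?_)
    beta_reduce
    rw [z1, z2]
    ring
  · rw [partialX_add cE cD hp, Pi.add_apply, partialX_partialXY, partialX_partialXY]
    refine (abs_add_le _ _).trans ((add_le_add (hs.boundE.2 (k + 1) l (by omega) p hp)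
      (hs.boundD.2 (k + 1) l (by omega) p hp)).trans_eq ?_)
    beta_reduce
    rw [show 1 - ((k + 1 : ℕ) : ℤ) = -(k : ℤ) by push_cast; ring,
      show -(k : ℤ) - (l : ℤ) = -3 by omega]
    ring
  · ring

/-- The corner part tolerates the logarithm: two layer weights give a full factor ε, so after
scaling by ε² exactly ε log N / N is left. -/
theorem sum_abs_moment_D_le (h : Admissible ε N) (hs : LayerSplit ε C₀ u A E D)
    (hM : 0 ≤ M) (he : ∑ i ∈ Finset.range N, ∑ j ∈ Finset.range N, e i j ^ 2 ≤ M ^ 2)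
    (hg : TestFamily ε N e 4 g G) {k l : ℕ} (hkl : k + l = 3) :
    ∑ i ∈ Finset.range N, ∑ j ∈ Finset.range N,
        |∫ p in cell ε N i j, partialXY k l D p * g i j p.1| ≤
      64 * Real.exp 4 * C₀ * (ε * Real.log N / N * (ε ^ (-3 : ℤ) * ε)) * M := by
  have hε := h.eps_pos
  have hC := hs.nonneg hε
  have z2 : ε ^ (1 - (k : ℤ) - (l : ℤ)) = ε * ε ^ (-3 : ℤ) := by
    rw [show 1 - (k : ℤ) - (l : ℤ) = 1 + (-3) by omega, zpow_add₀ hε.ne', zpow_one]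
  refine (sum_abs_moment_layer_le h (by norm_num) hM he hg (b₁ := 0)
    (b₂ := C₀ * ε ^ (-3 : ℤ)) le_rfl (by positivity)
    (by exact_mod_cast hs.boundD.contDiffOn_partialXY (n := 1) (by omega))
    (fun p hp => ?_) (fun p hp => ?_)).trans_eq ?_
  · refine (hs.boundD.2 k l (by omega) p hp).trans_eq ?_
    beta_reduce
    rw [z2]
    ring
  · rw [partialX_partialXY]
    refine (hs.boundD.2 (k + 1) l (by omega) p hp).trans_eq ?_
    beta_reduce
    rw [show 1 - ((k + 1 : ℕ) : ℤ) - (l : ℤ) = -3 by omega]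
    ring
  · ring

theorem setIntegral_partialXY_eq (h : Admissible ε N) (hs : LayerSplit ε C₀ u A E D)
    {k l : ℕ} (hkl : k + l ≤ 4) {i j : ℕ} (hi : i < N) (hj : j < N) {f : ℝ → ℝ}
    (hf : Continuous f) :
    ∫ p in cell ε N i j, partialXY k l u p * f p.1 =
      (∫ p in cell ε N i j, partialXY k l A p * f p.1)
        + ∫ p in cell ε N i j, (partialXY k l E p + partialXY k l D p) * f p.1 := by
  have hsub := h.cell_subset hi hj
  have cA : ContinuousOn (partialXY k l A) (cell ε N i j) :=
    (hs.boundA.contDiffOn_partialXY (n := 0) (by omega)).continuousOn.mono hsub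
  have cE : ContinuousOn (partialXY k l E) (cell ε N i j) :=
    (hs.boundE.contDiffOn_partialXY (n := 0) (by omega)).continuousOn.mono hsub
  have cD : ContinuousOn (partialXY k l D) (cell ε N i j) :=
    (hs.boundD.contDiffOn_partialXY (n := 0) (by omega)).continuousOn.mono hsub
  have cf : ContinuousOn (fun p : ℝ × ℝ => f p.1) (cell ε N i j) := by fun_prop
  have i1 : IntegrableOn (fun p => partialXY k l A p * f p.1) (cell ε N i j) :=
    integrableOn_cell (cA.mul cf)
  have i2 : IntegrableOn (fun p => (partialXY k l E p + partialXY k l D p) * f p.1)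
      (cell ε N i j) := integrableOn_cell ((cE.add cD).mul cf)
  rw [← integral_add i1 i2]
  refine setIntegral_congr_fun (measurableSet_cell ε N i j) fun p hp => ?_
  simp only [hs.partialXY_eq hkl (hsub hp), Pi.add_apply]
  ring

theorem sum_abs_moment_le (h : Admissible ε N) (hs : LayerSplit ε C₀ u A E D)
    (hM : 0 ≤ M) (he : ∑ i ∈ Finset.range N, ∑ j ∈ Finset.range N, e i j ^ 2 ≤ M ^ 2)
    (hg : TestFamily ε N e 4 g G) {k l : ℕ} (hkl : k + l = 3) :
    ∑ i ∈ Finset.range N, ∑ j ∈ Finset.range N,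
        |∫ p in cell ε N i j, partialXY k l u p * g i j p.1| ≤
      16 * C₀ * ((1 + ε ^ (1 - (l : ℤ)) * √ε) / N) * M +
      64 * Real.exp 4 * C₀ * (ε * Real.log N / N * (ε ^ (-(k : ℤ)) * √ε + ε ^ (-3 : ℤ) * ε)) *
        M := by
  refine le_trans ?_ (add_le_add (sum_abs_moment_A_le h hs hM he hg hkl)
    (sum_abs_moment_ED_le h hs hM he hg hkl))
  rw [← Finset.sum_add_distrib]
  refine Finset.sum_le_sum fun i hi => ?_
  rw [← Finset.sum_add_distrib]
  refine Finset.sum_le_sum fun j hj => ?_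
  rw [setIntegral_partialXY_eq h hs (by omega) (Finset.mem_range.1 hi) (Finset.mem_range.1 hj)
    (hg.continuous i j)]
  exact abs_add_le _ _

end

/-! ### Balancing the powers of ε. -/

section Powers

variable {ε : ℝ}

theorem zpow_neg_three (ε : ℝ) : ε ^ (-3 : ℤ) = (ε ^ 3)⁻¹ := by
  rw [show (-3 : ℤ) = -((3 : ℕ) : ℤ) by norm_num, zpow_neg, zpow_natCast]

theorem le_sqrt_self (hε : 0 < ε) (hε1 : ε ≤ 1) : ε ≤ √ε := by
  have h0 := Real.sqrt_nonneg ε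
  have h1 : √ε ≤ 1 := Real.sqrt_le_one.2 hε1
  nlinarith [Real.sq_sqrt hε.le]

theorem eps_sq_mul_smooth_three_le (hε : 0 < ε) (hε1 : ε ≤ 1) :
    ε ^ 2 * (1 + ε ^ (1 - ((3 : ℕ) : ℤ)) * √ε) ≤ 2 * √ε := by
  have h1 := le_sqrt_self hε hε1
  rw [show 1 - ((3 : ℕ) : ℤ) = -((2 : ℕ) : ℤ) by norm_num, zpow_neg, zpow_natCast]
  calc ε ^ 2 * (1 + (ε ^ 2)⁻¹ * √ε) = ε ^ 2 + √ε := by field_simp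
    _ ≤ 2 * √ε := by nlinarith

theorem eps_sq_mul_smooth_two_le (hε : 0 < ε) (hε1 : ε ≤ 1) :
    ε ^ 2 * (1 + ε ^ (1 - ((2 : ℕ) : ℤ)) * √ε) ≤ 2 * ε := by
  have h1 : √ε ≤ 1 := Real.sqrt_le_one.2 hε1
  rw [show 1 - ((2 : ℕ) : ℤ) = -1 by norm_num, zpow_neg_one]
  calc ε ^ 2 * (1 + ε⁻¹ * √ε) = ε ^ 2 + ε * √ε := by field_simp
    _ ≤ 2 * ε := by nlinarith

theorem eps_sq_mul_smooth_zero_le (hε : 0 < ε) (hε1 : ε ≤ 1) :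
    ε ^ 2 * (1 + ε ^ (1 - ((0 : ℕ) : ℤ)) * √ε) ≤ 2 * √ε := by
  have h0 := le_sqrt_self hε hε1
  have h1 : √ε ≤ 1 := Real.sqrt_le_one.2 hε1
  have h2 : ε * √ε ≤ 1 := mul_le_one₀ hε1 (Real.sqrt_nonneg _) h1
  rw [show 1 - ((0 : ℕ) : ℤ) = 1 by norm_num, zpow_one]
  nlinarith

theorem eps_sq_mul_corner (hε : 0 < ε) : ε ^ 2 * (ε ^ (-3 : ℤ) * ε) = 1 := by
  rw [zpow_neg_three]
  field_simp

theorem eps_sq_mul_layer_zero_le (hε : 0 < ε) (hε1 : ε ≤ 1) :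
    ε ^ 2 * (ε ^ (-((0 : ℕ) : ℤ)) * √ε + ε ^ (-3 : ℤ) * ε) ≤ 2 := by
  have h1 : √ε ≤ 1 := Real.sqrt_le_one.2 hε1
  have h2 : ε ^ 2 * √ε ≤ 1 :=
    mul_le_one₀ (pow_le_one₀ hε.le hε1) (Real.sqrt_nonneg _) h1
  rw [mul_add, eps_sq_mul_corner hε]
  simp only [Nat.cast_zero, neg_zero, zpow_zero, one_mul]
  linarith

theorem eps_sq_mul_layer_one_le (hε : 0 < ε) (hε1 : ε ≤ 1) :
    ε ^ 2 * (ε ^ (-((1 : ℕ) : ℤ)) * √ε + ε ^ (-3 : ℤ) * ε) ≤ 2 := by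
  have h1 : √ε ≤ 1 := Real.sqrt_le_one.2 hε1
  have h2 : ε * √ε ≤ 1 := mul_le_one₀ hε1 (Real.sqrt_nonneg _) h1
  rw [mul_add, eps_sq_mul_corner hε, Nat.cast_one, zpow_neg_one]
  have : ε ^ 2 * (ε⁻¹ * √ε) = ε * √ε := by field_simp
  linarith

end Powers

/-! ### Moment bounds scaled by ε². -/

section

variable {ε C₀ : ℝ} {N : ℕ} {u : ℝ × ℝ → ℝ} {κ : ℕ → ℕ → GradCoeffs}

/-- The number R records the contribution of A. The condition `hk` excludes k = 3 for small ε, since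
its left side then contains ε to the power -1/2; u_xxx is therefore treated separately. -/
theorem eps_sq_mul_moment_le (h : Admissible ε N) (hu : LayerDecomposition ε C₀ u)
    {g : ℕ → ℕ → ℝ → ℝ} {G : ℕ → ℕ → ℝ} (hg : TestFamily ε N (cellNorm ε N κ) 4 g G)
    {k l : ℕ} (hkl : k + l = 3) {R : ℝ} (hR : ε ^ 2 * (1 + ε ^ (1 - (l : ℤ)) * √ε) ≤ 2 * R)
    (hk : ε ^ 2 * (ε ^ (-(k : ℤ)) * √ε + ε ^ (-3 : ℤ) * ε) ≤ 2) :
    ε ^ 2 * ∑ i ∈ Finset.range N, ∑ j ∈ Finset.range N,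
        |∫ p in cell ε N i j, partialXY k l u p * g i j p.1| ≤
      128 * Real.exp 4 * C₀ * (R * (N : ℝ)⁻¹ + ε * (N : ℝ)⁻¹ * Real.log N)
        * coeffNorm ε N κ := by
  obtain ⟨A, E, D, hs⟩ := hu.exists_layerSplit
  have hε := h.eps_pos
  have hN := h.cast_pos
  have hlog := h.one_le_log
  have hC := hs.nonneg hε
  have hX : 0 ≤ coeffNorm ε N κ := Real.sqrt_nonneg _
  have hE4 : (1 : ℝ) ≤ Real.exp 4 := Real.one_le_exp (by norm_num)
  have hR0 : 0 ≤ R := by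
    have : 0 ≤ ε ^ 2 * (1 + ε ^ (1 - (l : ℤ)) * √ε) := by positivity
    linarith
  have h1 := mul_le_mul_of_nonneg_left (sum_abs_moment_le h hs hX (sum_cellNorm_sq h κ).le
    hg hkl) (sq_nonneg ε)
  refine h1.trans ?_
  calc _ = 16 * C₀ * ((ε ^ 2 * (1 + ε ^ (1 - (l : ℤ)) * √ε)) * (N : ℝ)⁻¹) * coeffNorm ε N κ
        + 64 * Real.exp 4 * C₀ * (ε * (N : ℝ)⁻¹ * Real.log N *
          (ε ^ 2 * (ε ^ (-(k : ℤ)) * √ε + ε ^ (-3 : ℤ) * ε))) * coeffNorm ε N κ := by ring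
    _ ≤ 16 * C₀ * ((2 * R) * (N : ℝ)⁻¹) * coeffNorm ε N κ
        + 64 * Real.exp 4 * C₀ * (ε * (N : ℝ)⁻¹ * Real.log N * 2) * coeffNorm ε N κ := by
        gcongr
    _ = 32 * 1 * (C₀ * (R * (N : ℝ)⁻¹) * coeffNorm ε N κ)
        + 128 * Real.exp 4 * (C₀ * (ε * (N : ℝ)⁻¹ * Real.log N) * coeffNorm ε N κ) := by ring
    _ ≤ 128 * Real.exp 4 * (C₀ * (R * (N : ℝ)⁻¹) * coeffNorm ε N κ)
        + 128 * Real.exp 4 * (C₀ * (ε * (N : ℝ)⁻¹ * Real.log N) * coeffNorm ε N κ) := by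
        gcongr
        norm_num
    _ = _ := by ring

theorem eps_sq_mul_normal_moment_le (h : Admissible ε N) (hu : LayerDecomposition ε C₀ u) :
    ε ^ 2 * ∑ i ∈ Finset.range N, ∑ j ∈ Finset.range N,
        |∫ p in cell ε N i j, partialXY 0 3 u p * testFun ε N i (κ i j).c 0 p.1| ≤
      128 * Real.exp 4 * C₀ * (√ε * (N : ℝ)⁻¹ + ε * (N : ℝ)⁻¹ * Real.log N)
        * coeffNorm ε N κ :=
  eps_sq_mul_moment_le h hu (testFamily_c h κ) rfl
    (eps_sq_mul_smooth_three_le h.eps_pos h.eps_le_one)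
    (eps_sq_mul_layer_zero_le h.eps_pos h.eps_le_one)

theorem eps_sq_mul_tangential_moment_le (h : Admissible ε N) (hu : LayerDecomposition ε C₀ u) :
    ε ^ 2 * ∑ i ∈ Finset.range N, ∑ j ∈ Finset.range N,
        |∫ p in cell ε N i j, partialXY 1 2 u p * testFun ε N i (κ i j).p₁ (κ i j).p₂ p.1| ≤
      256 * Real.exp 4 * C₀ * (ε * (N : ℝ)⁻¹ * Real.log N) * coeffNorm ε N κ := by
  refine (eps_sq_mul_moment_le h hu (testFamily_p h κ) rfl
    (eps_sq_mul_smooth_two_le h.eps_pos h.eps_le_one)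
    (eps_sq_mul_layer_one_le h.eps_pos h.eps_le_one)).trans ?_
  obtain ⟨A, E, D, hs⟩ := hu.exists_layerSplit
  have hε := h.eps_pos
  have hN := h.cast_pos
  have hlog := h.one_le_log
  have hC := hs.nonneg hε
  have hX : 0 ≤ coeffNorm ε N κ := Real.sqrt_nonneg _
  calc _ = 128 * Real.exp 4 * C₀ * (ε * (N : ℝ)⁻¹ * 1 + ε * (N : ℝ)⁻¹ * Real.log N)
        * coeffNorm ε N κ := by ring
    _ ≤ 128 * Real.exp 4 * C₀ * (ε * (N : ℝ)⁻¹ * Real.log N + ε * (N : ℝ)⁻¹ * Real.log N)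
        * coeffNorm ε N κ := by gcongr
    _ = _ := by ring

theorem eps_sq_mul_boundary_moment_le {A E D : ℝ × ℝ → ℝ} (h : Admissible ε N)
    (hs : LayerSplit ε C₀ u A E D) (hκ : HorizontalNormal ε N κ) :
    ε ^ 2 * |∑ i ∈ Finset.range N, ∑ j ∈ Finset.range N,
        ∫ p in cell ε N i j, partialXY 3 0 E p * testFun ε N i (κ i j).p₁ (κ i j).p₂ p.1| ≤
      136 * Real.exp 4 * C₀ * (√ε * (N : ℝ)⁻¹) * coeffNorm ε N κ := by
  have hε := h.eps_pos
  have hN := h.cast_pos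
  have hC := hs.nonneg hε
  have hX : 0 ≤ coeffNorm ε N κ := Real.sqrt_nonneg _
  have hE4 : (1 : ℝ) ≤ Real.exp 4 := Real.one_le_exp (by norm_num)
  have z1 : ε ^ (1 - ((3 : ℕ) : ℤ)) = ε * ε ^ (-3 : ℤ) := by
    rw [show 1 - ((3 : ℕ) : ℤ) = 1 + (-3) by norm_num, zpow_add₀ hε.ne', zpow_one]
  have cH : ContDiffOn ℝ 1 (partialXY 3 0 E) closedSquare := by
    exact_mod_cast hs.boundE.contDiffOn_partialXY (n := 1) (by norm_num)
  have h1 := abs_sum_moment_boundary_le (H := partialXY 3 0 E) (b := C₀ * ε ^ (-3 : ℤ)) h hκ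
    (by positivity) cH
    (fun p hp => by
      refine (hs.boundE.2 3 0 (by norm_num) p hp).trans_eq ?_
      beta_reduce
      rw [z1]
      ring)
    (fun p hp => by
      rw [partialX_partialXY]
      refine (hs.boundE.2 4 0 (by norm_num) p hp).trans_eq ?_
      norm_num
      ring)
    (fun p hp => by
      rw [partialY_partialXY 3 0 hs.boundE.1 hp]
      refine (hs.boundE.2 3 1 (by norm_num) p hp).trans_eq ?_
      beta_reduce
      rw [z1]
      ring)
  calc _ ≤ ε ^ 2 * ((128 * Real.exp 4 + 8) * (C₀ * ε ^ (-3 : ℤ) * ε * √ε / N)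
        * coeffNorm ε N κ) := mul_le_mul_of_nonneg_left h1 (sq_nonneg ε)
    _ = (128 * Real.exp 4 + 8) * ((ε ^ 2 * (ε ^ (-3 : ℤ) * ε)) * C₀ * (√ε * (N : ℝ)⁻¹))
        * coeffNorm ε N κ := by ring
    _ = (128 * Real.exp 4 + 8 * 1) * (C₀ * (√ε * (N : ℝ)⁻¹)) * coeffNorm ε N κ := by
        rw [eps_sq_mul_corner hε]
        ring
    _ ≤ (128 * Real.exp 4 + 8 * Real.exp 4) * (C₀ * (√ε * (N : ℝ)⁻¹)) * coeffNorm ε N κ := by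
        gcongr
    _ = _ := by ring

/-- u_xyy and the A and D parts of u_xxx are bounded cell by cell. The E part needs cancellation
between cells, so the absolute value stands outside the sum. -/
theorem eps_sq_mul_interp_moment_le (h : Admissible ε N) (hu : LayerDecomposition ε C₀ u)
    (hκ : HorizontalNormal ε N κ) :
    ε ^ 2 * |∑ i ∈ Finset.range N, ∑ j ∈ Finset.range N,
        ∫ p in cell ε N i j, (partialXY 3 0 u p + partialXY 1 2 u p)
          * testFun ε N i (κ i j).p₁ (κ i j).p₂ p.1| ≤
      512 * Real.exp 4 * C₀ * (√ε * (N : ℝ)⁻¹ + ε * (N : ℝ)⁻¹ * Real.log N)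
        * coeffNorm ε N κ := by
  obtain ⟨A, E, D, hs⟩ := hu.exists_layerSplit
  have hε := h.eps_pos
  have hε1 := h.eps_le_one
  have hN := h.cast_pos
  have hlog := h.one_le_log
  have hC := hs.nonneg hε
  have hX : 0 ≤ coeffNorm ε N κ := Real.sqrt_nonneg _
  have hE4 : (1 : ℝ) ≤ Real.exp 4 := Real.one_le_exp (by norm_num)
  have bu := eps_sq_mul_tangential_moment_le (κ := κ) h hu
  have bE := eps_sq_mul_boundary_moment_le h hs hκ
  have bA := mul_le_mul_of_nonneg_left (sum_abs_moment_A_le h hs hX (sum_cellNorm_sq h κ).le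
    (testFamily_p h κ) (k := 3) (l := 0) rfl) (sq_nonneg ε)
  have bD := mul_le_mul_of_nonneg_left (sum_abs_moment_D_le h hs hX (sum_cellNorm_sq h κ).le
    (testFamily_p h κ) (k := 3) (l := 0) rfl) (sq_nonneg ε)
  set g : ℕ → ℕ → ℝ → ℝ := fun i j => testFun ε N i (κ i j).p₁ (κ i j).p₂ with hg
  have split : ∀ i ∈ Finset.range N, ∀ j ∈ Finset.range N,
      ∫ p in cell ε N i j, (partialXY 3 0 u p + partialXY 1 2 u p) * g i j p.1 =
        (∫ p in cell ε N i j, partialXY 1 2 u p * g i j p.1)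
        + (∫ p in cell ε N i j, partialXY 3 0 E p * g i j p.1)
        + (∫ p in cell ε N i j, partialXY 3 0 A p * g i j p.1)
        + ∫ p in cell ε N i j, partialXY 3 0 D p * g i j p.1 := by
    intro i hi j hj
    have hsub := h.cell_subset (Finset.mem_range.1 hi) (Finset.mem_range.1 hj)
    have cg : ContinuousOn (fun p : ℝ × ℝ => g i j p.1) (cell ε N i j) :=
      ((continuous_testFun _ _ _ _ _).comp continuous_fst).continuousOn
    have i1 : IntegrableOn (fun p => partialXY 1 2 u p * g i j p.1) (cell ε N i j) :=
      integrableOn_cell (((contDiffOn_partialXY (n := 0) 1 2 (hu.contDiffOn.of_le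
        (by norm_cast))).continuousOn.mono hsub).mul cg)
    have i2 : IntegrableOn (fun p => partialXY 3 0 E p * g i j p.1) (cell ε N i j) :=
      integrableOn_cell (((hs.boundE.contDiffOn_partialXY (n := 0)
        (by norm_num)).continuousOn.mono hsub).mul cg)
    have i3 : IntegrableOn (fun p => partialXY 3 0 A p * g i j p.1) (cell ε N i j) :=
      integrableOn_cell (((hs.boundA.contDiffOn_partialXY (n := 0)
        (by norm_num)).continuousOn.mono hsub).mul cg)
    have i4 : IntegrableOn (fun p => partialXY 3 0 D p * g i j p.1) (cell ε N i j) :=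
      integrableOn_cell (((hs.boundD.contDiffOn_partialXY (n := 0)
        (by norm_num)).continuousOn.mono hsub).mul cg)
    have i12 : IntegrableOn (fun p => partialXY 1 2 u p * g i j p.1
        + partialXY 3 0 E p * g i j p.1) (cell ε N i j) := i1.add i2
    have i123 : IntegrableOn (fun p => partialXY 1 2 u p * g i j p.1
        + partialXY 3 0 E p * g i j p.1 + partialXY 3 0 A p * g i j p.1) (cell ε N i j) :=
      i12.add i3
    rw [← integral_add i1 i2, ← integral_add i12 i3, ← integral_add i123 i4]
    refine setIntegral_congr_fun (measurableSet_cell ε N i j) fun p hp => ?_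
    simp only [hs.partialXY_eq (i := 3) (j := 0) (by norm_num) (hsub hp), Pi.add_apply]
    ring
  have habs : ∀ f : ℕ → ℕ → ℝ, |∑ i ∈ Finset.range N, ∑ j ∈ Finset.range N, f i j| ≤
      ∑ i ∈ Finset.range N, ∑ j ∈ Finset.range N, |f i j| := fun f =>
    (Finset.abs_sum_le_sum_abs _ _).trans
      (Finset.sum_le_sum fun i _ => Finset.abs_sum_le_sum_abs _ _)
  rw [Finset.sum_congr rfl fun i hi => Finset.sum_congr rfl (split i hi)]
  simp only [Finset.sum_add_distrib]
  -- The second summand is the E part; it keeps its absolute value until `bE` is applied to the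
  -- whole sum.
  have tri : ∀ a b c d a' c' d' : ℝ, |a| ≤ a' → |c| ≤ c' → |d| ≤ d' →
      |a + b + c + d| ≤ a' + |b| + c' + d' := by
    intro a b c d a' c' d' ha hc hd
    have h1 := abs_add_le (a + b + c) d
    have h2 := abs_add_le (a + b) c
    have h3 := abs_add_le a b
    linarith
  refine (mul_le_mul_of_nonneg_left (tri _ _ _ _ _ _ _ (habs _) (habs _) (habs _))
    (sq_nonneg ε)).trans ?_
  simp only [mul_add]
  refine (add_le_add (add_le_add (add_le_add bu bE) bA) bD).trans ?_
  calc _ = 256 * Real.exp 4 * C₀ * (ε * (N : ℝ)⁻¹ * Real.log N) * coeffNorm ε N κ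
        + 136 * Real.exp 4 * C₀ * (√ε * (N : ℝ)⁻¹) * coeffNorm ε N κ
        + 16 * C₀ * ((ε ^ 2 * (1 + ε ^ (1 - ((0 : ℕ) : ℤ)) * √ε)) * (N : ℝ)⁻¹) * coeffNorm ε N κ
        + 64 * Real.exp 4 * C₀ * (ε * (N : ℝ)⁻¹ * Real.log N *
          (ε ^ 2 * (ε ^ (-3 : ℤ) * ε))) * coeffNorm ε N κ := by ring
    _ ≤ 256 * Real.exp 4 * C₀ * (ε * (N : ℝ)⁻¹ * Real.log N) * coeffNorm ε N κ
        + 136 * Real.exp 4 * C₀ * (√ε * (N : ℝ)⁻¹) * coeffNorm ε N κ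
        + 16 * C₀ * (2 * √ε * (N : ℝ)⁻¹) * coeffNorm ε N κ
        + 64 * Real.exp 4 * C₀ * (ε * (N : ℝ)⁻¹ * Real.log N * 1) * coeffNorm ε N κ := by
        have hz := eps_sq_mul_smooth_zero_le hε hε1
        rw [eps_sq_mul_corner hε]
        generalize ε ^ 2 * (1 + ε ^ (1 - ((0 : ℕ) : ℤ)) * √ε) = Z at hz
        gcongr
    _ = 320 * (Real.exp 4 * (C₀ * (ε * (N : ℝ)⁻¹ * Real.log N) * coeffNorm ε N κ))
        + 136 * (Real.exp 4 * (C₀ * (√ε * (N : ℝ)⁻¹) * coeffNorm ε N κ))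
        + 32 * (1 * (C₀ * (√ε * (N : ℝ)⁻¹) * coeffNorm ε N κ)) := by ring
    _ ≤ 512 * (Real.exp 4 * (C₀ * (ε * (N : ℝ)⁻¹ * Real.log N) * coeffNorm ε N κ))
        + 136 * (Real.exp 4 * (C₀ * (√ε * (N : ℝ)⁻¹) * coeffNorm ε N κ))
        + 376 * (Real.exp 4 * (C₀ * (√ε * (N : ℝ)⁻¹) * coeffNorm ε N κ)) := by
        gcongr
        · norm_num
        · norm_num
    _ = _ := by ring

end

/-! ### Shape functions and their coefficients -/

/-- The shape function with the given centred coefficients and constant term. -/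
noncomputable def GradCoeffs.poly (κ : GradCoeffs) (K a b w v : ℝ) (p : ℝ × ℝ) : ℝ :=
  K + κ.p₀ * (p.1 - a) + κ.p₁ * (p.1 - a) ^ 2 / 2
    + κ.p₂ * ((p.1 - a) ^ 3 / 3 - w ^ 2 / 12 * (p.1 - a))
    + κ.q₀ * (p.2 - b) + κ.q₁ * (p.2 - b) ^ 2 / 2
    + κ.q₂ * ((p.2 - b) ^ 3 / 3 - v ^ 2 / 12 * (p.2 - b)) + κ.c * (p.1 - a) * (p.2 - b)

theorem exists_monomial_coeffs {f : ℝ × ℝ → ℝ} (hf : f ∈ shapeSpace) :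
    ∃ c₀ c₁ c₂ c₃ c₄ c₅ c₆ c₇ : ℝ, ∀ p, f p = c₀ + c₁ * p.1 + c₂ * p.2 + c₃ * p.1 ^ 2
      + c₄ * (p.1 * p.2) + c₅ * p.2 ^ 2 + c₆ * p.1 ^ 3 + c₇ * p.2 ^ 3 := by
  unfold shapeSpace at hf
  induction hf using Submodule.span_induction with
  | mem f hf =>
    simp only [mem_insert_iff, mem_singleton_iff] at hf
    rcases hf with rfl | rfl | rfl | rfl | rfl | rfl | rfl | rfl
    · exact ⟨1, 0, 0, 0, 0, 0, 0, 0, fun p => by ring⟩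
    · exact ⟨0, 1, 0, 0, 0, 0, 0, 0, fun p => by ring⟩
    · exact ⟨0, 0, 1, 0, 0, 0, 0, 0, fun p => by ring⟩
    · exact ⟨0, 0, 0, 1, 0, 0, 0, 0, fun p => by ring⟩
    · exact ⟨0, 0, 0, 0, 1, 0, 0, 0, fun p => by ring⟩
    · exact ⟨0, 0, 0, 0, 0, 1, 0, 0, fun p => by ring⟩
    · exact ⟨0, 0, 0, 0, 0, 0, 1, 0, fun p => by ring⟩
    · exact ⟨0, 0, 0, 0, 0, 0, 0, 1, fun p => by ring⟩
  | zero => exact ⟨0, 0, 0, 0, 0, 0, 0, 0, fun p => by simp⟩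
  | add f g _ _ hf hg =>
    obtain ⟨a₀, a₁, a₂, a₃, a₄, a₅, a₆, a₇, ha⟩ := hf
    obtain ⟨b₀, b₁, b₂, b₃, b₄, b₅, b₆, b₇, hb⟩ := hg
    refine ⟨a₀ + b₀, a₁ + b₁, a₂ + b₂, a₃ + b₃, a₄ + b₄, a₅ + b₅, a₆ + b₆, a₇ + b₇, fun p => ?_⟩
    rw [Pi.add_apply, ha, hb]
    ring
  | smul r f _ hf =>
    obtain ⟨a₀, a₁, a₂, a₃, a₄, a₅, a₆, a₇, ha⟩ := hf
    refine ⟨r * a₀, r * a₁, r * a₂, r * a₃, r * a₄, r * a₅, r * a₆, r * a₇, fun p => ?_⟩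
    rw [Pi.smul_apply, ha, smul_eq_mul]
    ring

theorem exists_eq_poly {f : ℝ × ℝ → ℝ} (hf : f ∈ shapeSpace) (a b w v : ℝ) :
    ∃ κ : GradCoeffs, ∃ K, f = κ.poly K a b w v := by
  obtain ⟨c₀, c₁, c₂, c₃, c₄, c₅, c₆, c₇, h⟩ := exists_monomial_coeffs hf
  -- Taylor coefficients at (a, b); the terms c₆ w²/4 and c₇ v²/4 compensate the means subtracted
  -- from the quadratic parts, as p₂ = 3 c₆ and q₂ = 3 c₇.
  refine ⟨⟨c₁ + 2 * c₃ * a + c₄ * b + 3 * c₆ * a ^ 2 + c₆ * w ^ 2 / 4, 2 * c₃ + 6 * c₆ * a, 3 * c₆,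
    c₂ + 2 * c₅ * b + c₄ * a + 3 * c₇ * b ^ 2 + c₇ * v ^ 2 / 4, 2 * c₅ + 6 * c₇ * b, 3 * c₇, c₄⟩,
    c₀ + c₁ * a + c₂ * b + c₃ * a ^ 2 + c₄ * a * b + c₅ * b ^ 2 + c₆ * a ^ 3 + c₇ * b ^ 3, ?_⟩
  funext p
  rw [h, GradCoeffs.poly]
  ring

theorem hasDerivAt_cubic (α β γ δ a x : ℝ) :
    HasDerivAt (fun t => α + β * (t - a) + γ * (t - a) ^ 2 + δ * (t - a) ^ 3)
      (β + 2 * γ * (x - a) + 3 * δ * (x - a) ^ 2) x := by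
  have h1 : HasDerivAt (fun t : ℝ => t - a) 1 x := (hasDerivAt_id x).sub_const a
  refine ((((hasDerivAt_const x α).add (h1.const_mul β)).add ((h1.pow 2).const_mul γ)).add
    ((h1.pow 3).const_mul δ)).congr_deriv ?_
  push_cast
  ring

namespace GradCoeffs

variable (κ : GradCoeffs) (K a b w v : ℝ)

theorem poly_swap (p : ℝ × ℝ) : κ.swap.poly K b a v w p = κ.poly K a b w v p.swap := by
  simp only [poly, swap, Prod.fst_swap, Prod.snd_swap]
  ring

theorem dx_poly (p : ℝ × ℝ) : dx (κ.poly K a b w v) p =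
    κ.p₀ + κ.p₁ * (p.1 - a) + κ.p₂ * ((p.1 - a) ^ 2 - w ^ 2 / 12) + κ.c * (p.2 - b) := by
  have h := hasDerivAt_cubic (K + κ.q₀ * (p.2 - b) + κ.q₁ * (p.2 - b) ^ 2 / 2
    + κ.q₂ * ((p.2 - b) ^ 3 / 3 - v ^ 2 / 12 * (p.2 - b)))
    (κ.p₀ - κ.p₂ * w ^ 2 / 12 + κ.c * (p.2 - b)) (κ.p₁ / 2) (κ.p₂ / 3) a p.1
  have he : (fun t => κ.poly K a b w v (t, p.2)) = fun t =>
      K + κ.q₀ * (p.2 - b) + κ.q₁ * (p.2 - b) ^ 2 / 2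
        + κ.q₂ * ((p.2 - b) ^ 3 / 3 - v ^ 2 / 12 * (p.2 - b))
        + (κ.p₀ - κ.p₂ * w ^ 2 / 12 + κ.c * (p.2 - b)) * (t - a) + κ.p₁ / 2 * (t - a) ^ 2
        + κ.p₂ / 3 * (t - a) ^ 3 := by
    funext t
    unfold poly
    ring
  rw [dx, he, h.deriv]
  ring

theorem dy_poly (p : ℝ × ℝ) : dy (κ.poly K a b w v) p =
    κ.q₀ + κ.q₁ * (p.2 - b) + κ.q₂ * ((p.2 - b) ^ 2 - v ^ 2 / 12) + κ.c * (p.1 - a) := by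
  have h : κ.poly K a b w v = κ.swap.poly K b a v w ∘ Prod.swap := by
    funext p
    rw [Function.comp, poly_swap, Prod.swap_swap]
  rw [h]
  exact κ.swap.dx_poly K b a v w p.swap

theorem dx_dx_poly (p : ℝ × ℝ) :
    dx (dx (κ.poly K a b w v)) p = κ.p₁ + 2 * κ.p₂ * (p.1 - a) := by
  have h := hasDerivAt_cubic (κ.p₀ - κ.p₂ * w ^ 2 / 12 + κ.c * (p.2 - b)) κ.p₁ κ.p₂ 0 a p.1
  have he : (fun t => dx (κ.poly K a b w v) (t, p.2)) = fun t =>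
      κ.p₀ - κ.p₂ * w ^ 2 / 12 + κ.c * (p.2 - b) + κ.p₁ * (t - a) + κ.p₂ * (t - a) ^ 2
        + 0 * (t - a) ^ 3 := by
    funext t
    rw [dx_poly]
    ring
  rw [dx, he, h.deriv]
  ring

theorem dy_dy_poly (p : ℝ × ℝ) :
    dy (dy (κ.poly K a b w v)) p = κ.q₁ + 2 * κ.q₂ * (p.2 - b) := by
  have h := hasDerivAt_cubic (κ.q₀ - κ.q₂ * v ^ 2 / 12 + κ.c * (p.1 - a)) κ.q₁ κ.q₂ 0 b p.2
  have he : (fun t => dy (κ.poly K a b w v) (p.1, t)) = fun t =>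
      κ.q₀ - κ.q₂ * v ^ 2 / 12 + κ.c * (p.1 - a) + κ.q₁ * (t - b) + κ.q₂ * (t - b) ^ 2
        + 0 * (t - b) ^ 3 := by
    funext t
    rw [dy_poly]
    ring
  rw [dy, he, h.deriv]
  ring

/-- The bilinear interpolation error consists of the higher order part of the shape function. -/
theorem poly_sub_bilinearInterp {x₀ x₁ y₀ y₁ : ℝ} (hx : x₀ < x₁) (hy : y₀ < y₁) :
    (κ.poly K ((x₀ + x₁) / 2) ((y₀ + y₁) / 2) (x₁ - x₀) (y₁ - y₀)
      - bilinearInterp x₀ x₁ y₀ y₁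
        (κ.poly K ((x₀ + x₁) / 2) ((y₀ + y₁) / 2) (x₁ - x₀) (y₁ - y₀))) =
    GradCoeffs.poly ⟨0, κ.p₁, κ.p₂, 0, κ.q₁, κ.q₂, 0⟩
      (-(κ.p₁ * (x₁ - x₀) ^ 2 / 8 + κ.q₁ * (y₁ - y₀) ^ 2 / 8))
      ((x₀ + x₁) / 2) ((y₀ + y₁) / 2) (x₁ - x₀) (y₁ - y₀) := by
  -- Interpolation reproduces 1, x, y and xy. The centred cubics vanish at all four vertices, and
  -- the squares take there the constant values w²/8 and v²/8 once multiplied by 1/2; this gives the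
  -- constant term of the error.
  obtain ⟨w, rfl⟩ : ∃ w, x₁ = x₀ + w := ⟨x₁ - x₀, by ring⟩
  obtain ⟨v, rfl⟩ : ∃ v, y₁ = y₀ + v := ⟨y₁ - y₀, by ring⟩
  have hw : w ≠ 0 := by
    rintro rfl
    simp at hx
  have hv : v ≠ 0 := by
    rintro rfl
    simp at hy
  funext p
  rw [Pi.sub_apply]
  simp only [bilinearInterp, poly, add_sub_cancel_left]
  field_simp
  ring

end GradCoeffs

/-- Odd moments about the midpoint vanish. Degree four suffices because the squared gradient has at
most this degree in each variable. -/
theorem integral_quartic (ε : ℝ) (N i : ℕ) (α β γ δ η : ℝ) :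
    ∫ x in node ε N i..node ε N (i + 1), (α + β * (x - center ε N i)
      + γ * (x - center ε N i) ^ 2 + δ * (x - center ε N i) ^ 3 + η * (x - center ε N i) ^ 4) =
      α * width ε N i + γ * width ε N i ^ 3 / 12 + η * width ε N i ^ 5 / 80 := by
  rw [intervalIntegral.integral_comp_sub_right
    (fun s => α + β * s + γ * s ^ 2 + δ * s ^ 3 + η * s ^ 4)]
  have hd : ∀ s ∈ uIcc (node ε N i - center ε N i) (node ε N (i + 1) - center ε N i),
      HasDerivAt (fun s => α * s + β * s ^ 2 / 2 + γ * s ^ 3 / 3 + δ * s ^ 4 / 4 + η * s ^ 5 / 5)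
        (α + β * s + γ * s ^ 2 + δ * s ^ 3 + η * s ^ 4) s := by
    intro s _
    have h1 := hasDerivAt_id s
    refine (((((h1.const_mul α).add (((h1.pow 2).const_mul β).div_const 2)).add
      (((h1.pow 3).const_mul γ).div_const 3)).add (((h1.pow 4).const_mul δ).div_const 4)).add
      (((h1.pow 5).const_mul η).div_const 5)).congr_deriv ?_
    simp only [id]
    push_cast
    ring
  rw [intervalIntegral.integral_eq_sub_of_hasDerivAt hd
    (Continuous.intervalIntegrable (by fun_prop) _ _), center, width]
  ring

/-! ### Coefficients of a Morley function and their behaviour under exchange of variables. -/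

section

variable {ε : ℝ} {N : ℕ}

/-- The coefficients `κ` belong to the piecewise shape function `ξ`. -/
def Represents (ε : ℝ) (N : ℕ) (κ : ℕ → ℕ → GradCoeffs) (ξ : ℕ → ℕ → ℝ × ℝ → ℝ) : Prop :=
  ∀ i < N, ∀ j < N, ∃ K,
    ξ i j = (κ i j).poly K (center ε N i) (center ε N j) (width ε N i) (width ε N j)

/-- Exchange of the two variables in a family of coefficients. -/
def swapCoeffs (κ : ℕ → ℕ → GradCoeffs) (i j : ℕ) : GradCoeffs := (κ j i).swap

/-- Exchange of the two variables in a piecewise function. -/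
def swapFun (ξ : ℕ → ℕ → ℝ × ℝ → ℝ) (i j : ℕ) : ℝ × ℝ → ℝ := ξ j i ∘ Prod.swap

theorem IsMorley.exists_represents {ξ : ℕ → ℕ → ℝ × ℝ → ℝ} (hξ : IsMorley ε N ξ) :
    ∃ κ, Represents ε N κ ξ := by
  classical
  have : ∀ i j, ∃ κ : GradCoeffs, i < N → j < N → ∃ K,
      ξ i j = κ.poly K (center ε N i) (center ε N j) (width ε N i) (width ε N j) := by
    intro i j
    by_cases hij : i < N ∧ j < N
    · obtain ⟨κ, hκ⟩ := exists_eq_poly (hξ.mem_shape i hij.1 j hij.2) (center ε N i)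
        (center ε N j) (width ε N i) (width ε N j)
      exact ⟨κ, fun _ _ => hκ⟩
    -- Arbitrary values off the mesh, where nothing is required.
    · exact ⟨⟨0, 0, 0, 0, 0, 0, 0⟩, fun hi hj => absurd ⟨hi, hj⟩ hij⟩
  choose κ hκ using this
  exact ⟨κ, fun i hi j hj => hκ i j hi hj⟩

theorem Represents.swap {κ : ℕ → ℕ → GradCoeffs} {ξ : ℕ → ℕ → ℝ × ℝ → ℝ}
    (h : Represents ε N κ ξ) : Represents ε N (swapCoeffs κ) (swapFun ξ) := by
  intro i hi j hj
  obtain ⟨K, hK⟩ := h j hj i hi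
  refine ⟨K, funext fun p => ?_⟩
  rw [swapFun, swapCoeffs, GradCoeffs.poly_swap, hK]
  rfl

theorem coeffNorm_swap (κ : ℕ → ℕ → GradCoeffs) :
    coeffNorm ε N (swapCoeffs κ) = coeffNorm ε N κ := by
  unfold coeffNorm swapCoeffs
  rw [Finset.sum_comm]
  simp only [GradCoeffs.energy_swap]

theorem IsMorley.swap {ξ : ℕ → ℕ → ℝ × ℝ → ℝ} (h : IsMorley ε N ξ)
    (hs : ∀ i < N, ∀ j < N, swapFun ξ i j ∈ shapeSpace) : IsMorley ε N (swapFun ξ) where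
  mem_shape := hs
  vertex_continuous k hk l hl i hi j hj i' hi' j' hj' h1 h2 h3 h4 :=
    h.vertex_continuous l hl k hk j hj i hi j' hj' i' hi' h2 h1 h4 h3
  vertex_boundary k hk l hl hb i hi j hj h1 h2 :=
    h.vertex_boundary l hl k hk (by tauto) j hj i hi h2 h1
  vertical_edge i j hi hj := h.horizontal_edge j i hj hi
  horizontal_edge i j hi hj := h.vertical_edge j i hj hi
  vertical_boundary i hi j hj := h.horizontal_boundary j hj i hi
  horizontal_boundary i hi j hj := h.vertical_boundary j hj i hi

end

section

variable {ε : ℝ} {N : ℕ}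

theorem swap_mem_shapeSpace {f : ℝ × ℝ → ℝ} (hf : f ∈ shapeSpace) :
    f ∘ Prod.swap ∈ shapeSpace := by
  unfold shapeSpace at hf ⊢
  induction hf using Submodule.span_induction with
  | mem f hf =>
    simp only [mem_insert_iff, mem_singleton_iff] at hf
    apply Submodule.subset_span
    simp only [mem_insert_iff, mem_singleton_iff]
    rcases hf with rfl | rfl | rfl | rfl | rfl | rfl | rfl | rfl
    · exact Or.inl rfl
    · exact Or.inr (Or.inr (Or.inl rfl))
    · exact Or.inr (Or.inl rfl)
    · exact Or.inr (Or.inr (Or.inr (Or.inr (Or.inr (Or.inl rfl)))))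
    · refine Or.inr (Or.inr (Or.inr (Or.inr (Or.inl (funext fun p => ?_)))))
      exact mul_comm _ _
    · exact Or.inr (Or.inr (Or.inr (Or.inl rfl)))
    · exact Or.inr (Or.inr (Or.inr (Or.inr (Or.inr (Or.inr (Or.inr rfl))))))
    · exact Or.inr (Or.inr (Or.inr (Or.inr (Or.inr (Or.inr (Or.inl rfl))))))
  | zero => exact Submodule.zero_mem _
  | add f g _ _ hf hg => exact Submodule.add_mem _ hf hg
  | smul r f _ hf => exact Submodule.smul_mem _ r hf

theorem IsMorley.swapFun {ξ : ℕ → ℕ → ℝ × ℝ → ℝ} (h : IsMorley ε N ξ) :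
    IsMorley ε N (swapFun ξ) :=
  h.swap fun i hi j hj => swap_mem_shapeSpace (h.mem_shape j hj i hi)

/-! ### The energy norm -/

theorem setIntegral_laplace_sq (h : Admissible ε N) (κ : GradCoeffs) (K : ℝ) (i j : ℕ) :
    ∫ p in cell ε N i j,
      (dx (dx (κ.poly K (center ε N i) (center ε N j) (width ε N i) (width ε N j))) p
        + dy (dy (κ.poly K (center ε N i) (center ε N j) (width ε N i) (width ε N j))) p) ^ 2 =
      width ε N i * width ε N j * ((κ.p₁ + κ.q₁) ^ 2 + κ.p₂ ^ 2 * width ε N i ^ 2 / 3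
        + κ.q₂ ^ 2 * width ε N j ^ 2 / 3) := by
  simp only [GradCoeffs.dx_dx_poly, GradCoeffs.dy_dy_poly]
  rw [setIntegral_cell_eq h (Continuous.continuousOn (by fun_prop))]
  set a := center ε N i with ha
  set b := center ε N j with hb
  set w := width ε N i with hw
  set v := width ε N j with hv
  have inner : ∀ x, ∫ y in node ε N j..node ε N (j + 1),
      (κ.p₁ + 2 * κ.p₂ * (x - a) + (κ.q₁ + 2 * κ.q₂ * (y - b))) ^ 2 =
      ((κ.p₁ + κ.q₁) ^ 2 * v + κ.q₂ ^ 2 * v ^ 3 / 3)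
        + 4 * κ.p₂ * (κ.p₁ + κ.q₁) * v * (x - a) + 4 * κ.p₂ ^ 2 * v * (x - a) ^ 2
        + 0 * (x - a) ^ 3 + 0 * (x - a) ^ 4 := by
    intro x
    have := integral_quartic ε N j ((κ.p₁ + 2 * κ.p₂ * (x - a) + κ.q₁) ^ 2)
      (4 * κ.q₂ * (κ.p₁ + 2 * κ.p₂ * (x - a) + κ.q₁)) (4 * κ.q₂ ^ 2) 0 0
    rw [← hb, ← hv] at this
    refine Eq.trans ?_ (this.trans ?_)
    · congr 1
      funext y
      ring
    · ring
  simp only [inner]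
  rw [ha, integral_quartic, ← hw]
  ring

theorem setIntegral_grad_sq (h : Admissible ε N) (κ : GradCoeffs) (K : ℝ) (i j : ℕ) :
    ∫ p in cell ε N i j,
      ((dx (κ.poly K (center ε N i) (center ε N j) (width ε N i) (width ε N j)) p) ^ 2
        + (dy (κ.poly K (center ε N i) (center ε N j) (width ε N i) (width ε N j)) p) ^ 2) =
      width ε N i * width ε N j *
        ((κ.p₀ ^ 2 + κ.p₁ ^ 2 * width ε N i ^ 2 / 12 + κ.p₂ ^ 2 * width ε N i ^ 4 / 180
          + κ.c ^ 2 * width ε N j ^ 2 / 12)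
        + (κ.q₀ ^ 2 + κ.q₁ ^ 2 * width ε N j ^ 2 / 12 + κ.q₂ ^ 2 * width ε N j ^ 4 / 180
          + κ.c ^ 2 * width ε N i ^ 2 / 12)) := by
  simp only [GradCoeffs.dx_poly, GradCoeffs.dy_poly]
  rw [setIntegral_cell_eq h (Continuous.continuousOn (by fun_prop))]
  set a := center ε N i with ha
  set b := center ε N j with hb
  set w := width ε N i with hw
  set v := width ε N j with hv
  obtain ⟨p₀, p₁, p₂, q₀, q₁, q₂, c⟩ := κ
  simp only
  -- The inner integral is again a quartic in x - a, so the same formula performs the outer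
  -- integration.
  have inner : ∀ x, ∫ y in node ε N j..node ε N (j + 1),
      ((p₀ + p₁ * (x - a) + p₂ * ((x - a) ^ 2 - w ^ 2 / 12) + c * (y - b)) ^ 2
        + (q₀ + q₁ * (y - b) + q₂ * ((y - b) ^ 2 - v ^ 2 / 12) + c * (x - a)) ^ 2) =
      (((p₀ - p₂ * w ^ 2 / 12) ^ 2 * v + c ^ 2 * v ^ 3 / 12)
          + (q₀ ^ 2 * v + q₁ ^ 2 * v ^ 3 / 12 + q₂ ^ 2 * v ^ 5 / 180))
        + (2 * (p₀ - p₂ * w ^ 2 / 12) * p₁ * v + 2 * q₀ * c * v) * (x - a)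
        + (p₁ ^ 2 * v + 2 * (p₀ - p₂ * w ^ 2 / 12) * p₂ * v + c ^ 2 * v) * (x - a) ^ 2
        + 2 * p₁ * p₂ * v * (x - a) ^ 3 + p₂ ^ 2 * v * (x - a) ^ 4 := by
    intro x
    have := integral_quartic ε N j
      ((p₀ + p₁ * (x - a) + p₂ * ((x - a) ^ 2 - w ^ 2 / 12)) ^ 2
        + (q₀ - q₂ * v ^ 2 / 12 + c * (x - a)) ^ 2)
      (2 * c * (p₀ + p₁ * (x - a) + p₂ * ((x - a) ^ 2 - w ^ 2 / 12))
        + 2 * q₁ * (q₀ - q₂ * v ^ 2 / 12 + c * (x - a)))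
      (c ^ 2 + q₁ ^ 2 + 2 * q₂ * (q₀ - q₂ * v ^ 2 / 12 + c * (x - a))) (2 * q₁ * q₂) (q₂ ^ 2)
    rw [← hb, ← hv] at this
    refine Eq.trans ?_ (this.trans ?_)
    · congr 1
      funext y
      ring
    · ring
  simp only [inner]
  rw [ha, integral_quartic, ← hw]
  ring

theorem energyNorm_eq (h : Admissible ε N) {κ : ℕ → ℕ → GradCoeffs} {ξ : ℕ → ℕ → ℝ × ℝ → ℝ}
    (hκ : Represents ε N κ ξ) : energyNorm ε N ξ = coeffNorm ε N κ := by
  unfold energyNorm coeffNorm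
  congr 1
  rw [Finset.mul_sum, ← Finset.sum_add_distrib]
  refine Finset.sum_congr rfl fun i hi => ?_
  rw [Finset.mul_sum, ← Finset.sum_add_distrib]
  refine Finset.sum_congr rfl fun j hj => ?_
  obtain ⟨K, hK⟩ := hκ i (Finset.mem_range.1 hi) j (Finset.mem_range.1 hj)
  rw [hK, setIntegral_laplace_sq h, setIntegral_grad_sq h, GradCoeffs.energy]
  ring

/-! ### Matching on the horizontal edges -/

theorem node_eq_center_sub (ε : ℝ) (N i : ℕ) :
    node ε N i = center ε N i - width ε N i / 2 := by
  unfold center width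
  ring

theorem node_succ_eq_center_add (ε : ℝ) (N i : ℕ) :
    node ε N (i + 1) = center ε N i + width ε N i / 2 := by
  unfold center width
  ring

variable {κ : ℕ → ℕ → GradCoeffs} {ξ : ℕ → ℕ → ℝ × ℝ → ℝ}

theorem Represents.dx_eq (hκ : Represents ε N κ ξ) {i j : ℕ} (hi : i < N) (hj : j < N)
    (x y : ℝ) : dx (ξ i j) (x, y) =
      (κ i j).p₀ + (κ i j).c * (y - center ε N j)
        + testFun ε N i (κ i j).p₁ (κ i j).p₂ x := by
  obtain ⟨K, hK⟩ := hκ i hi j hj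
  rw [hK, GradCoeffs.dx_poly, testFun, linTest, quadTest]
  ring

theorem Represents.dy_top (hκ : Represents ε N κ ξ) {i j : ℕ} (hi : i < N) (hj : j < N)
    (x : ℝ) : dy (ξ i j) (x, node ε N (j + 1)) =
      (κ i j).qTop (width ε N j) + testFun ε N i (κ i j).c 0 x := by
  obtain ⟨K, hK⟩ := hκ i hi j hj
  rw [hK, GradCoeffs.dy_poly, testFun, linTest, GradCoeffs.qTop, node_succ_eq_center_add]
  ring

theorem Represents.dy_bottom (hκ : Represents ε N κ ξ) {i j : ℕ} (hi : i < N) (hj : j < N)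
    (x : ℝ) : dy (ξ i j) (x, node ε N j) =
      (κ i j).qBot (width ε N j) + testFun ε N i (κ i j).c 0 x := by
  obtain ⟨K, hK⟩ := hκ i hi j hj
  rw [hK, GradCoeffs.dy_poly, testFun, linTest, GradCoeffs.qBot]
  conv_lhs => rw [show ((x, node ε N j) : ℝ × ℝ).2 = _ from node_eq_center_sub ε N j]
  ring

theorem integral_const_add_testFun (ε : ℝ) (N i : ℕ) (m s t : ℝ) :
    ∫ x in node ε N i..node ε N (i + 1), (m + testFun ε N i s t x) = width ε N i * m := by
  rw [intervalIntegral.integral_add intervalIntegrable_const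
    ((continuous_testFun ε N i s t).intervalIntegrable _ _), integral_testFun,
    intervalIntegral.integral_const, smul_eq_mul, add_zero, width]

/-- On a horizontal edge the x-dependent part of ∂ξ/∂y has mean zero, so the edge condition is a
condition on `qTop` and `qBot` alone. -/
theorem IsMorley.horizontalNormal (h : Admissible ε N) (hξ : IsMorley ε N ξ)
    (hκ : Represents ε N κ ξ) : HorizontalNormal ε N κ where
  interior i hi j hj := by
    have h1 := hξ.horizontal_edge i j hi hj
    simp only [hκ.dy_top hi (Nat.lt_of_succ_lt hj), hκ.dy_bottom hi hj,
      integral_const_add_testFun] at h1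
    exact mul_left_cancel₀ (h.width_pos i).ne' h1
  bottom i hi hN := by
    have h1 := (hξ.horizontal_boundary i hi 0 hN).1 rfl
    simp only [hκ.dy_bottom hi hN, integral_const_add_testFun] at h1
    exact (mul_eq_zero.1 h1).resolve_left (h.width_pos i).ne'
  top i hi j hj := by
    have h1 := (hξ.horizontal_boundary i hi j (by omega)).2 hj
    simp only [hκ.dy_top hi (show j < N by omega), integral_const_add_testFun] at h1
    exact (mul_eq_zero.1 h1).resolve_left (h.width_pos i).ne'

theorem Represents.top_difference (hκ : Represents ε N κ ξ) {i j : ℕ} (hi : i < N) (hj : j < N) :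
    ξ i j (node ε N (i + 1), node ε N (j + 1)) - ξ i j (node ε N i, node ε N (j + 1)) =
      width ε N i * ((κ i j).p₀ + (κ i j).c * (width ε N j / 2)) := by
  obtain ⟨K, hK⟩ := hκ i hi j hj
  rw [hK]
  simp only [GradCoeffs.poly, node_succ_eq_center_add, node_eq_center_sub]
  ring

theorem Represents.bottom_difference (hκ : Represents ε N κ ξ) {i j : ℕ} (hi : i < N)
    (hj : j < N) :
    ξ i j (node ε N (i + 1), node ε N j) - ξ i j (node ε N i, node ε N j) =
      width ε N i * ((κ i j).p₀ - (κ i j).c * (width ε N j / 2)) := by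
  obtain ⟨K, hK⟩ := hκ i hi j hj
  rw [hK]
  simp only [GradCoeffs.poly, node_succ_eq_center_add]
  simp only [node_eq_center_sub]
  ring

/-- The integral of ∂ξ/∂x over a horizontal edge is a difference of vertex values, so the vertex
conditions match the means and make them vanish on the boundary. -/
theorem IsMorley.horizontalTangential (h : Admissible ε N) (hξ : IsMorley ε N ξ)
    (hκ : Represents ε N κ ξ) :
    EdgeMatching N (fun i j => (κ i j).p₀ + (κ i j).c * (width ε N j / 2))
      (fun i j => (κ i j).p₀ - (κ i j).c * (width ε N j / 2)) where
  interior i hi j hj := by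
    refine mul_left_cancel₀ (h.width_pos i).ne' ?_
    have hj' : j < N := Nat.lt_of_succ_lt hj
    rw [← hκ.top_difference hi hj', ← hκ.bottom_difference hi hj]
    rw [hξ.vertex_continuous (i + 1) hi (j + 1) hj.le i hi j hj' i hi (j + 1) hj
        (Or.inr rfl) (Or.inr rfl) (Or.inr rfl) (Or.inl rfl),
      hξ.vertex_continuous i hi.le (j + 1) hj.le i hi j hj' i hi (j + 1) hj
        (Or.inl rfl) (Or.inr rfl) (Or.inl rfl) (Or.inl rfl)]
  bottom i hi hN := by
    refine (mul_eq_zero.1 ?_).resolve_left (h.width_pos i).ne'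
    rw [← hκ.bottom_difference hi hN,
      hξ.vertex_boundary (i + 1) hi 0 (Nat.zero_le _) (by tauto) i hi 0 hN (Or.inr rfl)
        (Or.inl rfl),
      hξ.vertex_boundary i hi.le 0 (Nat.zero_le _) (by tauto) i hi 0 hN (Or.inl rfl)
        (Or.inl rfl), sub_zero]
  top i hi j hj := by
    have hj' : j < N := by omega
    refine (mul_eq_zero.1 ?_).resolve_left (h.width_pos i).ne'
    rw [← hκ.top_difference hi hj',
      hξ.vertex_boundary (i + 1) hi (j + 1) hj.le (by tauto) i hi j hj' (Or.inr rfl)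
        (Or.inr rfl),
      hξ.vertex_boundary i hi.le (j + 1) hj.le (by tauto) i hi j hj' (Or.inl rfl)
        (Or.inr rfl), sub_zero]

/-! ### Sums over the horizontal edges -/

/-- The sum over the mesh rectangles of the integrals over the top edges minus those over the
bottom edges. -/
noncomputable def horizontalSum (ε : ℝ) (N : ℕ) (f : ℕ → ℕ → ℝ × ℝ → ℝ) : ℝ :=
  ∑ i ∈ Finset.range N, ∑ j ∈ Finset.range N,
    ((∫ x in node ε N i..node ε N (i + 1), f i j (x, node ε N (j + 1)))
      - ∫ x in node ε N i..node ε N (i + 1), f i j (x, node ε N j))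

theorem integral_partialY {H : ℝ × ℝ → ℝ} (hH : ContDiffOn ℝ 1 H closedSquare) {x c d : ℝ}
    (hx : x ∈ Icc (0 : ℝ) 1) (hcd : c ≤ d) (hsub : Icc c d ⊆ Icc (0 : ℝ) 1) :
    ∫ y in c..d, partialY H (x, y) = H (x, d) - H (x, c) := by
  have hY : ContinuousOn (partialY H) closedSquare :=
    (contDiffOn_partialY (n := 0) (by simpa using hH)).continuousOn
  have hm : MapsTo (fun y : ℝ => (x, y)) (Icc c d) closedSquare :=
    fun y hy => mk_mem_prod hx (hsub hy)
  refine intervalIntegral.integral_eq_sub_of_hasDerivAt_of_le hcd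
    (hH.continuousOn.comp (by fun_prop) hm) (fun y hy => ?_)
    (ContinuousOn.intervalIntegrable_of_Icc hcd (hY.comp (by fun_prop) hm))
  have h1 : y ∈ Icc (0 : ℝ) 1 := hsub (Ioo_subset_Icc_self hy)
  have h2 := hasDerivWithinAt_partialY hH (p := (x, y)) (mk_mem_prod hx h1)
  exact (h2.mono hsub).hasDerivAt (Icc_mem_nhds hy.1 hy.2)

theorem setIntegral_partialY_mul (h : Admissible ε N) {H : ℝ × ℝ → ℝ}
    (hH : ContDiffOn ℝ 1 H closedSquare) {g : ℝ → ℝ} (hg : Continuous g) {i j : ℕ} (hi : i < N)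
    (hj : j < N) :
    ∫ p in cell ε N i j, partialY H p * g p.1 =
      ∫ x in node ε N i..node ε N (i + 1),
        (H (x, node ε N (j + 1)) - H (x, node ε N j)) * g x := by
  have hY : ContinuousOn (partialY H) closedSquare :=
    (contDiffOn_partialY (n := 0) (by simpa using hH)).continuousOn
  have hc : ContinuousOn (fun p : ℝ × ℝ => partialY H p * g p.1) (cell ε N i j) :=
    (hY.mono (h.cell_subset hi hj)).mul (hg.comp continuous_fst).continuousOn
  rw [setIntegral_cell_eq h hc]
  refine intervalIntegral.integral_congr fun x hx => ?_
  rw [uIcc_of_le (h.node_lt i).le] at hx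
  simp only [intervalIntegral.integral_mul_const]
  rw [integral_partialY hH (h.Icc_subset hi hx) (h.node_lt j).le (h.Icc_subset hj)]

/-- The fluctuation g is common to the top and bottom edges of a cell, so its contributions combine
into the integral of ∂H/∂y over the cell, while the means t and b telescope against the edge
integrals of H. -/
theorem horizontalSum_eq (h : Admissible ε N) {H : ℝ × ℝ → ℝ}
    (hH : ContDiffOn ℝ 1 H closedSquare) {f : ℕ → ℕ → ℝ × ℝ → ℝ} {t b : ℕ → ℕ → ℝ}
    (hm : EdgeMatching N t b) {g : ℕ → ℕ → ℝ → ℝ} (hg : ∀ i j, Continuous (g i j))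
    (ht : ∀ i < N, ∀ j < N, ∀ x, f i j (x, node ε N (j + 1)) =
      H (x, node ε N (j + 1)) * (t i j + g i j x))
    (hb : ∀ i < N, ∀ j < N, ∀ x, f i j (x, node ε N j) =
      H (x, node ε N j) * (b i j + g i j x)) :
    horizontalSum ε N f = ∑ i ∈ Finset.range N, ∑ j ∈ Finset.range N,
      ∫ p in cell ε N i j, partialY H p * g i j p.1 := by
  set γ : ℕ → ℕ → ℝ := fun i j => ∫ x in node ε N i..node ε N (i + 1), H (x, node ε N j) with hγ
  have hline : ∀ i < N, ∀ l ≤ N, ContinuousOn (fun x => H (x, node ε N l))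
      (Icc (node ε N i) (node ε N (i + 1))) := fun i hi l hl =>
    hH.continuousOn.comp (by fun_prop) fun x hx => mk_mem_prod (h.Icc_subset hi hx) (h.node_mem hl)
  have hsplit : ∀ i < N, ∀ l ≤ N, ∀ (m : ℝ) (φ : ℝ → ℝ), Continuous φ →
      ∫ x in node ε N i..node ε N (i + 1), H (x, node ε N l) * (m + φ x) =
        m * γ i l + ∫ x in node ε N i..node ε N (i + 1), H (x, node ε N l) * φ x := by
    intro i hi l hl m φ hφ
    have i1 : IntervalIntegrable (fun x => m * H (x, node ε N l)) volume (node ε N i)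
        (node ε N (i + 1)) :=
      ((hline i hi l hl).const_mul m |>.intervalIntegrable_of_Icc (h.node_lt i).le)
    have i2 : IntervalIntegrable (fun x => H (x, node ε N l) * φ x) volume (node ε N i)
        (node ε N (i + 1)) :=
      ((hline i hi l hl).mul hφ.continuousOn).intervalIntegrable_of_Icc (h.node_lt i).le
    rw [hγ, ← intervalIntegral.integral_const_mul, ← intervalIntegral.integral_add i1 i2]
    congr 1
    funext x
    ring
  have key : ∀ i ∈ Finset.range N, ∀ j ∈ Finset.range N,
      ((∫ x in node ε N i..node ε N (i + 1), f i j (x, node ε N (j + 1)))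
        - ∫ x in node ε N i..node ε N (i + 1), f i j (x, node ε N j)) =
      (t i j * γ i (j + 1) - b i j * γ i j)
        + ∫ p in cell ε N i j, partialY H p * g i j p.1 := by
    intro i hi j hj
    have hi' := Finset.mem_range.1 hi
    have hj' := Finset.mem_range.1 hj
    simp only [ht i hi' j hj', hb i hi' j hj']
    rw [hsplit i hi' (j + 1) hj' _ _ (hg i j), hsplit i hi' j hj'.le _ _ (hg i j),
      setIntegral_partialY_mul h hH (hg i j) hi' hj']
    have i1 : IntervalIntegrable (fun x => H (x, node ε N (j + 1)) * g i j x) volume (node ε N i)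
        (node ε N (i + 1)) :=
      ((hline i hi' _ hj').mul (hg i j).continuousOn).intervalIntegrable_of_Icc (h.node_lt i).le
    have i2 : IntervalIntegrable (fun x => H (x, node ε N j) * g i j x) volume (node ε N i)
        (node ε N (i + 1)) :=
      ((hline i hi' _ hj'.le).mul (hg i j).continuousOn).intervalIntegrable_of_Icc
        (h.node_lt i).le
    simp only [sub_mul]
    rw [intervalIntegral.integral_sub i1 i2]
    ring
  unfold horizontalSum
  rw [Finset.sum_congr rfl fun i hi => Finset.sum_congr rfl (key i hi)]
  simp only [Finset.sum_add_distrib]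
  rw [Finset.sum_eq_zero, zero_add]
  intro i hi
  have hi' := Finset.mem_range.1 hi
  exact telescope_eq_zero (t i) (b i) (γ i) (hm.interior i hi') (hm.bottom i hi') (hm.top i hi')

end

/-! ### The three consistency terms -/

section

variable {ε C₀ : ℝ} {N : ℕ} {u : ℝ × ℝ → ℝ} {κ : ℕ → ℕ → GradCoeffs} {ξ : ℕ → ℕ → ℝ × ℝ → ℝ}

/-- The second derivative is even in n and ∂ξ/∂n is odd, so opposite edges enter with opposite
signs; the vertical edges are the horizontal ones after exchange of variables. -/
theorem normalSum_eq (ε : ℝ) (N : ℕ) (u : ℝ × ℝ → ℝ) (ξ : ℕ → ℕ → ℝ × ℝ → ℝ) :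
    normalSum ε N u ξ = horizontalSum ε N (fun i j p => partialXY 0 2 u p * dy (ξ i j) p) +
      horizontalSum ε N (fun i j p => (partialXY 2 0 u ∘ Prod.swap) p * dy (swapFun ξ i j) p) := by
  have hswap : horizontalSum ε N
      (fun i j p => (partialXY 2 0 u ∘ Prod.swap) p * dy (swapFun ξ i j) p) =
      ∑ i ∈ Finset.range N, ∑ j ∈ Finset.range N,
        ((∫ y in node ε N j..node ε N (j + 1), partialXY 2 0 u (node ε N (i + 1), y)
            * dx (ξ i j) (node ε N (i + 1), y))
          - ∫ y in node ε N j..node ε N (j + 1), partialXY 2 0 u (node ε N i, y)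
            * dx (ξ i j) (node ε N i, y)) := Finset.sum_comm
  rw [hswap, horizontalSum, normalSum, ← Finset.sum_add_distrib]
  refine Finset.sum_congr rfl fun i _ => ?_
  rw [← Finset.sum_add_distrib]
  refine Finset.sum_congr rfl fun j _ => ?_
  simp only [boundaryIntegral, secondDeriv, dirDeriv, mul_zero, zero_mul, zero_add, add_zero,
    mul_neg, neg_mul, one_mul, mul_one, neg_neg, neg_zero, intervalIntegral.integral_neg]
  ring

/-- The integrand is cubic in n, since the tangent is linear in n; hence it is odd, and opposite
edges again have opposite signs. -/
theorem tangentialSum_eq (ε : ℝ) (N : ℕ) (u : ℝ × ℝ → ℝ) (ξ : ℕ → ℕ → ℝ × ℝ → ℝ) :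
    tangentialSum ε N u ξ = horizontalSum ε N (fun i j p => partialXY 1 1 u p * dx (ξ i j) p) +
      horizontalSum ε N (fun i j p => (partialXY 1 1 u ∘ Prod.swap) p * dx (swapFun ξ i j) p) := by
  have hswap : horizontalSum ε N
      (fun i j p => (partialXY 1 1 u ∘ Prod.swap) p * dx (swapFun ξ i j) p) =
      ∑ i ∈ Finset.range N, ∑ j ∈ Finset.range N,
        ((∫ y in node ε N j..node ε N (j + 1), partialXY 1 1 u (node ε N (i + 1), y)
            * dy (ξ i j) (node ε N (i + 1), y))
          - ∫ y in node ε N j..node ε N (j + 1), partialXY 1 1 u (node ε N i, y)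
            * dy (ξ i j) (node ε N i, y)) := Finset.sum_comm
  rw [hswap, horizontalSum, tangentialSum, ← Finset.sum_add_distrib]
  refine Finset.sum_congr rfl fun i _ => ?_
  rw [← Finset.sum_add_distrib]
  refine Finset.sum_congr rfl fun j _ => ?_
  simp only [boundaryIntegral, secondDeriv, dirDeriv, tangent, mul_zero, zero_mul, zero_add,
    add_zero, mul_neg, neg_mul, one_mul, mul_one, neg_neg, neg_zero,
    intervalIntegral.integral_neg]
  ring

theorem abs_sum_sum_le (N : ℕ) (f : ℕ → ℕ → ℝ) :
    |∑ i ∈ Finset.range N, ∑ j ∈ Finset.range N, f i j| ≤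
      ∑ i ∈ Finset.range N, ∑ j ∈ Finset.range N, |f i j| :=
  (Finset.abs_sum_le_sum_abs _ _).trans
    (Finset.sum_le_sum fun _ _ => Finset.abs_sum_le_sum_abs _ _)

theorem sum_setIntegral_congr (h : Admissible ε N) {F F' : ℝ × ℝ → ℝ}
    (hF : EqOn F F' closedSquare) (g : ℕ → ℕ → ℝ → ℝ) :
    ∑ i ∈ Finset.range N, ∑ j ∈ Finset.range N, ∫ p in cell ε N i j, F p * g i j p.1 =
      ∑ i ∈ Finset.range N, ∑ j ∈ Finset.range N, ∫ p in cell ε N i j, F' p * g i j p.1 := by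
  refine Finset.sum_congr rfl fun i hi => Finset.sum_congr rfl fun j hj => ?_
  refine setIntegral_congr_fun (measurableSet_cell ε N i j) fun p hp => ?_
  simp only [hF (h.cell_subset (Finset.mem_range.1 hi) (Finset.mem_range.1 hj) hp)]

theorem eps_sq_mul_normal_horizontal_le (h : Admissible ε N) (hu : LayerDecomposition ε C₀ u)
    (hξ : IsMorley ε N ξ) (hκ : Represents ε N κ ξ) {H : ℝ × ℝ → ℝ}
    (hH : ContDiffOn ℝ 1 H closedSquare) (hHu : EqOn (partialY H) (partialXY 0 3 u) closedSquare) :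
    ε ^ 2 * |horizontalSum ε N (fun i j p => H p * dy (ξ i j) p)| ≤
      128 * Real.exp 4 * C₀ * (√ε * (N : ℝ)⁻¹ + ε * (N : ℝ)⁻¹ * Real.log N)
        * coeffNorm ε N κ := by
  rw [horizontalSum_eq h hH (hξ.horizontalNormal h hκ)
    (g := fun i j => testFun ε N i (κ i j).c 0) (fun i j => continuous_testFun _ _ _ _ _)
    (fun i hi j hj x => by rw [hκ.dy_top hi hj]) (fun i hi j hj x => by rw [hκ.dy_bottom hi hj]),
    sum_setIntegral_congr h hHu]
  exact (mul_le_mul_of_nonneg_left (abs_sum_sum_le _ _) (sq_nonneg ε)).trans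
    (eps_sq_mul_normal_moment_le h hu)

theorem eps_sq_mul_tangential_horizontal_le (h : Admissible ε N)
    (hu : LayerDecomposition ε C₀ u) (hξ : IsMorley ε N ξ) (hκ : Represents ε N κ ξ)
    {H : ℝ × ℝ → ℝ} (hH : ContDiffOn ℝ 1 H closedSquare)
    (hHu : EqOn (partialY H) (partialXY 1 2 u) closedSquare) :
    ε ^ 2 * |horizontalSum ε N (fun i j p => H p * dx (ξ i j) p)| ≤
      256 * Real.exp 4 * C₀ * (ε * (N : ℝ)⁻¹ * Real.log N) * coeffNorm ε N κ := by
  rw [horizontalSum_eq h hH (hξ.horizontalTangential h hκ)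
    (g := fun i j => testFun ε N i (κ i j).p₁ (κ i j).p₂)
    (fun i j => continuous_testFun _ _ _ _ _)
    (fun i hi j hj x => by
      rw [hκ.dx_eq hi hj, node_succ_eq_center_add]
      ring)
    (fun i hi j hj x => by
      rw [hκ.dx_eq hi hj, node_eq_center_sub]
      ring),
    sum_setIntegral_congr h hHu]
  exact (mul_le_mul_of_nonneg_left (abs_sum_sum_le _ _) (sq_nonneg ε)).trans
    (eps_sq_mul_tangential_moment_le h hu)

theorem contDiffOn_comp_swap {n : WithTop ℕ∞} {F : ℝ × ℝ → ℝ}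
    (hF : ContDiffOn ℝ n F closedSquare) : ContDiffOn ℝ n (F ∘ Prod.swap) closedSquare :=
  hF.comp (contDiff_snd.prodMk contDiff_fst).contDiffOn fun _ hp => swap_mem_closedSquare hp

theorem partialXY_comp_swap (hu : ContDiffOn ℝ 4 u closedSquare) {i j : ℕ} (hij : i + j ≤ 4) :
    EqOn (partialXY i j u ∘ Prod.swap) (partialXY j i (u ∘ Prod.swap)) closedSquare :=
  (partialXY_swap j i (hu.of_le (by exact_mod_cast (by omega : j + i ≤ 4)))).symm

theorem eps_sq_mul_normalSum_le (h : Admissible ε N) (hu : LayerDecomposition ε C₀ u)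
    (hξ : IsMorley ε N ξ) (hκ : Represents ε N κ ξ) :
    ε ^ 2 * |normalSum ε N u ξ| ≤
      256 * Real.exp 4 * C₀ * (√ε * (N : ℝ)⁻¹ + ε * (N : ℝ)⁻¹ * Real.log N)
        * coeffNorm ε N κ := by
  have hc := hu.contDiffOn
  have b1 := eps_sq_mul_normal_horizontal_le h hu hξ hκ (H := partialXY 0 2 u)
    (by exact_mod_cast contDiffOn_partialXY (n := 1) 0 2 (hc.of_le (by norm_cast)))
    (partialY_partialXY 0 2 (hc.of_le (by norm_cast)))
  have b2 := eps_sq_mul_normal_horizontal_le h hu.swap hξ.swapFun hκ.swap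
    (H := partialXY 2 0 u ∘ Prod.swap)
    (contDiffOn_comp_swap
      (by exact_mod_cast contDiffOn_partialXY (n := 1) 2 0 (hc.of_le (by norm_cast))))
    (partialXY_comp_swap hc (i := 3) (j := 0) (by norm_num))
  rw [coeffNorm_swap] at b2
  rw [normalSum_eq]
  refine (mul_le_mul_of_nonneg_left (abs_add_le _ _) (sq_nonneg ε)).trans ?_
  linarith

theorem eps_sq_mul_tangentialSum_le (h : Admissible ε N) (hu : LayerDecomposition ε C₀ u)
    (hξ : IsMorley ε N ξ) (hκ : Represents ε N κ ξ) :
    ε ^ 2 * |tangentialSum ε N u ξ| ≤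
      512 * Real.exp 4 * C₀ * (ε * (N : ℝ)⁻¹ * Real.log N) * coeffNorm ε N κ := by
  have hc := hu.contDiffOn
  have c1 : ContDiffOn ℝ 1 (partialXY 1 1 u) closedSquare := by
    exact_mod_cast contDiffOn_partialXY (n := 1) 1 1 (hc.of_le (by norm_cast))
  have b1 := eps_sq_mul_tangential_horizontal_le h hu hξ hκ (H := partialXY 1 1 u) c1
    (partialY_partialXY 1 1 (hc.of_le (by norm_cast)))
  have b2 := eps_sq_mul_tangential_horizontal_le h hu.swap hξ.swapFun hκ.swap
    (H := partialXY 1 1 u ∘ Prod.swap) (contDiffOn_comp_swap c1)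
    (partialXY_comp_swap hc (i := 2) (j := 1) (by norm_num))
  rw [coeffNorm_swap] at b2
  rw [tangentialSum_eq]
  refine (mul_le_mul_of_nonneg_left (abs_add_le _ _) (sq_nonneg ε)).trans ?_
  linarith

/-! ### The gradient of the Laplacian and the interpolation term. -/

theorem partialX_laplacian (hu : ContDiffOn ℝ 4 u closedSquare) :
    EqOn (partialX (laplacian u)) (fun p => partialXY 3 0 u p + partialXY 1 2 u p)
      closedSquare := by
  have c1 : ContDiffOn ℝ 1 (partialXY 2 0 u) closedSquare := by
    exact_mod_cast contDiffOn_partialXY (n := 1) 2 0 (hu.of_le (by norm_cast))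
  have c2 : ContDiffOn ℝ 1 (partialXY 0 2 u) closedSquare := by
    exact_mod_cast contDiffOn_partialXY (n := 1) 0 2 (hu.of_le (by norm_cast))
  exact partialX_add c1 c2

theorem partialY_laplacian (hu : ContDiffOn ℝ 4 u closedSquare) :
    EqOn (partialY (laplacian u)) (fun p => partialXY 0 3 u p + partialXY 2 1 u p)
      closedSquare := by
  have c1 : ContDiffOn ℝ 1 (partialXY 2 0 u) closedSquare := by
    exact_mod_cast contDiffOn_partialXY (n := 1) 2 0 (hu.of_le (by norm_cast))
  have c2 : ContDiffOn ℝ 1 (partialXY 0 2 u) closedSquare := by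
    exact_mod_cast contDiffOn_partialXY (n := 1) 0 2 (hu.of_le (by norm_cast))
  intro p hp
  have h1 := partialY_add c1 c2 hp
  rw [Pi.add_apply, partialY_partialXY 2 0 (hu.of_le (by norm_cast)) hp,
    partialY_partialXY 0 2 (hu.of_le (by norm_cast)) hp] at h1
  exact h1.trans (add_comm _ _)

theorem Represents.sub_nodalInterp (h : Admissible ε N) (hκ : Represents ε N κ ξ) {i j : ℕ}
    (hi : i < N) (hj : j < N) (p : ℝ × ℝ) :
    dx (ξ i j - nodalInterp ε N ξ i j) p = testFun ε N i (κ i j).p₁ (κ i j).p₂ p.1 ∧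
    dy (ξ i j - nodalInterp ε N ξ i j) p = testFun ε N j (κ i j).q₁ (κ i j).q₂ p.2 := by
  obtain ⟨K, hK⟩ := hκ i hi j hj
  have := (κ i j).poly_sub_bilinearInterp K (h.node_lt i) (h.node_lt j)
  rw [nodalInterp, hK]
  unfold center width
  rw [this, GradCoeffs.dx_poly, GradCoeffs.dy_poly]
  simp only [testFun, linTest, quadTest, center, width]
  constructor <;> ring

theorem interpSum_eq (h : Admissible ε N) (hu : ContDiffOn ℝ 4 u closedSquare)
    (hκ : Represents ε N κ ξ) :
    interpSum ε N u ξ =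
      (∑ i ∈ Finset.range N, ∑ j ∈ Finset.range N,
        ∫ p in cell ε N i j, (partialXY 3 0 u p + partialXY 1 2 u p)
          * testFun ε N i (κ i j).p₁ (κ i j).p₂ p.1)
      + ∑ i ∈ Finset.range N, ∑ j ∈ Finset.range N,
        ∫ p in cell ε N i j,
          (partialXY 3 0 (u ∘ Prod.swap) p + partialXY 1 2 (u ∘ Prod.swap) p)
          * testFun ε N i (swapCoeffs κ i j).p₁ (swapCoeffs κ i j).p₂ p.1 := by
  have hcont : ∀ {k l : ℕ}, k + l ≤ 4 → ContinuousOn (partialXY k l u) closedSquare :=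
    fun {k l} hkl => (contDiffOn_partialXY (n := 0) k l
      (hu.of_le (by exact_mod_cast (by omega : 0 + k + l ≤ 4)))).continuousOn
  -- Reindexing the second sum makes the cell (j, i) of the exchanged problem meet the cell (i, j)
  -- of the original one.
  conv_rhs => rw [add_comm, Finset.sum_comm, add_comm]
  rw [interpSum, ← Finset.sum_add_distrib]
  refine Finset.sum_congr rfl fun i hi => ?_
  rw [← Finset.sum_add_distrib]
  refine Finset.sum_congr rfl fun j hj => ?_
  have hi' := Finset.mem_range.1 hi
  have hj' := Finset.mem_range.1 hj
  have hsub := h.cell_subset hi' hj'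
  have e1 : ∫ p in cell ε N j i,
      (partialXY 3 0 (u ∘ Prod.swap) p + partialXY 1 2 (u ∘ Prod.swap) p)
        * testFun ε N j (swapCoeffs κ j i).p₁ (swapCoeffs κ j i).p₂ p.1 =
      ∫ p in cell ε N i j, (partialXY 0 3 u p + partialXY 2 1 u p)
        * testFun ε N j (κ i j).q₁ (κ i j).q₂ p.2 := by
    rw [← setIntegral_cell_swap ε N j i]
    refine setIntegral_congr_fun (measurableSet_cell ε N j i) fun p hp => ?_
    have hp' := h.cell_subset hj' hi' hp
    simp only [← partialXY_comp_swap hu (i := 0) (j := 3) (by norm_num) hp',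
      ← partialXY_comp_swap hu (i := 2) (j := 1) (by norm_num) hp']
    rfl
  have i1 : IntegrableOn (fun p => (partialXY 3 0 u p + partialXY 1 2 u p)
      * testFun ε N i (κ i j).p₁ (κ i j).p₂ p.1) (cell ε N i j) :=
    integrableOn_cell ((((hcont (by norm_num)).mono hsub).add ((hcont (by norm_num)).mono hsub)).mul
      ((continuous_testFun _ _ _ _ _).comp continuous_fst).continuousOn)
  have i2 : IntegrableOn (fun p => (partialXY 0 3 u p + partialXY 2 1 u p)
      * testFun ε N j (κ i j).q₁ (κ i j).q₂ p.2) (cell ε N i j) :=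
    integrableOn_cell ((((hcont (by norm_num)).mono hsub).add ((hcont (by norm_num)).mono hsub)).mul
      ((continuous_testFun _ _ _ _ _).comp continuous_snd).continuousOn)
  rw [e1, ← integral_add i1 i2]
  refine setIntegral_congr_fun (measurableSet_cell ε N i j) fun p hp => ?_
  have hs := hκ.sub_nodalInterp h hi' hj' p
  simp only [partialX_laplacian hu (hsub hp), partialY_laplacian hu (hsub hp), hs.1, hs.2]

theorem eps_sq_mul_interpSum_le (h : Admissible ε N) (hu : LayerDecomposition ε C₀ u)
    (hξ : IsMorley ε N ξ) (hκ : Represents ε N κ ξ) :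
    ε ^ 2 * |interpSum ε N u ξ| ≤
      1024 * Real.exp 4 * C₀ * (√ε * (N : ℝ)⁻¹ + ε * (N : ℝ)⁻¹ * Real.log N)
        * coeffNorm ε N κ := by
  have b1 := eps_sq_mul_interp_moment_le h hu (hξ.horizontalNormal h hκ)
  have b2 := eps_sq_mul_interp_moment_le h hu.swap (hξ.swapFun.horizontalNormal h hκ.swap)
  rw [coeffNorm_swap] at b2
  rw [interpSum_eq h hu.contDiffOn hκ]
  refine (mul_le_mul_of_nonneg_left (abs_add_le _ _) (sq_nonneg ε)).trans ?_
  linarith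

end

end ShishkinMorley

/-! ### The uniform estimates. -/

theorem lemma4p1 (C₀ : ℝ) :
    ∃ C : ℝ, ∀ (ε : ℝ) (N : ℕ), 0 < ε → 0 < N → 4 ∣ N → ε * Real.log N ≤ 1 / 4 →
      ∀ u : ℝ × ℝ → ℝ, ShishkinMorley.LayerDecomposition ε C₀ u → ShishkinMorley.Clamped u →
      ∀ ξ : ℕ → ℕ → ℝ × ℝ → ℝ, ShishkinMorley.IsMorley ε N ξ →
        ε ^ 2 * |ShishkinMorley.normalSum ε N u ξ| ≤
            C * (√ε * (N : ℝ)⁻¹ + ε * (N : ℝ)⁻¹ * Real.log N + ((N : ℝ) ^ 2)⁻¹)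
              * ShishkinMorley.energyNorm ε N ξ ∧
        ε ^ 2 * |ShishkinMorley.tangentialSum ε N u ξ| ≤
            C * (ε * (N : ℝ)⁻¹ * Real.log N + ((N : ℝ) ^ 2)⁻¹)
              * ShishkinMorley.energyNorm ε N ξ ∧
        ε ^ 2 * |ShishkinMorley.interpSum ε N u ξ| ≤
            C * (√ε * (N : ℝ)⁻¹ + ε * (N : ℝ)⁻¹ * Real.log N + ((N : ℝ) ^ 2)⁻¹)
              * ShishkinMorley.energyNorm ε N ξ := by
  -- The largest of the three constants, from the interpolation term: twice 512 for the two
  -- variables.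
  refine ⟨1024 * Real.exp 4 * C₀, ?_⟩
  intro ε N hε hN h4 hlog u hu _ ξ hξ
  have h : ShishkinMorley.Admissible ε N := ⟨hε, hN, h4, hlog⟩
  obtain ⟨κ, hκ⟩ := hξ.exists_represents
  obtain ⟨A, E, D, hs⟩ := hu.exists_layerSplit
  have hC := hs.nonneg hε
  have hX : 0 ≤ ShishkinMorley.coeffNorm ε N κ := Real.sqrt_nonneg _
  have hl := h.one_le_log
  have hN2 : (0 : ℝ) ≤ ((N : ℝ) ^ 2)⁻¹ := by positivity
  rw [ShishkinMorley.energyNorm_eq h hκ]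
  refine ⟨(ShishkinMorley.eps_sq_mul_normalSum_le h hu hξ hκ).trans ?_,
    (ShishkinMorley.eps_sq_mul_tangentialSum_le h hu hξ hκ).trans ?_,
    (ShishkinMorley.eps_sq_mul_interpSum_le h hu hξ hκ).trans ?_⟩
  all_goals
    -- The bounds hold without N⁻², which is added here as a nonnegative term.
    refine mul_le_mul_of_nonneg_right (mul_le_mul ?_ (le_add_of_nonneg_right hN2)
      (by positivity) (by positivity)) hX
    gcongr <;> norm_num
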